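/- Let $0<t<1$ and let $b_1,b_2,\dots$ and $c_1,c_2,\dots$ be positive reals with $b_i=c_i$ for all $i\ge 1$. **Six vertex model.** Consider up-right paths in the quadrant $\mathbb Z_{\ge1}^2$, one path entering from the left in every row and none from below. Given positive $\{a_x\}$, with $a_xb_y<1$ in the rows under consideration, each vertex $(x,y)$ independently makes the following random choice. A path entering from the left alone goes straight with probability $\frac{1-a_xb_y}{1-ta_xb_y}$ and otherwise turns up. A path entering from below alone goes straight with probability $\frac{t(1-a_xb_y)}{1-ta_xb_y}$ and otherwise turns right. If both incoming edges are occupied, so are both outgoing ones. The height function $h(x,y)$ is the number of paths which go through or to the right of $(x,y)$. **Half-continuous six vertex model.** Paths in $\mathbb R_{\ge0}\times\mathbb Z_{\ge1}$, with all horizontal edges at $\tau=0$ occupied. There are independent Poisson processes of intensities $b_y$, $y\ge1$. At an arrival $\tau$ of the $y$-th process the path in row $y$ (if there is one) turns up. Moving up at $\tau$, it meets the rows $m=y+1,y+2,\dots$: if row $m$ is occupied just before $\tau$, both outgoing edges are occupied; if not, the path goes straight up with probability $t$ and turns right into row $m$ with probability $1-t$, independently of everything else. Its height function $h(\tau,y)$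 is the number of paths which go through or to the right of $(\tau,y)$. **Hall–Littlewood RSK dynamics.** Interlacing partitions $\lambda^{(1)}(\tau)\subset\lambda^{(2)}(\tau)\subset\cdots$, where $\lambda^{(m)}$ has $m$ rows (possibly of length $0$) and $\lambda^{(m+1)}_{i+1}\le\lambda^{(m)}_i\le\lambda^{(m+1)}_i$; all rows are $0$ at $\tau=0$. A row $\lambda^{(m)}_i$ is blocked if $\lambda^{(m)}_i=\lambda^{(m-1)}_{i-1}$, otherwise free. The nearest neighbor of $\lambda^{(m)}_i$ is the smallest free row $\lambda^{(m+1)}_j$ with $j\le i$. There are independent Poisson processes of intensities $c_k$, $k\ge1$. At an arrival of the $k$-th process the partitions $\lambda^{(m)}$, $m<k$, do not change, and in each $\lambda^{(m)}$, $m\ge k$, exactly one row increases by $1$, as follows (all conditions refer to the partitions before the change). In $\lambda^{(k)}$ it is the smallest free row. If $\lambda^{(m)}_i$ increases and $\lambda^{(m)}_i=\lambda^{(m+1)}_i$, then $\lambda^{(m+1)}_i$ increases. If $\lambda^{(m)}_i$ increases and $\lambda^{(m)}_i\ne\lambda^{(m+1)}_i$, then the nearest neighbor of $\lambda^{(m)}_i$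 increases with probability $R$, and $\lambda^{(m+1)}_{i+1}$ increases with probability $L=1-R$, the choices being independent of everything else. Let $D$ be the number of rows of $\lambda^{(m)}$ other than $\lambda^{(m)}_i$ which have the same length as $\lambda^{(m)}_i$. Then $R=1-t$ if $\lambda^{(m+1)}$ has $D+1$ rows of this length, and $R=\frac{1-t}{1-t^{D+1}}$ if it has $D$ of them. Let $l(\tau,y)$ be the length of the first column (the number of nonzero rows) of $\lambda^{(y)}(\tau)$. **Theorem.** Both random models exist. The half-continuous model is the limit of the six vertex models with all $a_x=\varepsilon/(1-t)$ and the $x$-axis rescaled to $\varepsilon\mathbb Z_{\ge1}$: as $\varepsilon\to0+$, the finite-dimensional distributions of $(\tau,y)\mapsto h(\max(\lceil\tau/\varepsilon\rceil,1),y)$ converge to those of $(\tau,y)\mapsto h(\tau,y)$ (finitely many rows are involved, and in these $a_xb_y<1$ for small $\varepsilon$). The random fields $\{h(\tau,y)\}_{\tau\in\mathbb R_{\ge0},\,y\in\mathbb Z_{\ge1}}$ and $\{y-l(\tau,y)\}_{\tau\in\mathbb R_{\ge0},\,y\in\mathbb Z_{\ge1}}$ are identically distributed. -/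

import Mathlib

open MeasureTheory ProbabilityTheory Filter Topology
open scoped NNReal

/-!
Indexing. Rows of the quadrant, columns of the quadrant, rows of a partition, parameters and Poisson
processes, which are customarily numbered from 1, are numbered from 0 here. So row `j : ℕ` is the
`(j+1)`-st row, and `b j` is its parameter. The partition `λ^(m)` keeps its number `m`; its rows are
`i = 0, …, m - 1`, and the signals of the Poisson process number `k` come to `λ^(k+1)`.
The variable `y` counts rows, so that the height function at `y` looks at the rows `j < y`.
-/

noncomputable section

/-! ### Up-right paths and vertices -/

/-- One vertex of the six vertex model: from the presence of a path at the left and at the bottom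
edge, the presence at the right and at the top edge. `turnUp` is the choice made by a path which
enters from the left alone (turn up or go straight), `keepUp` is the choice made by a path which
enters from the bottom alone (go straight or turn right). -/
def vertexOut (turnUp keepUp left bottom : Bool) : Bool × Bool :=
  match left, bottom with
  | false, false => (false, false)
  | true, true => (true, true)
  | true, false => if turnUp then (false, true) else (true, false)
  | false, true => if keepUp then (false, true) else (true, false)

/-- The bottom edges of the vertices in one column, given the choices made at the vertices and the
left edges. No path enters the column from below. -/
def columnBottom (turnUp keepUp left : ℕ → Bool) : ℕ → Bool
  | 0 => false
  | j + 1 =>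
    (vertexOut (turnUp j) (keepUp j) (left j) (columnBottom turnUp keepUp left j)).2

/-- The right edges of the vertices in one column. -/
def columnRight (turnUp keepUp left : ℕ → Bool) (j : ℕ) : Bool :=
  (vertexOut (turnUp j) (keepUp j) (left j) (columnBottom turnUp keepUp left j)).1

/-- The number of paths through or to the right of a point of height `y`, when `left j` tells whether
the horizontal edge which arrives from the left in row `j`, on the vertical line through the point,
belongs to a path. -/
def heightOf (left : ℕ → Bool) (y : ℕ) : ℕ :=
  ((Finset.range y).filter fun j => left j = true).card

/-! ### The stochastic six vertex model in the quadrant -/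

/-- The uniform distribution on `[0, 1]`. -/
def uniform01 : Measure ℝ := volume.restrict (Set.Icc 0 1)

instance : IsProbabilityMeasure uniform01 :=
  ⟨by simp [uniform01]⟩

/-- The probability that a path entering a vertex from the left alone goes straight. -/
def weightRight (t a b : ℝ) : ℝ := (1 - a * b) / (1 - t * a * b)

/-- The probability that a path entering a vertex from the bottom alone goes straight. -/
def weightUp (t a b : ℝ) : ℝ := t * (1 - a * b) / (1 - t * a * b)

/-- The horizontal edge entering the vertex `(x, j)` from the left, where the random choice at each
vertex `v` is made with the help of a number `u v`. All edges on the left boundary are occupied. -/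
def horizontalEdge (t : ℝ) (a b : ℕ → ℝ) (u : ℕ × ℕ → ℝ) : ℕ → ℕ → Bool
  | 0 => fun _ => true
  | x + 1 =>
    columnRight (fun j => decide (weightRight t (a x) (b j) ≤ u (x, j)))
      (fun j => decide (u (x, j) < weightUp t (a x) (b j))) (horizontalEdge t a b u x)

/-- The height function of the stochastic six vertex model. -/
def sixVertexHeight (t : ℝ) (a b : ℕ → ℝ) (u : ℕ × ℕ → ℝ) (x y : ℕ) : ℕ :=
  heightOf (horizontalEdge t a b u x) y

/-- The law of the choices at the vertices: they are independent and uniform on `[0, 1]`. -/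
def vertexLaw : Measure (ℕ × ℕ → ℝ) := Measure.infinitePi fun _ => uniform01

/-! ### Poisson processes and independent choices -/

/-- Independent Poisson processes number `k = 0, 1, …` with intensities `c k`, given by their
independent exponential interarrival times `gap k 0, gap k 1, …`, and, independent of them, a family
of independent uniform numbers: `coin k n m` is used for the random choice made
at level `m` at the moment of the `n`-th arrival of the process number `k`. -/
structure PoissonNoise (c : ℕ → ℝ) {Ω : Type*} [MeasurableSpace Ω] (μ : Measure Ω) where
  gap : ℕ → ℕ → Ω → ℝ
  coin : ℕ → ℕ → ℕ → Ω → ℝ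
  measurable_gap : ∀ k n, Measurable (gap k n)
  measurable_coin : ∀ k n m, Measurable (coin k n m)
  gap_law : ∀ k n, HasLaw (gap k n) (expMeasure (c k)) μ
  coin_law : ∀ k n m, HasLaw (coin k n m) uniform01 μ
  indep : iIndepFun
    (Sum.elim (fun p : ℕ × ℕ => gap p.1 p.2) (fun q : ℕ × ℕ × ℕ => coin q.1 q.2.1 q.2.2)) μ

/-- The time of the `n`-th arrival (`n = 0, 1, …`) of the Poisson process number `k`. -/
def PoissonNoise.arrival {c : ℕ → ℝ} {Ω : Type*} [MeasurableSpace Ω] {μ : Measure Ω}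
    (P : PoissonNoise c μ) (ω : Ω) (k n : ℕ) : ℝ :=
  ∑ i ∈ Finset.range (n + 1), P.gap k i ω

/-! ### The half-continuous stochastic six vertex model -/

/-- The up-right paths in `ℝ_{≥0} × {rows}`, for given arrival times and choices. Here `left τ j`
tells whether the horizontal edge which arrives at the point `(τ, j)` from the left belongs to a path.
At the `n`-th arrival of the process number `k`, a path in row `k` (if present) turns up. It goes
straight up through every vertex whose left edge is occupied, and at a vertex with
unoccupied left edge it goes straight up or turns right, according to whether the coin is `< t`. -/
structure IsHalfContinuousPaths (t : ℝ) (arrival : ℕ → ℕ → ℝ) (coin : ℕ → ℕ → ℕ → ℝ)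
    (left : ℝ≥0 → ℕ → Bool) : Prop where
  init : ∀ j, left 0 j = true
  const : ∀ (s τ : ℝ≥0) (j : ℕ), s ≤ τ →
    (∀ k ≤ j, ∀ n, ¬ ((s : ℝ) ≤ arrival k n ∧ arrival k n < τ)) → left τ j = left s j
  vertex : ∀ (τ : ℝ≥0) (k n : ℕ), arrival k n = τ → ∀ j, ∀ᶠ s in 𝓝[>] τ,
    left s j =
      columnRight (fun i => decide (i = k)) (fun i => decide (coin k n i < t)) (left τ) j

/-- A half-continuous stochastic six vertex model with parameters `t` and `b`. -/
structure HalfContinuousSixVertex (t : ℝ) (b : ℕ → ℝ) {Ω : Type*} [MeasurableSpace Ω]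
    (μ : Measure Ω) where
  noise : PoissonNoise b μ
  left : Ω → ℝ≥0 → ℕ → Bool
  paths : ∀ᵐ ω ∂μ,
    IsHalfContinuousPaths t (noise.arrival ω) (fun k n m => noise.coin k n m ω) (left ω)

/-- The height function of the half-continuous stochastic six vertex model. -/
def HalfContinuousSixVertex.height {t : ℝ} {b : ℕ → ℝ} {Ω : Type*} [MeasurableSpace Ω]
    {μ : Measure Ω} (X : HalfContinuousSixVertex t b μ) (ω : Ω) (τ : ℝ≥0) (y : ℕ) : ℕ :=
  heightOf (X.left ω τ) y

/-! ### The Hall–Littlewood RSK dynamics -/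

/-- A sequence of interlacing partitions: `row m i` is the row `i` of `λ^(m)`, which has exactly `m`
rows `i = 0, …, m - 1`, some of which may have length 0. -/
structure InterlacingArray where
  row : ℕ → ℕ → ℕ
  row_eq_zero : ∀ m i, m ≤ i → row m i = 0
  interlace : ∀ m i, i < m → row (m + 1) (i + 1) ≤ row m i ∧ row m i ≤ row (m + 1) i

namespace InterlacingArray

variable (A : InterlacingArray)

/-- A row is blocked if it equals the preceding row of the preceding partition; else it is free. -/
def IsFree (m i : ℕ) : Prop :=
  i < m ∧ (i = 0 ∨ A.row m i ≠ A.row (m - 1) (i - 1))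

/-- The row `i` is the smallest free row of `λ^(m)`. -/
def IsSmallestFree (m i : ℕ) : Prop :=
  A.IsFree m i ∧ ∀ i', A.IsFree m i' → A.row m i ≤ A.row m i'

/-- The row `j` of `λ^(m+1)` is the nearest neighbor of the row `i` of `λ^(m)`: the smallest free row
of `λ^(m+1)` with `j ≤ i`. -/
def IsNearestNeighbor (m i j : ℕ) : Prop :=
  A.IsFree (m + 1) j ∧ j ≤ i ∧
    ∀ j', A.IsFree (m + 1) j' → j' ≤ i → A.row (m + 1) j ≤ A.row (m + 1) j'

/-- The number of rows of `λ^(m)`, other than row `i`, which have the same length as row `i`. -/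
def numEqual (m i : ℕ) : ℕ :=
  ((Finset.range m).filter fun i' => i' ≠ i ∧ A.row m i' = A.row m i).card

/-- The number of rows of `λ^(m+1)` which have the same length as the row `i` of `λ^(m)`. -/
def numEqualNext (m i : ℕ) : ℕ :=
  ((Finset.range (m + 1)).filter fun j => A.row (m + 1) j = A.row m i).card

/-- The probability `R`. -/
def probRight (t : ℝ) (m i : ℕ) : ℝ :=
  if A.numEqualNext m i = A.numEqual m i + 1 then 1 - t
  else (1 - t) / (1 - t ^ (A.numEqual m i + 1))

/-- The probability `L = 1 - R`. -/
def probLeft (t : ℝ) (m i : ℕ) : ℝ := 1 - A.probRight t m i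

/-- If the row `i` of `λ^(m)` increases by one, then the row `j` of `λ^(m+1)` does. All conditions
refer to the array `A` before the change. The number `u` makes the choice:
it is `< L` with probability `L`. -/
def Propagates (t u : ℝ) (m i j : ℕ) : Prop :=
  (A.row m i = A.row (m + 1) i ∧ j = i) ∨
  (A.row m i ≠ A.row (m + 1) i ∧ u < A.probLeft t m i ∧ j = i + 1) ∨
  (A.row m i ≠ A.row (m + 1) i ∧ ¬ u < A.probLeft t m i ∧ A.IsNearestNeighbor m i j)

/-- The array `A` turns into `A'` when a signal comes to `λ^(k)`, with choices given by `u`: in each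
`λ^(m)`, `m ≥ k`, exactly one row `r m` increases by one. -/
def IsUpdate (t : ℝ) (k : ℕ) (u : ℕ → ℝ) (A' : InterlacingArray) : Prop :=
  ∃ r : ℕ → ℕ,
    (∀ m < k, A'.row m = A.row m) ∧
    (∀ m, k ≤ m → A'.row m = Function.update (A.row m) (r m) (A.row m (r m) + 1)) ∧
    A.IsSmallestFree k (r k) ∧
    ∀ m, k ≤ m → A.Propagates t (u m) m (r m) (r (m + 1))

/-- The length of the first column of `λ^(m)`, that is, the number of its nonzero rows. -/
def firstColumn (m : ℕ) : ℕ :=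
  ((Finset.range m).filter fun i => 0 < A.row m i).card

end InterlacingArray

/-- The evolution of interlacing partitions, for given arrival times and choices: the partitions
vanish at time 0, `λ^(m)` changes only at arrivals of the processes number `k < m`, and at an arrival
at time `τ` the state `A` just before `τ` is updated. -/
structure IsRSKEvolution (t : ℝ) (arrival : ℕ → ℕ → ℝ) (coin : ℕ → ℕ → ℕ → ℝ)
    (state : ℝ≥0 → InterlacingArray) : Prop where
  init : ∀ m i, (state 0).row m i = 0
  const : ∀ (s τ : ℝ≥0) (m : ℕ), s ≤ τ →
    (∀ k < m, ∀ n, ¬ ((s : ℝ) < arrival k n ∧ arrival k n ≤ τ)) →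
      (state τ).row m = (state s).row m
  jump : ∀ (τ : ℝ≥0) (k n : ℕ), arrival k n = τ → ∃ A : InterlacingArray,
    (∀ m, ∀ᶠ s in 𝓝[<] τ, (state s).row m = A.row m) ∧
      A.IsUpdate t (k + 1) (coin k n) (state τ)

/-- The Hall–Littlewood RSK dynamics with parameters `t` and `c`. -/
structure HallLittlewoodRSK (t : ℝ) (c : ℕ → ℝ) {Ω : Type*} [MeasurableSpace Ω]
    (μ : Measure Ω) where
  noise : PoissonNoise c μ
  state : Ω → ℝ≥0 → InterlacingArray
  evolution : ∀ᵐ ω ∂μ,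
    IsRSKEvolution t (noise.arrival ω) (fun k n m => noise.coin k n m ω) (state ω)

/-- The length of the first column of `λ^(y)(τ)`. -/
def HallLittlewoodRSK.firstColumn {t : ℝ} {c : ℕ → ℝ} {Ω : Type*} [MeasurableSpace Ω]
    {μ : Measure Ω} (Y : HallLittlewoodRSK t c μ) (ω : Ω) (τ : ℝ≥0) (y : ℕ) : ℕ :=
  (Y.state ω τ).firstColumn y

end

/-! The first columns of the partitions evolve by themselves, and their evolution is the
half-continuous six vertex model. Interlacing lets the first column grow by 0 or 1 from `λ^(j)` to
`λ^(j+1)`. Call the edge in row `j` occupied when it does not grow (`edge`); then `y - l` counts the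
occupied edges below `y`. When a signal arrives, call the vertical edge below row `m` occupied if
the row of `λ^(m)` that grows had length zero. Three facts give the vertex rules. The smallest free
row of `λ^(k+1)` is zero exactly when edge `k` is occupied, so the path in that row turns up. A
nonzero row only makes nonzero rows grow. A growing zero row makes a zero row grow for certain if
the edge is occupied, and otherwise with probability `L = t`, because then `λ^(m+1)` has `D + 1`
zero rows. This is `InterlacingArray.IsUpdate.edge_eq`.

Both models are therefore the same function of arrivals and coins, obtained by performing updates in
order of time (`IsHalfContinuousPaths.eq_edgesAfter`, `IsRSKEvolution.edge_eq_edgesAfter`).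
Infinitely many processes run at once, but each row depends on finitely many arrivals in bounded
time. One model looks at arrivals before `τ`, the other at arrivals up to `τ`. At a fixed time these
agree almost surely, which suffices for equal laws on the product space.

The limit is proved by coupling. Rounded exponential gaps are geometric, so for a suitable scale the
columns with an arrival are exactly independent Bernoulli trials with the turning probability of the
six vertex model (`expSequence_pattern`). Coins attached to these arrivals supply the other choices,
so a discrete model built from the same noise has exactly the six vertex law
(`eventually_vertexLaw_eq`). As `ε → 0`, almost surely the discrete model eventually has the same
arrivals before `τ`, in the same order and with the same coin decisions, hence the same paths
(`eventually_leftEdges_eq`). Dominated convergence concludes. -/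

noncomputable section

/-! ### Applying updates in the order of their times -/

section ApplyInOrder

variable {S α : Type*}

/-- The event `e` is the strictly latest one in `l`, where `a` gives the times of events. -/
def IsLast (a : ℕ × ℕ → ℝ) (l : Finset (ℕ × ℕ)) (e : ℕ × ℕ) : Prop :=
  e ∈ l ∧ ∀ e' ∈ l, e' ≠ e → a e' < a e

lemma IsLast.unique {a : ℕ × ℕ → ℝ} {l : Finset (ℕ × ℕ)} {e e' : ℕ × ℕ} (h : IsLast a l e)
    (h' : IsLast a l e') : e = e' := by
  by_contra hne
  exact lt_asymm (h.2 e' h'.1 (Ne.symm hne)) (h'.2 e h.1 hne)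

open Classical in
/-- Starting with `s₀`, apply the updates `U e`, `e ∈ l`, in the order of their times `a e`. -/
def applyInOrder (a : ℕ × ℕ → ℝ) (U : ℕ × ℕ → S → S) (s₀ : S) (l : Finset (ℕ × ℕ)) : S :=
  -- For distinct times the default `s₀` is reached only at the empty set, by `exists_isLast`.
  if h : ∃ e, IsLast a l e then U h.choose (applyInOrder a U s₀ (l.erase h.choose)) else s₀
termination_by l.card
decreasing_by exact Finset.card_erase_lt_of_mem h.choose_spec.1

variable {a : ℕ × ℕ → ℝ} {U : ℕ × ℕ → S → S} {s₀ : S} {l : Finset (ℕ × ℕ)} {e : ℕ × ℕ}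

lemma applyInOrder_empty : applyInOrder a U s₀ ∅ = s₀ := by
  rw [applyInOrder, dif_neg]
  rintro ⟨e, he⟩
  simpa using he.1

lemma applyInOrder_of_isLast (h : IsLast a l e) :
    applyInOrder a U s₀ l = U e (applyInOrder a U s₀ (l.erase e)) := by
  have hex : ∃ e, IsLast a l e := ⟨e, h⟩
  rw [applyInOrder, dif_pos hex, hex.choose_spec.unique h]

lemma isLast_insert (h : ∀ e' ∈ l, a e' < a e) : IsLast a (insert e l) e :=
  ⟨Finset.mem_insert_self _ _, fun e' he' hne =>
    h e' ((Finset.mem_insert.1 he').resolve_left hne)⟩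

lemma applyInOrder_insert (h : ∀ e' ∈ l, a e' < a e) :
    applyInOrder a U s₀ (insert e l) = U e (applyInOrder a U s₀ l) := by
  rw [applyInOrder_of_isLast (isLast_insert h), Finset.erase_insert]
  exact fun he => lt_irrefl _ (h e he)

/-- Every finite set of events with distinct times is built by adding a strictly latest event again
and again, and `applyInOrder_insert` computes each such step. -/
lemma induction_on_time {p : Finset (ℕ × ℕ) → Prop} (l : Finset (ℕ × ℕ))
    (ha : Set.InjOn a l) (empty : p ∅)
    (step : ∀ e l', (∀ e' ∈ l', a e' < a e) → insert e l' ⊆ l → p l' → p (insert e l')) : p l := by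
  induction l using Finset.induction_on_max_value a with
  | empty => exact empty
  | insert e s hes hle ih =>
    have hsub : ((s : Set (ℕ × ℕ))) ⊆ ↑(insert e s) := by simp
    refine step e s (fun e' he' => lt_of_le_of_ne (hle e' he') fun h => hes ?_) le_rfl
      (ih (ha.mono hsub) fun e' l' h1 h2 => step e' l' h1 (h2.trans (Finset.subset_insert _ _)))
    rw [← ha (hsub he') (by simp) h]
    exact he'

lemma exists_isLast (ha : Set.InjOn a l) (hl : l.Nonempty) : ∃ e, IsLast a l e := by
  obtain ⟨e, he, hmax⟩ := l.exists_max_image a hl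
  exact ⟨e, he, fun e' he' hne => lt_of_le_of_ne (hmax e' he') fun h => hne (ha he' he h)⟩

/-- Two systems of updates which preserve a relation, applied in the same order. -/
lemma applyInOrder_rel {S' : Type*} {a' : ℕ × ℕ → ℝ} {U' : ℕ × ℕ → S' → S'} {s₀' : S'}
    (R : S → S' → Prop) (ha : Set.InjOn a l)
    (hord : ∀ e ∈ l, ∀ e' ∈ l, a e < a e' → a' e < a' e') (h0 : R s₀ s₀')
    (hR : ∀ e ∈ l, ∀ s s', R s s' → R (U e s) (U' e s')) :
    R (applyInOrder a U s₀ l) (applyInOrder a' U' s₀' l) := by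
  refine induction_on_time (p := fun l => R (applyInOrder a U s₀ l) (applyInOrder a' U' s₀' l))
    l ha (by simpa only [applyInOrder_empty]) fun e l' hlt hsub ih => ?_
  rw [applyInOrder_insert hlt, applyInOrder_insert fun e' he' =>
    hord e' (hsub (Finset.mem_insert_of_mem he')) e (hsub (Finset.mem_insert_self _ _))
      (hlt e' he')]
  exact hR e (hsub (Finset.mem_insert_self _ _)) _ _ ih

/-- The coordinate `j` after an update depends on the coordinates `i ≤ j` before it only, and
an event number `k` does not change the coordinates `j < k + d`. -/
structure IsLocal (c : S → ℕ → α) (d : ℕ) (U : ℕ × ℕ → S → S) : Prop where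
  congr : ∀ e s s' j, (∀ i ≤ j, c s i = c s' i) → c (U e s) j = c (U e s') j
  eq_self : ∀ e s j, j < e.1 + d → c (U e s) j = c s j

/-- Events numbered too high leave the coordinates up to `K` alone, and the other events read only
those coordinates there, so deleting the former is invisible. This reduces infinitely many processes
to finitely many. -/
lemma IsLocal.applyInOrder_filter {c : S → ℕ → α} {d : ℕ} (hU : IsLocal c d U)
    (ha : Set.InjOn a l) {K : ℕ} : ∀ {j : ℕ}, j ≤ K →
    c (applyInOrder a U s₀ l) j = c (applyInOrder a U s₀ (l.filter fun e => e.1 + d ≤ K)) j := by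
  refine induction_on_time (p := fun l => ∀ {j : ℕ}, j ≤ K → c (applyInOrder a U s₀ l) j =
      c (applyInOrder a U s₀ (l.filter fun e => e.1 + d ≤ K)) j) l ha (by simp)
    fun e l' hlt _ ih {j} hj => ?_
  rw [applyInOrder_insert hlt, Finset.filter_insert]
  split_ifs with h
  · rw [applyInOrder_insert fun e' he' => hlt e' (Finset.mem_of_mem_filter _ he')]
    exact hU.congr _ _ _ _ fun i hi => ih (hi.trans hj)
  · rw [hU.eq_self _ _ _ (by omega), ih hj]

end ApplyInOrder

/-! ### Arrivals -/

/-- The arrival times of processes which have finitely many arrivals in bounded time, no two of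
them at the same time and none at time 0. -/
structure IsGoodArrival (a : ℕ × ℕ → ℝ) : Prop where
  pos : ∀ e, 0 < a e
  inj : Function.Injective a
  tendsto : ∀ k, Tendsto (fun n => a (k, n)) atTop atTop

/-- The arrivals at times in `T` which concern the coordinate `j`. -/
def eventSet (a : ℕ × ℕ → ℝ) (d j : ℕ) (T : Set ℝ) : Set (ℕ × ℕ) := {e | e.1 + d ≤ j ∧ a e ∈ T}

open Classical in
/-- The arrivals at times in `T` which concern the coordinate `j`, if they are finitely many. -/
def events (a : ℕ × ℕ → ℝ) (d j : ℕ) (T : Set ℝ) : Finset (ℕ × ℕ) :=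
  if h : (eventSet a d j T).Finite then h.toFinset else ∅

namespace IsGoodArrival

variable {a : ℕ × ℕ → ℝ} (ha : IsGoodArrival a) {d j : ℕ} {T : Set ℝ}
include ha

lemma finite_eventSet (hT : BddAbove T) : (eventSet a d j T).Finite := by
  obtain ⟨B, hB⟩ := hT
  have : ∀ k, ∃ N, ∀ n ≥ N, B < a (k, n) := fun k =>
    eventually_atTop.1 ((ha.tendsto k).eventually_gt_atTop B)
  choose N hN using this
  refine ((Finset.range (j + 1)).biUnion fun k =>
    (Finset.range (N k)).image fun n => (k, n)).finite_toSet.subset ?_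
  rintro ⟨k, n⟩ ⟨hk, hT⟩
  simp only [Finset.coe_biUnion, Finset.coe_image, Set.mem_iUnion, Finset.mem_coe, Finset.mem_range]
  refine ⟨k, by simp only at hk; omega, n, ?_, rfl⟩
  by_contra h
  simp only [Finset.coe_range, Set.mem_Iio, not_lt] at h
  exact absurd (hB hT) (not_le.2 (hN k n h))

lemma mem_events (hT : BddAbove T) {e : ℕ × ℕ} :
    e ∈ events a d j T ↔ e.1 + d ≤ j ∧ a e ∈ T := by
  rw [events, dif_pos (ha.finite_eventSet hT), Set.Finite.mem_toFinset]
  rfl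

/-- Only finitely many relevant arrivals lie before `τ + 1`, so there is a gap after `τ`. -/
lemma eventually_right (τ : ℝ≥0) : ∀ᶠ s : ℝ≥0 in 𝓝[>] τ,
    ∀ e, e.1 + d ≤ j → (τ : ℝ) < a e → (s : ℝ) < a e := by
  have hfin := ha.finite_eventSet (d := d) (j := j) (T := Set.Iic ((τ : ℝ) + 1)) bddAbove_Iic
  have key : ∀ x : ℝ, (τ : ℝ) < x → ∀ᶠ s : ℝ≥0 in 𝓝[>] τ, (s : ℝ) < x := fun x hx =>
    nhdsWithin_le_nhds ((NNReal.continuous_coe.tendsto τ).eventually (gt_mem_nhds hx))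
  have h1 : ∀ᶠ s : ℝ≥0 in 𝓝[>] τ, ∀ e ∈ eventSet a d j (Set.Iic ((τ : ℝ) + 1)),
      (τ : ℝ) < a e → (s : ℝ) < a e := by
    rw [eventually_all_finite hfin]
    intro e _
    by_cases h : (τ : ℝ) < a e
    · exact (key _ h).mono fun s hs _ => hs
    · exact Eventually.of_forall fun s hs => absurd hs h
  filter_upwards [h1, key (τ + 1) (by linarith)] with s hs hs' e he hτ
  by_cases h : a e ≤ τ + 1
  · exact hs e ⟨he, h⟩ hτ
  · linarith

lemma eventually_left (τ : ℝ≥0) : ∀ᶠ s : ℝ≥0 in 𝓝[<] τ,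
    ∀ e, e.1 + d ≤ j → a e < τ → a e < s := by
  have hfin := ha.finite_eventSet (d := d) (j := j) (T := Set.Iio (τ : ℝ)) bddAbove_Iio
  have h1 : ∀ᶠ s : ℝ≥0 in 𝓝[<] τ, ∀ e ∈ eventSet a d j (Set.Iio (τ : ℝ)), a e < s := by
    rw [eventually_all_finite hfin]
    exact fun e he => nhdsWithin_le_nhds
      ((NNReal.continuous_coe.tendsto τ).eventually (lt_mem_nhds he.2))
  filter_upwards [h1] with s hs e he hτ using hs e ⟨he, hτ⟩

lemma events_filter (hT : BddAbove T) {i : ℕ} (hij : i ≤ j) :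
    ((events a d j T).filter fun e => e.1 + d ≤ i) = events a d i T := by
  ext e
  rw [Finset.mem_filter, ha.mem_events hT, ha.mem_events hT]
  constructor
  · rintro ⟨⟨_, h⟩, h'⟩; exact ⟨h', h⟩
  · rintro ⟨h', h⟩; exact ⟨⟨h'.trans hij, h⟩, h'⟩

variable {S α : Type*} {c : S → ℕ → α} {U : ℕ × ℕ → S → S} {s₀ : S}

lemma coord_applyInOrder (hU : IsLocal c d U) (hT : BddAbove T) {i : ℕ} (hij : i ≤ j) :
    c (applyInOrder a U s₀ (events a d j T)) i = c (applyInOrder a U s₀ (events a d i T)) i := by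
  rw [hU.applyInOrder_filter ha.inj.injOn le_rfl, ha.events_filter hT hij]

/-- An update at the end of a time interval. -/
lemma coord_step (hU : IsLocal c d U) {T' : Set ℝ} (hT : BddAbove T) (hT' : BddAbove T')
    {e : ℕ × ℕ} (hlt : ∀ x ∈ T, x < a e)
    (h : ∀ e', e'.1 + d ≤ j → (a e' ∈ T' ↔ a e' ∈ T ∨ e' = e)) :
    c (applyInOrder a U s₀ (events a d j T')) j =
      c (U e (applyInOrder a U s₀ (events a d j T))) j := by
  by_cases he : e.1 + d ≤ j
  · have : events a d j T' = insert e (events a d j T) := by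
      ext e'
      rw [Finset.mem_insert, ha.mem_events hT, ha.mem_events hT']
      constructor
      · rintro ⟨h1, h2⟩
        rcases (h e' h1).1 h2 with h3 | h3
        · exact Or.inr ⟨h1, h3⟩
        · exact Or.inl h3
      · rintro (rfl | ⟨h1, h2⟩)
        · exact ⟨he, (h _ he).2 (Or.inr rfl)⟩
        · exact ⟨h1, (h e' h1).2 (Or.inl h2)⟩
    rw [this, applyInOrder_insert fun e' he' => hlt _ ((ha.mem_events hT).1 he').2]
  · rw [hU.eq_self _ _ _ (not_le.1 he)]
    congr 2
    ext e'
    rw [ha.mem_events hT, ha.mem_events hT']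
    refine and_congr_right fun h1 => ?_
    rw [h e' h1]
    refine or_iff_left ?_
    rintro rfl
    exact he h1

end IsGoodArrival

/-! ### Updates of interlacing arrays -/

namespace InterlacingArray

variable (A : InterlacingArray) {t : ℝ} {m i j k : ℕ}

lemma row_succ_le (m i : ℕ) : A.row m (i + 1) ≤ A.row m i := by
  by_cases h : i + 1 < m
  · obtain ⟨m, rfl⟩ : ∃ m', m = m' + 1 := ⟨m - 1, by omega⟩
    exact (A.interlace m i (by omega)).1.trans (A.interlace m i (by omega)).2
  · rw [A.row_eq_zero m (i + 1) (by omega)]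
    exact Nat.zero_le _

lemma antitone_row (m : ℕ) : Antitone (A.row m) := antitone_nat_of_succ_le (A.row_succ_le m)

lemma row_le_row_succ (m i : ℕ) : A.row m i ≤ A.row (m + 1) i := by
  by_cases h : i < m
  · exact (A.interlace m i h).2
  · rw [A.row_eq_zero m i (by omega)]
    exact Nat.zero_le _

lemma row_succ_succ_le (m i : ℕ) : A.row (m + 1) (i + 1) ≤ A.row m i := by
  by_cases h : i < m
  · exact (A.interlace m i h).1
  · rw [A.row_eq_zero (m + 1) (i + 1) (by omega)]
    exact Nat.zero_le _

lemma isFree_zero (hm : 0 < m) : A.IsFree m 0 := ⟨hm, Or.inl rfl⟩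

open Classical in
lemma exists_isSmallestFree (hm : 0 < m) : ∃ i, A.IsSmallestFree m i := by
  obtain ⟨i, hi, hmin⟩ := ((Finset.range m).filter (A.IsFree m)).exists_min_image (A.row m)
    ⟨0, by simp [hm, A.isFree_zero hm]⟩
  refine ⟨i, (Finset.mem_filter.1 hi).2, fun i' hi' => hmin i' ?_⟩
  exact Finset.mem_filter.2 ⟨Finset.mem_range.2 hi'.1, hi'⟩

open Classical in
lemma exists_isNearestNeighbor (m i : ℕ) : ∃ j, A.IsNearestNeighbor m i j := by
  obtain ⟨j, hj, hmin⟩ := ((Finset.range (i + 1)).filter (A.IsFree (m + 1))).exists_min_image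
    (A.row (m + 1)) ⟨0, by simp [A.isFree_zero (Nat.succ_pos m)]⟩
  rw [Finset.mem_filter, Finset.mem_range] at hj
  refine ⟨j, hj.2, by omega, fun j' hj' hle => hmin j' ?_⟩
  exact Finset.mem_filter.2 ⟨Finset.mem_range.2 (by omega), hj'⟩

open Classical in
/-- The row of `λ^(m+1)` which increases when the row `i` of `λ^(m)` does. -/
def nextRow (t u : ℝ) (m i : ℕ) : ℕ :=
  if A.row m i = A.row (m + 1) i then i
  else if u < A.probLeft t m i then i + 1
  -- Nothing is really chosen: by `IsFree.isFirst` the free rows of a partition have distinct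
  -- lengths, so the nearest neighbor is unique.
  else Classical.epsilon (A.IsNearestNeighbor m i)

lemma propagates_nextRow (t u : ℝ) (m i : ℕ) : A.Propagates t u m i (A.nextRow t u m i) := by
  unfold nextRow Propagates
  split_ifs with h1 h2
  · exact Or.inl ⟨h1, rfl⟩
  · exact Or.inr (Or.inl ⟨h1, h2, rfl⟩)
  · exact Or.inr (Or.inr ⟨h1, h2, Classical.epsilon_spec (A.exists_isNearestNeighbor m i)⟩)

/-- The row of `λ^(m)`, `m ≥ k`, which increases at a signal to `λ^(k)`. -/
def movedRow (t : ℝ) (k : ℕ) (u : ℕ → ℝ) : ℕ → ℕ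
  | 0 => 0
  | m + 1 =>
    if m + 1 = k then Classical.epsilon (A.IsSmallestFree (m + 1))
    else A.nextRow t (u m) m (movedRow t k u m)

lemma isSmallestFree_movedRow (t : ℝ) (hk : 0 < k) (u : ℕ → ℝ) :
    A.IsSmallestFree k (A.movedRow t k u k) := by
  obtain ⟨k, rfl⟩ : ∃ k', k = k' + 1 := ⟨k - 1, by omega⟩
  rw [movedRow, if_pos rfl]
  exact Classical.epsilon_spec (A.exists_isSmallestFree hk)

lemma propagates_movedRow (t : ℝ) (u : ℕ → ℝ) (hm : k ≤ m) :
    A.Propagates t (u m) m (A.movedRow t k u m) (A.movedRow t k u (m + 1)) := by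
  rw [movedRow, if_neg (by omega)]
  exact A.propagates_nextRow _ _ _ _

/-- The row `i` of `λ^(m)` is the first one of its length. -/
def IsFirst (m i : ℕ) : Prop := i < m ∧ (i = 0 ∨ A.row m i < A.row m (i - 1))

variable {A}

lemma IsFree.lt (h : A.IsFree m i) (hi : i ≠ 0) : A.row m i < A.row (m - 1) (i - 1) := by
  obtain ⟨m, rfl⟩ : ∃ m', m = m' + 1 := ⟨m - 1, by have := h.1; omega⟩
  obtain ⟨i, rfl⟩ : ∃ i', i = i' + 1 := ⟨i - 1, by omega⟩
  exact lt_of_le_of_ne (A.row_succ_succ_le m i) (h.2.resolve_left hi)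

lemma IsFree.isFirst (h : A.IsFree m i) : A.IsFirst m i := by
  refine ⟨h.1, or_iff_not_imp_left.2 fun hi => (h.lt hi).trans_le ?_⟩
  obtain ⟨m, rfl⟩ : ∃ m', m = m' + 1 := ⟨m - 1, by have := h.1; omega⟩
  exact A.row_le_row_succ m _

/-- Growth of the first row of its length keeps the rows weakly decreasing, so this is the invariant
to carry upwards. In the first two cases strictness comes from `λ^(m+1)_i = λ^(m)_i < λ^(m)_{i-1} ≤
λ^(m+1)_{i-1}` and from `λ^(m+1)_{i+1} ≤ λ^(m)_i < λ^(m+1)_i`. -/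
lemma Propagates.isFirst {u : ℝ} (h : A.Propagates t u m i j) (hi : A.IsFirst m i) :
    A.IsFirst (m + 1) j := by
  rcases h with ⟨h, rfl⟩ | ⟨h, _, rfl⟩ | ⟨h, _, h'⟩
  · refine ⟨hi.1.trans (Nat.lt_succ_self m), hi.2.imp_right fun h' => ?_⟩
    rw [← h]
    exact h'.trans_le (A.row_le_row_succ m _)
  · refine ⟨Nat.succ_lt_succ hi.1, Or.inr ?_⟩
    exact (A.row_succ_succ_le m i).trans_lt (lt_of_le_of_ne (A.row_le_row_succ m i) h)
  · exact h'.1.isFirst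

lemma isFirst_of_propagates {r : ℕ → ℕ} {u : ℕ → ℝ} (h0 : A.IsSmallestFree k (r k))
    (h : ∀ m, k ≤ m → A.Propagates t (u m) m (r m) (r (m + 1))) (hm : k ≤ m) :
    A.IsFirst m (r m) := by
  induction m, hm using Nat.le_induction with
  | base => exact h0.1.isFirst
  | succ m hm ih => exact (h m hm).isFirst ih

variable (A) in
/-- The rows after a signal to `λ^(k)`. -/
def updatedRow (t : ℝ) (k : ℕ) (u : ℕ → ℝ) (m : ℕ) : ℕ → ℕ :=
  if m < k then A.row m
  else Function.update (A.row m) (A.movedRow t k u m) (A.row m (A.movedRow t k u m) + 1)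

lemma le_update_add_one (f : ℕ → ℕ) (i p : ℕ) : f p ≤ Function.update f i (f i + 1) p := by
  rw [Function.update_apply]
  split_ifs with h
  · rw [h]; omega
  · exact le_rfl

/-- Row `i` of `λ^(m)` can only outgrow row `i` of `λ^(m+1)`, and if they are equal both grow. Row
`j` of `λ^(m+1)` can only outgrow row `j - 1` of `λ^(m)`: it is free, or that row grows too, or `j =
i` and the first row of its length lies strictly below its predecessor. -/
lemma Propagates.interlace {u : ℝ} (h : A.Propagates t u m i j) (hi : A.IsFirst m i) (p : ℕ) :
    Function.update (A.row (m + 1)) j (A.row (m + 1) j + 1) (p + 1) ≤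
        Function.update (A.row m) i (A.row m i + 1) p ∧
      Function.update (A.row m) i (A.row m i + 1) p ≤
        Function.update (A.row (m + 1)) j (A.row (m + 1) j + 1) p := by
  constructor
  · by_cases hj : p + 1 = j
    · subst hj
      rw [Function.update_self]
      rcases h with ⟨h, rfl⟩ | ⟨h, _, hpi⟩ | ⟨h, _, h'⟩
      · rw [Function.update_of_ne (by omega), ← h]
        exact hi.2.resolve_left (by omega)
      · obtain rfl : p = i := by omega
        rw [Function.update_self]
        exact Nat.succ_le_succ (A.row_succ_succ_le m p)
      · exact (Nat.succ_le_of_lt (h'.1.lt (by omega))).trans (le_update_add_one _ _ _)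
    · rw [Function.update_of_ne hj]
      exact (A.row_succ_succ_le m p).trans (le_update_add_one _ _ _)
  · by_cases hp : p = i
    · subst hp
      rw [Function.update_self]
      by_cases heq : A.row m p = A.row (m + 1) p
      · rcases h with ⟨h, rfl⟩ | ⟨h, _⟩ | ⟨h, _⟩
        · rw [Function.update_self, heq]
        · exact absurd heq h
        · exact absurd heq h
      · exact (Nat.succ_le_of_lt (lt_of_le_of_ne (A.row_le_row_succ m p) heq)).trans
          (le_update_add_one _ _ _)
    · rw [Function.update_of_ne hp]
      exact (A.row_le_row_succ m p).trans (le_update_add_one _ _ _)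

lemma interlace_updatedRow (t : ℝ) (hk : 0 < k) (u : ℕ → ℝ) (m p : ℕ) :
    A.updatedRow t k u (m + 1) (p + 1) ≤ A.updatedRow t k u m p ∧
      A.updatedRow t k u m p ≤ A.updatedRow t k u (m + 1) p := by
  have h0 := A.isSmallestFree_movedRow t hk u
  have hp : ∀ m, k ≤ m → _ := fun m hm => A.propagates_movedRow t u hm
  unfold updatedRow
  rcases lt_trichotomy (m + 1) k with hm | hm | hm
  · rw [if_pos hm, if_pos (by omega)]
    exact ⟨A.row_succ_succ_le m p, A.row_le_row_succ m p⟩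
  · rw [if_neg (by omega), if_pos (by omega), hm]
    refine ⟨?_, ?_⟩
    · by_cases h : p + 1 = A.movedRow t k u k
      · rw [h, Function.update_self]
        have := h0.1.lt (by omega)
        rw [show k - 1 = m by omega, show A.movedRow t k u k - 1 = p by omega] at this
        exact this
      · rw [Function.update_of_ne h, ← hm]
        exact A.row_succ_succ_le m p
    · refine le_trans ?_ (le_update_add_one _ _ _)
      rw [← hm]
      exact A.row_le_row_succ m p
  · rw [if_neg (by omega), if_neg (by omega)]
    exact (hp m (by omega)).interlace (isFirst_of_propagates h0 hp (by omega)) p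

variable (A) in
/-- The array after a signal to `λ^(k+1)`. -/
def update (t : ℝ) (k : ℕ) (u : ℕ → ℝ) : InterlacingArray where
  row := A.updatedRow t (k + 1) u
  row_eq_zero m i hmi := by
    unfold updatedRow
    split_ifs with h
    · exact A.row_eq_zero m i hmi
    · have := (isFirst_of_propagates (A.isSmallestFree_movedRow t (Nat.add_pos_right k one_pos) u)
        (fun m hm => A.propagates_movedRow t u hm) (not_lt.1 h)).1
      rw [Function.update_of_ne (by omega), A.row_eq_zero m i hmi]
  interlace m i _ := interlace_updatedRow t k.succ_pos u m i

variable (A) in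
-- The hypothesis compares one partition at a time because `arrayAfter` reads different partitions
-- off from different finite sets of events.
lemma isUpdate_of_row_eq {A' : InterlacingArray} (t : ℝ) (k : ℕ) (u : ℕ → ℝ)
    (h : ∀ m, A'.row m = (A.update t k u).row m) : A.IsUpdate t (k + 1) u A' := by
  refine ⟨A.movedRow t (k + 1) u, fun m hm => ?_, fun m hm => ?_,
    A.isSmallestFree_movedRow t (Nat.add_pos_right k one_pos) u,
    fun m hm => A.propagates_movedRow t u hm⟩
  · rw [h]; exact if_pos hm
  · rw [h]; exact if_neg (not_lt.2 hm)

variable {B : InterlacingArray}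

lemma nextRow_congr (t u : ℝ) (i : ℕ) (h : A.row m = B.row m)
    (h' : A.row (m + 1) = B.row (m + 1)) : A.nextRow t u m i = B.nextRow t u m i := by
  have h1 : A.probLeft t m i = B.probLeft t m i := by
    simp only [probLeft, probRight, numEqual, numEqualNext, h, h']
    congr
  have h2 : A.IsNearestNeighbor m i = B.IsNearestNeighbor m i := by
    funext j
    simp only [IsNearestNeighbor, IsFree, Nat.add_sub_cancel, h, h']
  simp only [nextRow, h, h', h1, h2]

lemma movedRow_congr (t : ℝ) (k : ℕ) (u : ℕ → ℝ) (h : ∀ i ≤ m, A.row i = B.row i) :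
    A.movedRow t k u m = B.movedRow t k u m := by
  induction m with
  | zero => rfl
  | succ m ih =>
    have h1 : A.IsSmallestFree (m + 1) = B.IsSmallestFree (m + 1) := by
      funext j
      simp only [IsSmallestFree, IsFree, Nat.add_sub_cancel, h m (by omega), h (m + 1) le_rfl]
    rw [movedRow, movedRow, h1, ih fun i hi => h i (by omega),
      nextRow_congr _ _ _ (h m (by omega)) (h (m + 1) le_rfl)]

/-- The shift `1` records that the process number `k` first acts on `λ^(k+1)`. -/
lemma isLocal_update (t : ℝ) (u : ℕ → ℕ → ℕ → ℝ) :
    IsLocal row 1 fun e A => A.update t e.1 (u e.1 e.2) where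
  congr e A B j h := by
    change updatedRow _ _ _ _ _ = updatedRow _ _ _ _ _
    rw [updatedRow, updatedRow, movedRow_congr _ _ _ h, h j le_rfl]
  eq_self e A j h := if_pos h

/-! ### The first column -/

/-- The rows are weakly decreasing, so the nonzero ones form an initial segment. -/
lemma pos_iff_lt_firstColumn : 0 < A.row m i ↔ i < A.firstColumn m := by
  have hanti := A.antitone_row m
  have key : ∀ i, 0 < A.row m i →
      Finset.range (i + 1) ⊆ (Finset.range m).filter fun i => 0 < A.row m i := by
    intro i hi j hj
    rw [Finset.mem_range] at hj
    have hj' : 0 < A.row m j := hi.trans_le (hanti (by omega))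
    rw [Finset.mem_filter, Finset.mem_range]
    refine ⟨?_, hj'⟩
    by_contra hmj
    rw [A.row_eq_zero m j (by omega)] at hj'
    exact lt_irrefl _ hj'
  constructor
  · intro h
    have := Finset.card_le_card (key i h)
    rw [Finset.card_range] at this
    exact this
  · intro h
    by_contra hi
    have : (Finset.range m).filter (fun i => 0 < A.row m i) ⊆ Finset.range i := by
      intro j hj
      rw [Finset.mem_range]
      by_contra hij
      exact hi ((Finset.mem_filter.1 hj).2.trans_le (hanti (by omega)))
    have := Finset.card_le_card this
    rw [Finset.card_range] at this
    exact absurd h (not_lt.2 this)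

lemma eq_zero_iff_firstColumn_le : A.row m i = 0 ↔ A.firstColumn m ≤ i := by
  rw [← not_lt, ← pos_iff_lt_firstColumn, Nat.pos_iff_ne_zero, not_not]

lemma firstColumn_le (A : InterlacingArray) (m : ℕ) : A.firstColumn m ≤ m :=
  eq_zero_iff_firstColumn_le.1 (A.row_eq_zero m m le_rfl)

lemma firstColumn_le_succ (A : InterlacingArray) (m : ℕ) :
    A.firstColumn m ≤ A.firstColumn (m + 1) := by
  have := A.row_le_row_succ m (A.firstColumn (m + 1))
  rw [eq_zero_iff_firstColumn_le.2 le_rfl, Nat.le_zero, eq_zero_iff_firstColumn_le] at this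
  exact this

/-- With `firstColumn_le_succ` this leaves only increments 0 and 1, so the first columns are encoded
by one bit per row. -/
lemma firstColumn_succ_le (A : InterlacingArray) (m : ℕ) :
    A.firstColumn (m + 1) ≤ A.firstColumn m + 1 := by
  have := A.row_succ_succ_le m (A.firstColumn m)
  rw [eq_zero_iff_firstColumn_le.2 le_rfl, Nat.le_zero, eq_zero_iff_firstColumn_le] at this
  exact this

/-- The edges of the six vertex model which correspond to an array: the number of zero rows of
`λ^(j+1)` exceeds that of `λ^(j)`. -/
def edge (A : InterlacingArray) (j : ℕ) : Bool := decide (A.firstColumn (j + 1) = A.firstColumn j)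

/-- The number of zero rows increases by one at each occupied edge and is unchanged elsewhere, so
the sum telescopes. -/
lemma heightOf_edge (A : InterlacingArray) (y : ℕ) :
    (heightOf A.edge y : ℤ) = y - A.firstColumn y := by
  induction y with
  | zero => simp [heightOf, firstColumn]
  | succ y ih =>
    have h1 := A.firstColumn_le_succ y
    have h2 := A.firstColumn_succ_le y
    have : heightOf A.edge (y + 1) = heightOf A.edge y + if A.edge y = true then 1 else 0 := by
      simp only [heightOf, Finset.card_filter, Finset.sum_range_succ]
    rw [this]
    push_cast
    rw [ih]
    by_cases h : A.firstColumn (y + 1) = A.firstColumn y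
    · rw [if_pos (by simpa [edge] using h), h]; ring
    · rw [if_neg (by simpa [edge] using h)]
      have : A.firstColumn (y + 1) = A.firstColumn y + 1 := by omega
      rw [this]; push_cast; ring

lemma firstColumn_congr {A' : InterlacingArray} (h : A'.row m = A.row m) :
    A'.firstColumn m = A.firstColumn m := by
  rw [firstColumn, firstColumn, h]

/-- A zero row which is the first of its length stands directly after the last nonzero row. -/
lemma firstColumn_of_update {A' : InterlacingArray} (hi : A.IsFirst m i)
    (h : A'.row m = Function.update (A.row m) i (A.row m i + 1)) :
    A'.firstColumn m = A.firstColumn m + if A.row m i = 0 then 1 else 0 := by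
  have key : ∀ p, p < A'.firstColumn m ↔ p < A.firstColumn m ∨ p = i := by
    intro p
    rw [← pos_iff_lt_firstColumn, ← pos_iff_lt_firstColumn, h, Function.update_apply]
    split_ifs with hp
    · simp [hp]
    · simp [hp]
  split_ifs with h0
  · have hle := eq_zero_iff_firstColumn_le.1 h0
    have hi' : i = A.firstColumn m := by
      rcases hi.2 with h' | h'
      · omega
      · have := pos_iff_lt_firstColumn.1 (Nat.zero_lt_of_lt h')
        omega
    refine eq_of_forall_lt_iff fun p => ?_
    rw [key]; omega
  · have hlt := pos_iff_lt_firstColumn.1 (Nat.pos_of_ne_zero h0)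
    refine eq_of_forall_lt_iff fun p => ?_
    rw [key]; omega

/-- The vertex rule in the row of the signal. If the columns have equal length, the first zero row
of `λ^(k+1)` is row 0 or comes after a nonzero row of `λ^(k)`, hence is free. Otherwise every zero
row of `λ^(k+1)` is blocked by a zero row of `λ^(k)`. -/
lemma IsSmallestFree.row_eq_zero_iff (h : A.IsSmallestFree (k + 1) i) :
    A.row (k + 1) i = 0 ↔ A.firstColumn (k + 1) = A.firstColumn k := by
  have h1 := A.firstColumn_le_succ k
  have h2 := A.firstColumn_succ_le k
  constructor
  · intro h0
    have hi := eq_zero_iff_firstColumn_le.1 h0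
    rcases Nat.eq_zero_or_pos i with rfl | hpos
    · omega
    · have hlt := h.1.lt (by omega)
      rw [h0, Nat.add_sub_cancel, pos_iff_lt_firstColumn] at hlt
      omega
  · intro heq
    have hle := A.firstColumn_le k
    have h0 : A.row (k + 1) (A.firstColumn k) = 0 := eq_zero_iff_firstColumn_le.2 heq.le
    have hfree : A.IsFree (k + 1) (A.firstColumn k) := by
      refine ⟨by omega, or_iff_not_imp_left.2 fun hne => ?_⟩
      rw [h0, Nat.add_sub_cancel]
      exact (pos_iff_lt_firstColumn.2 (by omega)).ne
    have := h.2 _ hfree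
    omega

/-- A nonzero row of `λ^(m)` makes a nonzero row of `λ^(m+1)` increase. -/
lemma Propagates.pos {u : ℝ} (ht : t < 1) (hu : 0 ≤ u) (h : A.Propagates t u m i j)
    (hi : A.IsFirst m i) (h0 : 0 < A.row m i) : 0 < A.row (m + 1) j := by
  rcases h with ⟨h, rfl⟩ | ⟨h, hL, rfl⟩ | ⟨h, _, h'⟩
  · rwa [← h]
  -- If row `i + 1` of `λ^(m+1)` were zero, then row `i` would be alone with its length in `λ^(m)`,
  -- and no row of `λ^(m+1)` would have that length. Thus `D = 0` and `R = (1 - t) / (1 - t) = 1`,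
  -- so `u < L = 0` is impossible.
  · by_contra hz
    rw [not_lt, Nat.le_zero] at hz
    have hlt : A.row m i < A.row (m + 1) i := lt_of_le_of_ne (A.row_le_row_succ m i) h
    have hz1 : ∀ i', i < i' → A.row (m + 1) i' = 0 := fun i' hi' =>
      Nat.le_zero.1 ((A.antitone_row (m + 1) (Nat.succ_le_of_lt hi')).trans hz.le)
    have hD : A.numEqual m i = 0 := by
      rw [numEqual, Finset.card_eq_zero, Finset.filter_eq_empty_iff]
      rintro i' _ ⟨hne, heq⟩
      rcases lt_or_gt_of_ne hne with hlt' | hlt'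
      · have h3 := hi.2.resolve_left (by omega)
        have h4 := A.antitone_row m (show i' ≤ i - 1 by omega)
        omega
      · have h3 := A.row_le_row_succ m i'
        have h4 := hz1 i' hlt'
        omega
    have hN : A.numEqualNext m i = 0 := by
      rw [numEqualNext, Finset.card_eq_zero, Finset.filter_eq_empty_iff]
      intro i' _ heq
      rcases Nat.lt_or_ge i i' with hlt' | hle
      · have := hz1 i' hlt'; omega
      · have := A.antitone_row (m + 1) hle; omega
    have ht' : (1 - t) ≠ 0 := by linarith
    have : A.probLeft t m i = 0 := by
      simp [probLeft, probRight, hD, hN, div_self ht']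
    linarith
  · exact (h0.trans_le (A.row_le_row_succ m i)).trans_le (A.antitone_row (m + 1) h'.2.1)

/-- When the first zero row of `λ^(m)` increases and `λ^(m+1)` has one zero row less than there
could be, then a zero row of `λ^(m+1)` increases with probability `t`. -/
lemma Propagates.eq_zero_iff {u : ℝ} (h : A.Propagates t u m i j) (hi : A.IsFirst m i)
    (h0 : A.row m i = 0) : A.row (m + 1) j = 0 ↔ A.edge m = true ∨ u < t := by
  have h1 := A.firstColumn_le_succ m
  have h2 := A.firstColumn_succ_le m
  have hle := eq_zero_iff_firstColumn_le.1 h0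
  have hi' : i = A.firstColumn m := by
    rcases hi.2 with h' | h'
    · omega
    · have := pos_iff_lt_firstColumn.1 (Nat.zero_lt_of_lt h')
      omega
  rw [edge, decide_eq_true_iff]
  by_cases heq : A.firstColumn (m + 1) = A.firstColumn m
  · have hz : A.row (m + 1) i = 0 := eq_zero_iff_firstColumn_le.2 (by omega)
    rcases h with ⟨_, rfl⟩ | ⟨h, _⟩ | ⟨h, _⟩
    · simp [heq, hz]
    · exact absurd (h0.trans hz.symm) h
    · exact absurd (h0.trans hz.symm) h
  · have hcol : A.firstColumn (m + 1) = A.firstColumn m + 1 := by omega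
    have hpos : 0 < A.row (m + 1) i := pos_iff_lt_firstColumn.2 (by omega)
    -- Both partitions have `m - i` zero rows, namely `D + 1`, which selects the value `R = 1 - t`.
    have hD : A.numEqual m i + 1 = m - i := by
      have : (Finset.range m).filter (fun i' => i' ≠ i ∧ A.row m i' = A.row m i) =
          Finset.Ico (i + 1) m := by
        ext p
        rw [Finset.mem_filter, Finset.mem_range, Finset.mem_Ico, h0, eq_zero_iff_firstColumn_le]
        omega
      rw [numEqual, this, Nat.card_Ico]
      have := hi.1
      omega
    have hN : A.numEqualNext m i = m - i := by
      have : (Finset.range (m + 1)).filter (fun i' => A.row (m + 1) i' = A.row m i) =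
          Finset.Ico (i + 1) (m + 1) := by
        ext p
        rw [Finset.mem_filter, Finset.mem_range, Finset.mem_Ico, h0, eq_zero_iff_firstColumn_le]
        omega
      rw [numEqualNext, this, Nat.card_Ico]
      omega
    have hL : A.probLeft t m i = t := by
      rw [probLeft, probRight, if_pos (by rw [hN, hD])]
      ring
    simp only [heq, false_or]
    rcases h with ⟨h, _⟩ | ⟨_, h, rfl⟩ | ⟨_, h, h'⟩
    · omega
    · rw [hL] at h
      exact iff_of_true (eq_zero_iff_firstColumn_le.2 (by omega)) h
    · rw [hL] at h
      refine iff_of_false ?_ h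
      rw [eq_zero_iff_firstColumn_le]
      have := h'.2.1
      omega

/-- The first column is updated like the paths in a column of the six vertex model. -/
lemma IsUpdate.edge_eq {A' : InterlacingArray} {u : ℕ → ℝ} (ht : t < 1) (hu : ∀ m, 0 ≤ u m)
    (h : A.IsUpdate t (k + 1) u A') (j : ℕ) :
    A'.edge j = columnRight (fun i => decide (i = k)) (fun i => decide (u i < t)) A.edge j := by
  obtain ⟨r, hlow, hhigh, hfree, hprop⟩ := h
  have hfirst : ∀ m, k + 1 ≤ m → A.IsFirst m (r m) := fun m hm =>
    isFirst_of_propagates hfree hprop hm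
  -- The vertical edges of the column at the arrival. They turn out to mark the levels where a zero
  -- row grows, that is, where the first column becomes longer.
  let C := columnBottom (fun i => decide (i = k)) (fun i => decide (u i < t)) A.edge
  have hC : ∀ m, (C m = true ↔ k + 1 ≤ m ∧ A.row m (r m) = 0) := by
    intro m
    induction m with
    | zero => simp [C, columnBottom]
    | succ m ih =>
      have hstep : C (m + 1) =
        (vertexOut (decide (m = k)) (decide (u m < t)) (A.edge m) (C m)).2 := rfl
      rw [hstep]
      rcases lt_trichotomy m k with hm | rfl | hm
      · have hCm : C m = false := by
          rw [← Bool.not_eq_true, ih]; omega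
        rw [hCm, decide_eq_false hm.ne]
        cases A.edge m <;> simp [vertexOut] <;> omega
      · have hCm : C m = false := by
          rw [← Bool.not_eq_true, ih]; omega
        rw [hCm, decide_eq_true rfl, hfree.row_eq_zero_iff]
        cases he : A.edge m <;> simp [edge] at he <;> simp [vertexOut, he]
      · have hmk : k + 1 ≤ m := hm
        have hmk' : k + 1 ≤ m + 1 := by omega
        rw [decide_eq_false hm.ne']
        simp only [hmk, true_and] at ih
        simp only [hmk', true_and]
        by_cases h0 : A.row m (r m) = 0
        · rw [ih.2 h0, (hprop m hmk).eq_zero_iff (hfirst m hmk) h0]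
          cases he : A.edge m <;> by_cases hut : u m < t <;> simp [vertexOut, hut]
        · have hCm : C m = false := by
            rw [← Bool.not_eq_true, ih]; exact h0
          have := (hprop m hmk).pos ht (hu m) (hfirst m hmk) (Nat.pos_of_ne_zero h0)
          rw [hCm]
          cases he : A.edge m <;> simp [vertexOut] <;> omega
  have hcol : ∀ m, A'.firstColumn m = A.firstColumn m + (C m).toNat := by
    intro m
    by_cases hm : k + 1 ≤ m
    · rw [firstColumn_of_update (hfirst m hm) (hhigh m hm)]
      by_cases h0 : A.row m (r m) = 0
      · rw [if_pos h0, (hC m).2 ⟨hm, h0⟩]; rfl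
      · have : C m = false := by rw [← Bool.not_eq_true, hC]; tauto
        rw [if_neg h0, this]; rfl
    · have : C m = false := by rw [← Bool.not_eq_true, hC]; tauto
      rw [firstColumn_congr (hlow m (by omega)), this]; rfl
  have hstep : C (j + 1) =
    (vertexOut (decide (j = k)) (decide (u j < t)) (A.edge j) (C j)).2 := rfl
  have hright : columnRight (fun i => decide (i = k)) (fun i => decide (u i < t)) A.edge j =
    (vertexOut (decide (j = k)) (decide (u j < t)) (A.edge j) (C j)).1 := rfl
  have h1 := A.firstColumn_le_succ j
  have h2 := A.firstColumn_succ_le j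
  have he : A.edge j = decide (A.firstColumn (j + 1) = A.firstColumn j) := rfl
  rw [hright, edge, hcol, hcol, hstep]
  by_cases heq : A.firstColumn (j + 1) = A.firstColumn j
  · rw [he, decide_eq_true heq, heq]
    cases C j <;> cases decide (j = k) <;> cases decide (u j < t) <;> simp [vertexOut]
  · have : A.firstColumn (j + 1) = A.firstColumn j + 1 := by omega
    rw [he, decide_eq_false heq, this]
    cases C j <;> cases decide (j = k) <;> cases decide (u j < t) <;> simp [vertexOut]

end InterlacingArray

/-! ### Columns of the six vertex model -/

/-- A vertex consults `keepUp` only when a path enters from below, so agreement is required only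
there. This matters for the discretized model, whose coins at the other vertices are unrelated. -/
lemma columnBottom_congr {T K l T' K' l' : ℕ → Bool} {j : ℕ} (hT : ∀ i < j, T i = T' i)
    (hK : ∀ i < j, columnBottom T K l i = true → K i = K' i) (hl : ∀ i < j, l i = l' i) :
    columnBottom T K l j = columnBottom T' K' l' j := by
  induction j with
  | zero => rfl
  | succ j ih =>
    have hj := ih (fun i hi => hT i (by omega)) (fun i hi => hK i (by omega))
      (fun i hi => hl i (by omega))
    rw [columnBottom, columnBottom, ← hj, hT j (by omega), hl j (by omega)]
    cases hb : columnBottom T K l j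
    · cases l' j <;> rfl
    · rw [hK j (by omega) hb]

lemma columnRight_congr {T K l T' K' l' : ℕ → Bool} {j : ℕ} (hT : ∀ i ≤ j, T i = T' i)
    (hK : ∀ i ≤ j, columnBottom T K l i = true → K i = K' i) (hl : ∀ i ≤ j, l i = l' i) :
    columnRight T K l j = columnRight T' K' l' j := by
  have hj : columnBottom T K l j = columnBottom T' K' l' j :=
    columnBottom_congr (fun i hi => hT i hi.le) (fun i hi => hK i hi.le) fun i hi => hl i hi.le
  rw [columnRight, columnRight, ← hj, hT j le_rfl, hl j le_rfl]
  cases hb : columnBottom T K l j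
  · cases l' j <;> rfl
  · rw [hK j le_rfl hb]

lemma columnBottom_eq_false {T K l : ℕ → Bool} {j : ℕ} (hT : ∀ i < j, T i = false) :
    columnBottom T K l j = false := by
  induction j with
  | zero => rfl
  | succ j ih =>
    rw [columnBottom, ih fun i hi => hT i (by omega), hT j (by omega)]
    cases l j <;> rfl

lemma columnRight_eq_left {T K l : ℕ → Bool} {j : ℕ} (hT : ∀ i ≤ j, T i = false) :
    columnRight T K l j = l j := by
  rw [columnRight, columnBottom_eq_false fun i hi => hT i hi.le, hT j le_rfl]
  cases l j <;> rfl

/-- The update of the horizontal edges when a path in row `e.1` turns up. -/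
def pathUpdate (keep : ℕ × ℕ → ℕ → Bool) (e : ℕ × ℕ) (s : ℕ → Bool) : ℕ → Bool :=
  columnRight (fun i => decide (i = e.1)) (keep e) s

lemma isLocal_pathUpdate (keep : ℕ × ℕ → ℕ → Bool) :
    IsLocal (fun s : ℕ → Bool => s) 0 (pathUpdate keep) where
  congr e s s' j h := columnRight_congr (fun _ _ => rfl) (fun _ _ _ => rfl) h
  eq_self e s j h := columnRight_eq_left fun i hi => decide_eq_false (by omega)

/-- The horizontal edges after the arrivals at times in `T`. -/
def edgesAfter (a : ℕ × ℕ → ℝ) (keep : ℕ × ℕ → ℕ → Bool) (T : Set ℝ) (j : ℕ) : Bool :=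
  applyInOrder a (pathUpdate keep) (fun _ => true) (events a 0 j T) j

/-! ### Existence and uniqueness of both evolutions for given arrivals and coins -/

section Evolution

variable {a : ℕ × ℕ → ℝ} (ha : IsGoodArrival a) {t : ℝ} {coin : ℕ → ℕ → ℕ → ℝ}
include ha

lemma IsGoodArrival.events_congr {d j : ℕ} {T T' : Set ℝ} (hT : BddAbove T) (hT' : BddAbove T')
    (h : ∀ e, e.1 + d ≤ j → (a e ∈ T ↔ a e ∈ T')) : events a d j T = events a d j T' := by
  ext e
  rw [ha.mem_events hT, ha.mem_events hT']
  exact and_congr_right fun he => h e he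

lemma IsGoodArrival.events_eq_empty {d j : ℕ} {T : Set ℝ} (hT : BddAbove T)
    (h : ∀ e, e.1 + d ≤ j → a e ∉ T) : events a d j T = ∅ := by
  rw [Finset.eq_empty_iff_forall_notMem]
  exact fun e he => h e ((ha.mem_events hT).1 he).1 ((ha.mem_events hT).1 he).2

lemma isHalfContinuousPaths_edgesAfter :
    IsHalfContinuousPaths t (fun k n => a (k, n)) coin fun τ =>
      edgesAfter a (fun e i => decide (coin e.1 e.2 i < t)) (Set.Iio (τ : ℝ)) where
  init j := by
    rw [edgesAfter, ha.events_eq_empty bddAbove_Iio, applyInOrder_empty]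
    exact fun e _ he => lt_asymm (ha.pos e) he
  const s τ j hs h := by
    rw [edgesAfter, edgesAfter, ha.events_congr bddAbove_Iio bddAbove_Iio]
    intro e he
    have := h e.1 he e.2
    have hs' : (s : ℝ) ≤ τ := hs
    simp only [Set.mem_Iio]
    constructor
    · intro h1
      by_contra h2
      exact this ⟨not_lt.1 h2, h1⟩
    · exact fun h1 => h1.trans_le hs'
  vertex τ k n hτ j := by
    filter_upwards [ha.eventually_right (d := 0) (j := j) τ, self_mem_nhdsWithin] with s hs hlt
    have hlt' : (τ : ℝ) < s := hlt
    have hU := isLocal_pathUpdate fun e i => decide (coin e.1 e.2 i < t)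
    rw [edgesAfter, ha.coord_step hU (e := (k, n)) (T := Set.Iio (τ : ℝ)) bddAbove_Iio
      bddAbove_Iio (by rw [hτ]; exact fun x hx => hx)]
    · exact hU.congr _ _ _ _ fun i hi => ha.coord_applyInOrder hU bddAbove_Iio hi
    · intro e he
      simp only [Set.mem_Iio]
      constructor
      · intro h1
        rcases lt_trichotomy (a e) τ with h2 | h2 | h2
        · exact Or.inl h2
        · exact Or.inr (ha.inj (h2.trans hτ.symm))
        · exact absurd (hs e he h2) (not_lt.2 h1.le)
      · rintro (h1 | rfl)
        · exact h1.trans hlt'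
        · rw [hτ]; exact hlt'

/-- Induction on the number of arrivals before `τ` in rows up to `j`: the edges are constant after
the last arrival, `vertex` describes the change there, and the edges at that time are covered by the
induction hypothesis. -/
lemma IsHalfContinuousPaths.eq_edgesAfter {left : ℝ≥0 → ℕ → Bool}
    (h : IsHalfContinuousPaths t (fun k n => a (k, n)) coin left) (τ : ℝ≥0) (j : ℕ) :
    left τ j = edgesAfter a (fun e i => decide (coin e.1 e.2 i < t)) (Set.Iio (τ : ℝ)) j := by
  set U := pathUpdate fun e i => decide (coin e.1 e.2 i < t) with hUdef
  have hU : IsLocal (fun s : ℕ → Bool => s) 0 U := isLocal_pathUpdate _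
  suffices H : ∀ N (τ : ℝ≥0), (events a 0 j (Set.Iio (τ : ℝ))).card = N → ∀ i ≤ j, left τ i =
      applyInOrder a U (fun _ => true) (events a 0 j (Set.Iio (τ : ℝ))) i from H _ τ rfl j le_rfl
  intro N
  induction N using Nat.strong_induction_on with
  | _ N ih =>
    intro τ hN i hi
    have hmem : ∀ (x : ℝ) (e : ℕ × ℕ), e ∈ events a 0 j (Set.Iio x) ↔ e.1 ≤ j ∧ a e < x :=
      fun x e => ha.mem_events bddAbove_Iio
    rcases (events a 0 j (Set.Iio (τ : ℝ))).eq_empty_or_nonempty with hempty | hne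
    · rw [hempty, applyInOrder_empty, ← h.init i]
      refine h.const 0 τ i (zero_le) fun k hk n hkn => ?_
      have : (k, n) ∈ events a 0 j (Set.Iio (τ : ℝ)) := (hmem _ _).2 ⟨hk.trans hi, hkn.2⟩
      simp [hempty] at this
    · obtain ⟨e, he⟩ := exists_isLast (ha.inj.injOn (s := _)) hne
      have he' := (hmem _ _).1 he.1
      have herase : (events a 0 j (Set.Iio (τ : ℝ))).erase e = events a 0 j (Set.Iio (a e)) := by
        ext e'
        rw [Finset.mem_erase, hmem, hmem]
        constructor
        · rintro ⟨h1, h2⟩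
          exact ⟨h2.1, he.2 e' ((hmem _ _).2 h2) h1⟩
        · rintro ⟨h1, h2⟩
          exact ⟨fun h3 => by rw [h3] at h2; exact lt_irrefl _ h2, h1, h2.trans he'.2⟩
      let σ : ℝ≥0 := ⟨a e, (ha.pos e).le⟩
      have hστ : σ < τ := he'.2
      -- The rule `vertex` speaks of times just after `σ`; one such time up to `τ` is enough, since
      -- no relevant arrival follows before `τ`.
      obtain ⟨s, hs, hsσ, hsτ⟩ := ((h.vertex σ e.1 e.2 rfl i).and
        (Ioc_mem_nhdsGT hστ)).exists
      rw [applyInOrder_of_isLast he, herase, h.const s τ i hsτ, hs]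
      · refine hU.congr e _ _ i fun i' hi' => ih _ ?_ σ rfl i' (hi'.trans hi)
        rw [← hN]
        change (events a 0 j (Set.Iio (a e))).card < _
        rw [← herase]
        exact Finset.card_erase_lt_of_mem he.1
      · rintro k hk n ⟨h1, h2⟩
        have h3 : a e < a (k, n) := lt_of_lt_of_le hsσ h1
        rcases eq_or_ne (k, n) e with h4 | h4
        · rw [h4] at h3; exact lt_irrefl _ h3
        · exact lt_asymm h3 (he.2 _ ((hmem _ _).2 ⟨hk.trans hi, h2⟩) h4)

/-- The same induction, with `IsUpdate.edge_eq` at the last arrival. The time interval is closed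
because the partitions have already changed at an arrival, whereas `left` still shows the incoming
edges. -/
lemma IsRSKEvolution.edge_eq_edgesAfter (ht : t < 1) (hcoin : ∀ k n m, 0 ≤ coin k n m)
    {state : ℝ≥0 → InterlacingArray}
    (h : IsRSKEvolution t (fun k n => a (k, n)) coin state) (τ : ℝ≥0) (j : ℕ) :
    (state τ).edge j =
      edgesAfter a (fun e i => decide (coin e.1 e.2 i < t)) (Set.Iic (τ : ℝ)) j := by
  set U := pathUpdate fun e i => decide (coin e.1 e.2 i < t) with hUdef
  have hU : IsLocal (fun s : ℕ → Bool => s) 0 U := isLocal_pathUpdate _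
  suffices H : ∀ N (τ : ℝ≥0), (events a 0 j (Set.Iic (τ : ℝ))).card = N → ∀ i ≤ j,
      (state τ).edge i = applyInOrder a U (fun _ => true) (events a 0 j (Set.Iic (τ : ℝ))) i from
    H _ τ rfl j le_rfl
  have hedge : ∀ {A B : InterlacingArray} {i}, A.row i = B.row i → A.row (i + 1) = B.row (i + 1) →
      A.edge i = B.edge i := fun h1 h2 => by
    rw [InterlacingArray.edge, InterlacingArray.edge, InterlacingArray.firstColumn_congr h1,
      InterlacingArray.firstColumn_congr h2]
  have hconst : ∀ (s τ : ℝ≥0) (i : ℕ), s ≤ τ →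
      (∀ k ≤ i, ∀ n, ¬ ((s : ℝ) < a (k, n) ∧ a (k, n) ≤ τ)) → (state τ).edge i = (state s).edge i :=
    fun s τ i hs h1 => hedge (h.const s τ i hs fun k hk => h1 k hk.le)
      (h.const s τ (i + 1) hs fun k hk => h1 k (Nat.le_of_lt_succ hk))
  have hinit : ∀ i, (state 0).edge i = true := by
    intro i
    have h0 : ∀ m, (state 0).firstColumn m = 0 := fun m => by
      simp [InterlacingArray.firstColumn, h.init]
    simp [InterlacingArray.edge, h0]
  intro N
  induction N using Nat.strong_induction_on with
  | _ N ih =>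
    intro τ hN i hi
    have hmem : ∀ (x : ℝ) (e : ℕ × ℕ), e ∈ events a 0 j (Set.Iic x) ↔ e.1 ≤ j ∧ a e ≤ x :=
      fun x e => ha.mem_events bddAbove_Iic
    rcases (events a 0 j (Set.Iic (τ : ℝ))).eq_empty_or_nonempty with hempty | hne
    · rw [hempty, applyInOrder_empty, ← hinit i]
      refine hconst 0 τ i (zero_le) fun k hk n hkn => ?_
      have : (k, n) ∈ events a 0 j (Set.Iic (τ : ℝ)) := (hmem _ _).2 ⟨hk.trans hi, hkn.2⟩
      simp [hempty] at this
    · obtain ⟨e, he⟩ := exists_isLast (ha.inj.injOn (s := _)) hne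
      have he' := (hmem _ _).1 he.1
      let σ : ℝ≥0 := ⟨a e, (ha.pos e).le⟩
      have hστ : σ ≤ τ := he'.2
      have hσ : (0 : ℝ≥0) < σ := ha.pos e
      obtain ⟨A, hA, hupd⟩ := h.jump σ e.1 e.2 rfl
      have hA' : ∀ᶠ s in 𝓝[<] σ, ∀ i ∈ Finset.range (j + 2), (state s).row i = A.row i := by
        rw [eventually_all_finset]
        exact fun i _ => hA i
      have := nhdsLT_neBot_of_exists_lt ⟨0, hσ⟩
      -- A time before `σ` but after all earlier relevant arrivals, at which the partitions up to
      -- `λ^(j+1)` already agree with those of `A`.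
      obtain ⟨s, ⟨hs, hsa⟩, hsσ⟩ := ((hA'.and (ha.eventually_left (d := 0) (j := j) σ)).and
        self_mem_nhdsWithin).exists
      have hsσ' : (s : ℝ) < a e := hsσ
      have hlast : ∀ e' : ℕ × ℕ, e'.1 ≤ j → a e' ≤ τ → e' ≠ e → a e' < a e := fun e' h1 h2 h3 =>
        he.2 e' ((hmem _ _).2 ⟨h1, h2⟩) h3
      have herase : (events a 0 j (Set.Iic (τ : ℝ))).erase e = events a 0 j (Set.Iic (s : ℝ)) := by
        ext e'
        rw [Finset.mem_erase, hmem, hmem]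
        constructor
        · rintro ⟨h1, h2⟩
          exact ⟨h2.1, (hsa e' h2.1 (hlast e' h2.1 h2.2 h1)).le⟩
        · rintro ⟨h1, h2⟩
          exact ⟨fun h3 => by rw [h3] at h2; linarith, h1, h2.trans (hsσ'.le.trans he'.2)⟩
      rw [applyInOrder_of_isLast he, herase, hconst σ τ i hστ, hupd.edge_eq ht (hcoin _ _)]
      · refine hU.congr e _ _ i fun i' hi' => ?_
        rw [← ih _ (by rw [← hN, ← herase]; exact Finset.card_erase_lt_of_mem he.1) s rfl i'
          (hi'.trans hi)]
        exact (hedge (hs i' (by simp; omega)) (hs (i' + 1) (by simp; omega))).symm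
      · rintro k hk n ⟨h1, h2⟩
        have h3 : a e < a (k, n) := h1
        rcases eq_or_ne (k, n) e with h4 | h4
        · rw [h4] at h3; exact lt_irrefl _ h3
        · exact lt_asymm h3 (hlast _ (hk.trans hi) h2 h4)

/-- The empty partitions. -/
def emptyArray : InterlacingArray where
  row _ _ := 0
  row_eq_zero _ _ _ := rfl
  interlace _ _ _ := ⟨le_rfl, le_rfl⟩

omit ha in
/-- The array after the arrivals at times in `T`. -/
def arrayAfter (ha : IsGoodArrival a) (t : ℝ) (coin : ℕ → ℕ → ℕ → ℝ) (T : Set ℝ)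
    (hT : BddAbove T) : InterlacingArray where
  row m := (applyInOrder a (fun e A => A.update t e.1 (coin e.1 e.2)) emptyArray
    (events a 1 m T)).row m
  row_eq_zero m i h := InterlacingArray.row_eq_zero _ m i h
  interlace m i h := by
    -- By locality `λ^(m)` can also be read off from the events that concern `λ^(m+1)`, so both
    -- partitions belong to one interlacing array.
    have := ha.coord_applyInOrder (s₀ := emptyArray) (InterlacingArray.isLocal_update t coin) hT
      (Nat.le_succ m)
    rw [← this]
    exact InterlacingArray.interlace _ m i h

lemma isRSKEvolution_arrayAfter :
    IsRSKEvolution t (fun k n => a (k, n)) coin fun τ =>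
      arrayAfter ha t coin (Set.Iic (τ : ℝ)) bddAbove_Iic where
  init m i := by
    simp only [arrayAfter]
    rw [ha.events_eq_empty bddAbove_Iic, applyInOrder_empty, emptyArray]
    exact fun e _ he => not_lt.2 he (ha.pos e)
  const s τ m hs h := by
    simp only [arrayAfter]
    rw [ha.events_congr bddAbove_Iic bddAbove_Iic]
    intro e he
    have := h e.1 he e.2
    have hs' : (s : ℝ) ≤ τ := hs
    simp only [Set.mem_Iic]
    constructor
    · intro h1
      by_contra h2
      exact this ⟨not_le.1 h2, h1⟩
    · exact fun h1 => h1.trans hs'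
  jump τ k n hτ := by
    have hU := InterlacingArray.isLocal_update t coin
    refine ⟨arrayAfter ha t coin (Set.Iio (τ : ℝ)) bddAbove_Iio, fun m => ?_,
      InterlacingArray.isUpdate_of_row_eq _ _ _ _ fun m => ?_⟩
    · filter_upwards [ha.eventually_left (d := 1) (j := m) τ, self_mem_nhdsWithin] with s hs hlt
      have hlt' : (s : ℝ) < τ := hlt
      simp only [arrayAfter]
      rw [ha.events_congr bddAbove_Iic bddAbove_Iio]
      exact fun e he => ⟨fun h => lt_of_le_of_lt h hlt', fun h => (hs e he h).le⟩
    · simp only [arrayAfter]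
      rw [ha.coord_step hU (e := (k, n)) (T := Set.Iio (τ : ℝ)) bddAbove_Iio
        bddAbove_Iic (by rw [hτ]; exact fun x hx => hx)]
      · exact hU.congr (k, n) _ _ m fun i hi => ha.coord_applyInOrder hU bddAbove_Iio hi
      · intro e he
        simp only [Set.mem_Iio, Set.mem_Iic, le_iff_lt_or_eq]
        refine or_congr_right ⟨fun h => ha.inj (h.trans hτ.symm), fun h => ?_⟩
        rw [h, hτ]

end Evolution

/-! ### The law of the noise -/

/-- The law of the interarrival times. -/
def gapLaw (c : ℕ → ℝ) : Measure (ℕ × ℕ → ℝ) := Measure.infinitePi fun p => expMeasure (c p.1)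

/-- The law of the choices. -/
def coinLaw : Measure (ℕ × ℕ × ℕ → ℝ) := Measure.infinitePi fun _ => uniform01

/-- The joint law of the interarrival times and the choices. -/
def noiseLaw (c : ℕ → ℝ) : Measure ((ℕ × ℕ → ℝ) × (ℕ × ℕ × ℕ → ℝ)) := (gapLaw c).prod coinLaw

instance : IsProbabilityMeasure coinLaw := by unfold coinLaw; infer_instance

/-- Turns independence of one family indexed by a sum type into a product of the law of the gaps and
the law of the coins, to which Fubini applies. -/
lemma map_sumElim_prod_infinitePi {ι κ X : Type*} [MeasurableSpace X] (μ : ι → Measure X)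
    (ν : κ → Measure X) [∀ i, IsProbabilityMeasure (μ i)] [∀ i, IsProbabilityMeasure (ν i)] :
    ((Measure.infinitePi μ).prod (Measure.infinitePi ν)).map (fun p => Sum.elim p.1 p.2) =
      Measure.infinitePi (Sum.elim μ ν) := by
  have : ∀ i, IsProbabilityMeasure (Sum.elim μ ν i) := by
    rintro (i | i) <;> simp only [Sum.elim_inl, Sum.elim_inr] <;> infer_instance
  have hm : Measurable fun p : (ι → X) × (κ → X) => (Sum.elim p.1 p.2 : ι ⊕ κ → X) := by
    refine measurable_pi_iff.2 ?_
    rintro (i | i)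
    · exact (measurable_pi_apply i).comp measurable_fst
    · exact (measurable_pi_apply i).comp measurable_snd
  refine Measure.eq_infinitePi _ fun s t ht => ?_
  rw [Measure.map_apply hm (MeasurableSet.pi s.countable_toSet fun i _ => ht i)]
  have hpre : (fun p : (ι → X) × (κ → X) => (Sum.elim p.1 p.2 : ι ⊕ κ → X)) ⁻¹' (Set.pi s t) =
      (Set.pi s.toLeft fun i => t (Sum.inl i)) ×ˢ (Set.pi s.toRight fun i => t (Sum.inr i)) := by
    ext p
    simp [Set.mem_pi]
  rw [hpre, Measure.prod_prod, Measure.infinitePi_pi _ (fun i _ => ht _),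
    Measure.infinitePi_pi _ (fun i _ => ht _), Finset.prod_sum_eq_prod_toLeft_mul_prod_toRight]
  simp

section Noise

variable {c : ℕ → ℝ} [hc : ∀ k, IsProbabilityMeasure (expMeasure (c k))]

instance : IsProbabilityMeasure (gapLaw c) := by unfold gapLaw; infer_instance

instance : IsProbabilityMeasure (noiseLaw c) := by unfold noiseLaw; infer_instance

/-- The noise whose components are the coordinates. -/
def coordinateNoise (c : ℕ → ℝ) [hc : ∀ k, IsProbabilityMeasure (expMeasure (c k))] :
    PoissonNoise c (noiseLaw c) where
  gap k n ω := ω.1 (k, n)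
  coin k n m ω := ω.2 (k, n, m)
  measurable_gap k n := by fun_prop
  measurable_coin k n m := by fun_prop
  gap_law k n := by
    refine ⟨by fun_prop, ?_⟩
    have : (fun ω : (ℕ × ℕ → ℝ) × (ℕ × ℕ × ℕ → ℝ) => ω.1 (k, n)) =
      (fun g => g (k, n)) ∘ Prod.fst := rfl
    rw [this, ← Measure.map_map (by fun_prop) (by fun_prop), noiseLaw, Measure.map_fst_prod,
      measure_univ, one_smul, gapLaw]
    exact Measure.infinitePi_map_eval (fun p : ℕ × ℕ => expMeasure (c p.1)) (k, n)
  coin_law k n m := by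
    refine ⟨by fun_prop, ?_⟩
    have : (fun ω : (ℕ × ℕ → ℝ) × (ℕ × ℕ × ℕ → ℝ) => ω.2 (k, n, m)) =
      (fun g => g (k, n, m)) ∘ Prod.snd := rfl
    rw [this, ← Measure.map_map (by fun_prop) (by fun_prop), noiseLaw, Measure.map_snd_prod,
      measure_univ, one_smul, coinLaw]
    exact Measure.infinitePi_map_eval (fun _ : ℕ × ℕ × ℕ => uniform01) (k, n, m)
  indep := by
    set f : ℕ × ℕ ⊕ ℕ × ℕ × ℕ → (ℕ × ℕ → ℝ) × (ℕ × ℕ × ℕ → ℝ) → ℝ :=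
      fun i ω => (Sum.elim ω.1 ω.2 : ℕ × ℕ ⊕ ℕ × ℕ × ℕ → ℝ) i with hf
    have hf' : Sum.elim (fun (p : ℕ × ℕ) (ω : (ℕ × ℕ → ℝ) × (ℕ × ℕ × ℕ → ℝ)) => ω.1 (p.1, p.2))
        (fun (q : ℕ × ℕ × ℕ) ω => ω.2 (q.1, q.2.1, q.2.2)) = f := by
      funext i ω
      rcases i with i | i <;> rfl
    rw [hf']
    have hm : ∀ i, Measurable (f i) := by
      rintro (i | i)
      · exact (measurable_pi_apply i).comp measurable_fst
      · exact (measurable_pi_apply i).comp measurable_snd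
    have hI : ∀ i, IsProbabilityMeasure
        (Sum.elim (fun p : ℕ × ℕ => expMeasure (c p.1)) (fun _ : ℕ × ℕ × ℕ => uniform01) i) := by
      rintro (i | i) <;> simp only [Sum.elim_inl, Sum.elim_inr] <;> infer_instance
    have hmap := map_sumElim_prod_infinitePi (fun p : ℕ × ℕ => expMeasure (c p.1))
      (fun _ : ℕ × ℕ × ℕ => uniform01)
    rw [iIndepFun_iff_map_fun_eq_infinitePi_map hm]
    refine hmap.trans ?_
    congr 1
    funext i
    rw [← Measure.infinitePi_map_eval
      (Sum.elim (fun p : ℕ × ℕ => expMeasure (c p.1)) (fun _ : ℕ × ℕ × ℕ => uniform01)) i, ← hmap,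
      Measure.map_map (measurable_pi_apply i) (measurable_pi_iff.2 hm)]
    rfl

/-- The interarrival times and choices as a function of the elementary event. -/
def PoissonNoise.noise {c : ℕ → ℝ} {Ω : Type*} [MeasurableSpace Ω] {μ : Measure Ω}
    (P : PoissonNoise c μ) (ω : Ω) : (ℕ × ℕ → ℝ) × (ℕ × ℕ × ℕ → ℝ) :=
  (fun p => P.gap p.1 p.2 ω, fun q => P.coin q.1 q.2.1 q.2.2 ω)

omit hc in
lemma PoissonNoise.measurable_noise {Ω : Type*} [MeasurableSpace Ω] {μ : Measure Ω}
    (P : PoissonNoise c μ) : Measurable P.noise :=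
  (measurable_pi_iff.2 fun _ => P.measurable_gap _ _).prodMk
    (measurable_pi_iff.2 fun _ => P.measurable_coin _ _ _)

/-- Independence and the marginals determine the joint law, so almost sure and distributional
statements about any noise reduce to `noiseLaw`. -/
lemma PoissonNoise.map_noise {Ω : Type*} [MeasurableSpace Ω] {μ : Measure Ω}
    (P : PoissonNoise c μ) : μ.map P.noise = noiseLaw c := by
  have hI : ∀ i, IsProbabilityMeasure
      (Sum.elim (fun p : ℕ × ℕ => expMeasure (c p.1)) (fun _ : ℕ × ℕ × ℕ => uniform01) i) := by
    rintro (i | i) <;> simp only [Sum.elim_inl, Sum.elim_inr] <;> infer_instance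
  set f := Sum.elim (fun p : ℕ × ℕ => P.gap p.1 p.2)
    (fun q : ℕ × ℕ × ℕ => P.coin q.1 q.2.1 q.2.2) with hf
  have hm : ∀ i, Measurable (f i) := by
    rintro (i | i)
    · exact P.measurable_gap _ _
    · exact P.measurable_coin _ _ _
  have h1 := P.indep.map_fun_eq_infinitePi_map hm
  have h2 : (fun i => μ.map (f i)) =
      Sum.elim (fun p : ℕ × ℕ => expMeasure (c p.1)) (fun _ : ℕ × ℕ × ℕ => uniform01) := by
    funext i
    rcases i with i | i
    · exact (P.gap_law _ _).map_eq
    · exact (P.coin_law _ _ _).map_eq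
  rw [h2, ← map_sumElim_prod_infinitePi] at h1
  let split : (ℕ × ℕ ⊕ ℕ × ℕ × ℕ → ℝ) → (ℕ × ℕ → ℝ) × (ℕ × ℕ × ℕ → ℝ) :=
    fun x => (fun p => x (Sum.inl p), fun q => x (Sum.inr q))
  have hsplit : Measurable split := by fun_prop
  have hm' : Measurable fun p : (ℕ × ℕ → ℝ) × (ℕ × ℕ × ℕ → ℝ) =>
      (Sum.elim p.1 p.2 : ℕ × ℕ ⊕ ℕ × ℕ × ℕ → ℝ) := by
    refine measurable_pi_iff.2 ?_
    rintro (i | i)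
    · exact (measurable_pi_apply i).comp measurable_fst
    · exact (measurable_pi_apply i).comp measurable_snd
  have h3 := congrArg (Measure.map split) h1
  rw [Measure.map_map hsplit (measurable_pi_iff.2 hm), Measure.map_map hsplit hm'] at h3
  exact h3.trans Measure.map_id

lemma PoissonNoise.ae_noise {Ω : Type*} [MeasurableSpace Ω] {μ : Measure Ω}
    (P : PoissonNoise c μ) {p : (ℕ × ℕ → ℝ) × (ℕ × ℕ × ℕ → ℝ) → Prop}
    (h : ∀ᵐ x ∂(noiseLaw c), p x) : ∀ᵐ ω ∂μ, p (P.noise ω) :=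
  ae_of_ae_map P.measurable_noise.aemeasurable (by rwa [P.map_noise])

/-! ### Arrival times -/

/-- The arrival times for given interarrival times. -/
def arrivalTime (g : ℕ × ℕ → ℝ) (e : ℕ × ℕ) : ℝ := ∑ i ∈ Finset.range (e.2 + 1), g (e.1, i)

@[fun_prop]
lemma measurable_arrivalTime (e : ℕ × ℕ) : Measurable fun g => arrivalTime g e := by
  unfold arrivalTime
  fun_prop

lemma nullSingletonClass_expMeasure (r : ℝ) : NullSingletonClass (expMeasure r) := by
  refine ⟨fun x => ?_⟩
  have : expMeasure r ≪ volume := by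
    unfold expMeasure gammaMeasure
    exact withDensity_absolutelyContinuous _ _
  exact this (by simp)

lemma expMeasure_Iic_zero {r : ℝ} (hr : 0 < r) : expMeasure r (Set.Iic 0) = 0 := by
  have := isProbabilityMeasure_expMeasure hr
  have h := cdf_expMeasure_eq hr 0
  rw [cdf_eq_real] at h
  simp only [le_refl, if_true, mul_zero, neg_zero, Real.exp_zero, sub_self] at h
  exact (measureReal_eq_zero_iff).1 h

lemma expMeasure_Ici {r : ℝ} (hr : 0 < r) {x : ℝ} (hx : 0 ≤ x) :
    expMeasure r (Set.Ici x) = ENNReal.ofReal (Real.exp (-(r * x))) := by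
  have := isProbabilityMeasure_expMeasure hr
  have := nullSingletonClass_expMeasure r
  have h := cdf_expMeasure_eq hr x
  rw [cdf_eq_real, if_pos hx] at h
  have h2 : (expMeasure r).real (Set.Ioi x) = Real.exp (-(r * x)) := by
    rw [← Set.compl_Iic, probReal_compl_eq_one_sub measurableSet_Iic, h]
    ring
  rw [← h2, ofReal_measureReal]
  exact measure_congr Ioi_ae_eq_Ici.symm

lemma ae_apply_gapLaw (p : ℕ × ℕ) {P : ℝ → Prop} (h : ∀ᵐ x ∂(expMeasure (c p.1)), P x) :
    ∀ᵐ g ∂(gapLaw c), P (g p) :=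
  (measurePreserving_eval_infinitePi (fun p : ℕ × ℕ => expMeasure (c p.1))
    p).quasiMeasurePreserving.ae h

lemma indepFun_sum_gapLaw {S T : Finset (ℕ × ℕ)} (hST : Disjoint S T) :
    IndepFun (fun g => ∑ p ∈ S, g p) (fun g => ∑ p ∈ T, g p) (gapLaw c) := by
  have h : iIndepFun (fun (p : ℕ × ℕ) (g : ℕ × ℕ → ℝ) => g p) (gapLaw c) :=
    iIndepFun_infinitePi (P := fun p : ℕ × ℕ => expMeasure (c p.1)) (X := fun _ x => x)
      fun _ => measurable_id
  have := (h.indepFun_finset S T hST fun p => measurable_pi_apply p).comp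
    (φ := fun x : S → ℝ => ∑ p, x p) (ψ := fun x : T → ℝ => ∑ p, x p) (by fun_prop) (by fun_prop)
  convert this using 2 with g g
  · exact (Finset.sum_coe_sort S fun p => g p).symm
  · exact (Finset.sum_coe_sort T fun p => g p).symm

omit hc in
-- Fubini on the diagonal: for each value of `Y` the fiber is a single point, which has measure zero
-- under the law of `X`.
lemma ae_ne_of_indepFun {Ω : Type*} [MeasurableSpace Ω] {μ : Measure Ω} [IsProbabilityMeasure μ]
    {X Y : Ω → ℝ} (hX : Measurable X) (hY : Measurable Y) (h : IndepFun X Y μ)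
    (hatom : ∀ x, μ.map X {x} = 0) : ∀ᵐ ω ∂μ, X ω ≠ Y ω := by
  have hXY := (indepFun_iff_map_prod_eq_prod_map_map hX.aemeasurable hY.aemeasurable).1 h
  have := Measure.isProbabilityMeasure_map (μ := μ) hX.aemeasurable
  have := Measure.isProbabilityMeasure_map (μ := μ) hY.aemeasurable
  have hD : MeasurableSet {p : ℝ × ℝ | p.1 = p.2} :=
    measurableSet_eq_fun measurable_fst measurable_snd
  have h0 : (μ.map fun ω => (X ω, Y ω)) {p : ℝ × ℝ | p.1 = p.2} = 0 := by
    rw [hXY, Measure.prod_apply_symm hD]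
    simp only [Set.preimage_ofPred_eq, Set.ofPred_eq_eq_singleton, hatom, lintegral_zero]
  rw [Measure.map_apply (hX.prodMk hY) hD] at h0
  rw [ae_iff]
  simpa using h0

/-- The first gap has no atoms and is independent of the sum of the later gaps. -/
lemma ae_arrivalTime_ne (e : ℕ × ℕ) (τ : ℝ) : ∀ᵐ g ∂(gapLaw c), arrivalTime g e ≠ τ := by
  have hdisj : Disjoint ({(e.1, 0)} : Finset (ℕ × ℕ))
      ((Finset.range e.2).image fun i => (e.1, i + 1)) := by
    simp
  have h := (indepFun_sum_gapLaw (c := c) hdisj).comp (φ := fun x => x) (ψ := fun x => τ - x)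
    measurable_id (by fun_prop)
  have h' := ae_ne_of_indepFun (by fun_prop) (by fun_prop) h fun x => by
    have : ((fun x => x) ∘ fun g : ℕ × ℕ → ℝ => ∑ p ∈ {(e.1, 0)}, g p) = fun g => g (e.1, 0) := by
      funext g; simp
    rw [this, gapLaw, Measure.infinitePi_map_eval (fun p : ℕ × ℕ => expMeasure (c p.1)) (e.1, 0)]
    exact (nullSingletonClass_expMeasure _).measure_singleton x
  filter_upwards [h'] with g hg heq
  apply hg
  simp only [Function.comp_apply, Finset.sum_singleton]
  rw [Finset.sum_image (by simp), ← heq, arrivalTime, Finset.sum_range_succ']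
  ring

lemma ae_arrivalTime_ne_arrivalTime {e e' : ℕ × ℕ} (h : e.1 ≠ e'.1) :
    ∀ᵐ g ∂(gapLaw c), arrivalTime g e ≠ arrivalTime g e' := by
  have hdisj : Disjoint ((Finset.range (e.2 + 1)).image fun i => (e.1, i))
      ((Finset.range (e'.2 + 1)).image fun i => (e'.1, i)) := by
    rw [Finset.disjoint_left]
    intro p hp hp'
    rw [Finset.mem_image] at hp hp'
    obtain ⟨i, _, rfl⟩ := hp
    obtain ⟨i', _, h'⟩ := hp'
    exact h (congrArg Prod.fst h').symm
  have hsum : ∀ e : ℕ × ℕ, (fun g : ℕ × ℕ → ℝ =>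
      ∑ p ∈ (Finset.range (e.2 + 1)).image (fun i => (e.1, i)), g p) =
      fun g => arrivalTime g e := by
    intro e
    funext g
    rw [Finset.sum_image (by simp), arrivalTime]
  have hind := indepFun_sum_gapLaw (c := c) hdisj
  rw [hsum, hsum] at hind
  refine ae_ne_of_indepFun (by fun_prop) (by fun_prop) hind fun x => ?_
  rw [Measure.map_apply (by fun_prop) (measurableSet_singleton x)]
  have := ae_arrivalTime_ne (c := c) e x
  rw [ae_iff] at this
  simpa [Set.preimage] using this

omit hc in
-- The probability that `L` given gaps are all less than 1 is `r ^ L`, which tends to 0.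
lemma ae_frequently_one_le (hpos : ∀ k, 0 < c k) (k : ℕ) :
    ∀ᵐ g ∂(gapLaw c), ∃ᶠ n in atTop, 1 ≤ g (k, n) := by
  have hc := fun k => isProbabilityMeasure_expMeasure (hpos k)
  suffices h : ∀ N, ∀ᵐ g ∂(gapLaw c), ∃ n ≥ N, 1 ≤ g (k, n) by
    filter_upwards [ae_all_iff.2 h] with g hg using frequently_atTop.2 hg
  intro N
  rw [ae_iff]
  set r := expMeasure (c k) (Set.Iio 1) with hr
  have hr1 : r < 1 := by
    rw [hr, ← Set.compl_Ici, prob_compl_eq_one_sub measurableSet_Ici,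
      expMeasure_Ici (hpos k) zero_le_one]
    exact ENNReal.sub_lt_self ENNReal.one_ne_top one_ne_zero
      (by rw [Ne, ENNReal.ofReal_eq_zero, not_le]; positivity)
  have hle : ∀ L, gapLaw c {g | ¬ ∃ n ≥ N, 1 ≤ g (k, n)} ≤ r ^ L := by
    intro L
    calc gapLaw c {g | ¬ ∃ n ≥ N, 1 ≤ g (k, n)}
        ≤ gapLaw c (Set.pi ((Finset.range L).image fun i => (k, N + i)) fun _ => Set.Iio 1) := by
          refine measure_mono fun g hg => ?_
          intro p hp
          rw [Finset.coe_image] at hp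
          obtain ⟨i, _, rfl⟩ := hp
          by_contra h
          exact hg ⟨N + i, by omega, not_lt.1 h⟩
      _ = r ^ L := by
          rw [gapLaw, Measure.infinitePi_pi _ fun _ _ => measurableSet_Iio,
            Finset.prod_image (by simp)]
          simp [hr]
  exact le_antisymm (ge_of_tendsto' (ENNReal.tendsto_pow_atTop_nhds_zero_of_lt_one hr1) hle)
    zero_le

omit hc in
lemma ae_pos_gapLaw (hpos : ∀ k, 0 < c k) : ∀ᵐ g ∂(gapLaw c), ∀ p, 0 < g p := by
  have hc := fun k => isProbabilityMeasure_expMeasure (hpos k)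
  rw [ae_all_iff]
  refine fun p => ae_apply_gapLaw p ?_
  rw [ae_iff]
  convert! expMeasure_Iic_zero (hpos p.1) using 2
  ext x
  simp

omit hc in
-- Positive gaps order the arrivals of one process, infinitely many gaps of size at least 1 make
-- them diverge, and arrival times of different processes are independent without atoms.
lemma ae_isGoodArrival (hpos : ∀ k, 0 < c k) :
    ∀ᵐ g ∂(gapLaw c), IsGoodArrival (arrivalTime g) := by
  have hc := fun k => isProbabilityMeasure_expMeasure (hpos k)
  have h1 : ∀ᵐ g ∂(gapLaw c), ∀ e e' : ℕ × ℕ, e.1 ≠ e'.1 → arrivalTime g e ≠ arrivalTime g e' := by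
    rw [ae_all_iff]; intro e
    rw [ae_all_iff]; intro e'
    by_cases h : e.1 = e'.1
    · exact ae_of_all _ fun _ h' => absurd h h'
    · exact (ae_arrivalTime_ne_arrivalTime h).mono fun g hg _ => hg
  have h2 := ae_all_iff.2 (ae_frequently_one_le hpos)
  filter_upwards [h1, h2, ae_pos_gapLaw hpos] with g h1 h2 h3
  have hstrict : ∀ k, StrictMono fun n => arrivalTime g (k, n) := fun k =>
    strictMono_nat_of_lt_succ fun n => by
      simp only [arrivalTime, Finset.sum_range_succ _ (n + 1)]
      linarith [h3 (k, n + 1)]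
  refine ⟨fun e => Finset.sum_pos (fun i _ => h3 _) ⟨0, by simp⟩, ?_, fun k => ?_⟩
  · rintro ⟨k, n⟩ ⟨k', n'⟩ h
    by_cases hk : k = k'
    · subst hk
      rw [(hstrict k).injective h]
    · exact absurd h (h1 _ _ hk)
  · have hns : ¬ Summable fun n => g (k, n) := by
      intro hs
      have := hs.tendsto_atTop_zero.eventually_lt_const one_pos
      obtain ⟨n, hn, hn'⟩ := ((h2 k).and_eventually this).exists
      linarith
    have := (not_summable_iff_tendsto_nat_atTop_of_nonneg fun n => (h3 (k, n)).le).1 hns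
    exact this.comp (tendsto_add_atTop_nat 1)

lemma ae_coinLaw (t : ℝ) : ∀ᵐ q ∂coinLaw, ∀ i, 0 ≤ q i ∧ q i ≠ t := by
  rw [ae_all_iff]
  intro i
  refine (measurePreserving_eval_infinitePi (fun _ : ℕ × ℕ × ℕ => uniform01)
    i).quasiMeasurePreserving.ae (p := fun x => 0 ≤ x ∧ x ≠ t) ?_
  have h1 : ∀ᵐ x ∂uniform01, x ∈ Set.Icc (0 : ℝ) 1 := ae_restrict_mem measurableSet_Icc
  have h2 : ∀ᵐ x ∂uniform01, x ≠ t := by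
    rw [ae_iff]
    simp [uniform01]
  filter_upwards [h1, h2] with x h1 h2 using ⟨h1.1, h2⟩

omit hc in
lemma ae_noiseLaw_fst {P : (ℕ × ℕ → ℝ) → Prop} (h : ∀ᵐ g ∂(gapLaw c), P g) :
    ∀ᵐ x ∂(noiseLaw c), P x.1 :=
  Measure.quasiMeasurePreserving_fst.ae h

omit hc in
lemma ae_noiseLaw_snd {P : (ℕ × ℕ × ℕ → ℝ) → Prop} (h : ∀ᵐ q ∂coinLaw, P q) :
    ∀ᵐ x ∂(noiseLaw c), P x.2 :=
  Measure.quasiMeasurePreserving_snd.ae h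

end Noise

/-! ### Measurability of the graphical construction -/

section Measurability

variable {Ω : Type*} [MeasurableSpace Ω]

lemma measurable_vertexOut {T K l b : Ω → Bool} (hT : Measurable T) (hK : Measurable K)
    (hl : Measurable l) (hb : Measurable b) :
    Measurable fun ω => vertexOut (T ω) (K ω) (l ω) (b ω) :=
  (Measurable.of_discrete (f := fun p : Bool × Bool × Bool × Bool =>
    vertexOut p.1 p.2.1 p.2.2.1 p.2.2.2)).comp (hT.prodMk (hK.prodMk (hl.prodMk hb)))

lemma measurable_columnBottom {T K l : Ω → ℕ → Bool} (hT : ∀ j, Measurable fun ω => T ω j)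
    (hK : ∀ j, Measurable fun ω => K ω j) (hl : ∀ j, Measurable fun ω => l ω j) (j : ℕ) :
    Measurable fun ω => columnBottom (T ω) (K ω) (l ω) j := by
  induction j with
  | zero => exact measurable_const
  | succ j ih => exact (measurable_vertexOut (hT j) (hK j) (hl j) ih).snd

lemma measurable_columnRight {T K l : Ω → ℕ → Bool} (hT : ∀ j, Measurable fun ω => T ω j)
    (hK : ∀ j, Measurable fun ω => K ω j) (hl : ∀ j, Measurable fun ω => l ω j) (j : ℕ) :
    Measurable fun ω => columnRight (T ω) (K ω) (l ω) j :=
  (measurable_vertexOut (hT j) (hK j) (hl j) (measurable_columnBottom hT hK hl j)).fst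

lemma measurable_heightOf {l : Ω → ℕ → Bool} (hl : ∀ j, Measurable fun ω => l ω j) (y : ℕ) :
    Measurable fun ω => heightOf (l ω) y := by
  simp only [heightOf, Finset.card_filter]
  refine Finset.measurable_fun_sum _ fun j _ => ?_
  exact Measurable.ite (hl j (measurableSet_singleton true)) measurable_const measurable_const

variable {a : Ω → ℕ × ℕ → ℝ} (ha : ∀ e, Measurable fun ω => a ω e)
include ha

lemma measurableSet_isLast (l : Finset (ℕ × ℕ)) (e : ℕ × ℕ) :
    MeasurableSet {ω | IsLast (a ω) l e} := by
  have : {ω | IsLast (a ω) l e} =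
      {_ω | e ∈ l} ∩ ⋂ e' ∈ l, {ω | e' ≠ e → a ω e' < a ω e} := by
    ext ω
    simp [IsLast]
  rw [this]
  refine MeasurableSet.inter (MeasurableSet.const _) (l.measurableSet_biInter fun e' _ => ?_)
  by_cases h : e' = e
  · simp [h]
  · simp only [ne_eq, h, not_false_eq_true, forall_const]
    exact measurableSet_lt (ha e') (ha e)

/-- There are only countably many finite sets of events, and each is recognized by countably many
membership conditions. -/
lemma measurableSet_events {T : Set ℝ} (hT : MeasurableSet T) (d j : ℕ) (l : Finset (ℕ × ℕ)) :
    MeasurableSet {ω | events (a ω) d j T = l} := by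
  have h1 : ∀ l : Finset (ℕ × ℕ), MeasurableSet {ω | eventSet (a ω) d j T = ↑l} := by
    intro l
    have : {ω | eventSet (a ω) d j T = ↑l} =
        ⋂ e : ℕ × ℕ, {ω | (e.1 + d ≤ j ∧ a ω e ∈ T) ↔ e ∈ l} := by
      ext ω
      simp only [Set.mem_ofPred_eq, Set.mem_iInter, Set.ext_iff]
      rfl
    rw [this]
    refine MeasurableSet.iInter fun e => ?_
    exact (MeasurableSet.inter (MeasurableSet.const _) (ha e hT)).iff (MeasurableSet.const _)
  have h2 : MeasurableSet {ω | (eventSet (a ω) d j T).Finite} := by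
    have : {ω | (eventSet (a ω) d j T).Finite} =
        ⋃ l : Finset (ℕ × ℕ), {ω | eventSet (a ω) d j T = ↑l} := by
      ext ω
      simp only [Set.mem_ofPred_eq, Set.mem_iUnion]
      exact ⟨fun h => ⟨h.toFinset, h.coe_toFinset.symm⟩, fun ⟨l, hl⟩ => hl ▸ l.finite_toSet⟩
    rw [this]
    exact MeasurableSet.iUnion h1
  have : {ω | events (a ω) d j T = l} =
      {ω | eventSet (a ω) d j T = ↑l} ∪ ({ω | (eventSet (a ω) d j T).Finite}ᶜ ∩ {_ω | l = ∅}) := by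
    ext ω
    simp only [Set.mem_ofPred_eq, Set.mem_union, Set.mem_inter_iff, Set.mem_compl_iff]
    by_cases h : (eventSet (a ω) d j T).Finite
    · rw [events, dif_pos h]
      simp only [h, not_true_eq_false, false_and, or_false]
      rw [← Finset.coe_inj, h.coe_toFinset]
    · rw [events, dif_neg h]
      simp only [h, not_false_eq_true, true_and]
      constructor
      · exact fun h' => Or.inr h'.symm
      · rintro (h' | h')
        · exact absurd (h' ▸ l.finite_toSet) h
        · exact h'.symm
  rw [this]
  exact (h1 l).union (h2.compl.inter (MeasurableSet.const _))

variable {keep : Ω → ℕ × ℕ → ℕ → Bool} (hkeep : ∀ e i, Measurable fun ω => keep ω e i)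
include hkeep

lemma measurable_applyInOrder_pathUpdate (s₀ : ℕ → Bool) (l : Finset (ℕ × ℕ)) : ∀ j,
    Measurable fun ω => applyInOrder (a ω) (pathUpdate (keep ω)) s₀ l j := by
  induction hn : l.card generalizing l with
  | zero =>
    intro j
    simp only [Finset.card_eq_zero.1 hn, applyInOrder_empty]
    exact measurable_const
  | succ n ih =>
    intro j
    refine measurable_to_bool ?_
    have : (fun ω => applyInOrder (a ω) (pathUpdate (keep ω)) s₀ l j) ⁻¹' {true} =
        (⋃ e ∈ l, {ω | IsLast (a ω) l e} ∩ {ω | columnRight (fun i => decide (i = e.1)) (keep ω e)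
          (applyInOrder (a ω) (pathUpdate (keep ω)) s₀ (l.erase e)) j = true}) ∪
        ((⋂ e ∈ l, {ω | IsLast (a ω) l e}ᶜ) ∩ {_ω | s₀ j = true}) := by
      ext ω
      simp only [Set.mem_preimage, Set.mem_singleton_iff, Set.mem_union, Set.mem_iUnion,
        Set.mem_inter_iff, Set.mem_iInter, Set.mem_compl_iff, Set.mem_ofPred_eq, exists_prop]
      by_cases h : ∃ e, IsLast (a ω) l e
      · obtain ⟨e, he⟩ := h
        rw [applyInOrder_of_isLast he]
        constructor
        · exact fun h' => Or.inl ⟨e, he.1, he, h'⟩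
        · rintro (⟨e', _, he', h'⟩ | ⟨h', _⟩)
          · rw [he.unique he']
            exact h'
          · exact absurd he (h' e he.1)
      · rw [applyInOrder, dif_neg h]
        constructor
        · exact fun h' => Or.inr ⟨fun e _ he => h ⟨e, he⟩, h'⟩
        · rintro (⟨e', _, he', _⟩ | ⟨_, h'⟩)
          · exact absurd ⟨e', he'⟩ h
          · exact h'
    rw [this]
    refine MeasurableSet.union ?_ (MeasurableSet.inter ?_ (MeasurableSet.const _))
    · refine l.measurableSet_biUnion fun e he => (measurableSet_isLast ha l e).inter ?_
      refine measurable_columnRight (T := fun _ i => decide (i = e.1)) (fun _ => measurable_const)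
        (hkeep e) (ih _ ?_) j (measurableSet_singleton true)
      rw [Finset.card_erase_of_mem he, hn, Nat.add_sub_cancel]
    · exact l.measurableSet_biInter fun e _ => (measurableSet_isLast ha l e).compl

lemma measurable_edgesAfter {T : Set ℝ} (hT : MeasurableSet T) (j : ℕ) :
    Measurable fun ω => edgesAfter (a ω) (keep ω) T j := by
  refine measurable_to_bool ?_
  have : (fun ω => edgesAfter (a ω) (keep ω) T j) ⁻¹' {true} =
      ⋃ l : Finset (ℕ × ℕ), {ω | events (a ω) 0 j T = l} ∩
        {ω | applyInOrder (a ω) (pathUpdate (keep ω)) (fun _ => true) l j = true} := by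
    ext ω
    simp [edgesAfter]
  rw [this]
  exact MeasurableSet.iUnion fun l => (measurableSet_events ha hT 0 j l).inter
    (measurable_applyInOrder_pathUpdate ha hkeep _ l j (measurableSet_singleton true))

end Measurability

/-! ### The height function as a function of the noise -/

/-- The choices of the paths which arrive from the bottom. -/
def keepCoin (t : ℝ) (q : ℕ × ℕ × ℕ → ℝ) (e : ℕ × ℕ) (i : ℕ) : Bool :=
  decide (q (e.1, e.2, i) < t)

lemma measurable_decide_lt {Ω : Type*} [MeasurableSpace Ω] {f g : Ω → ℝ} (hf : Measurable f)
    (hg : Measurable g) : Measurable fun ω => decide (f ω < g ω) := by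
  refine measurable_to_bool ?_
  have : (fun ω => decide (f ω < g ω)) ⁻¹' {true} = {ω | f ω < g ω} := by
    ext ω; simp
  rw [this]
  exact measurableSet_lt hf hg

/-- The height function after the arrivals at times in `T`. -/
def noiseHeight (t : ℝ) (T : Set ℝ) (x : (ℕ × ℕ → ℝ) × (ℕ × ℕ × ℕ → ℝ)) (y : ℕ) : ℕ :=
  heightOf (edgesAfter (arrivalTime x.1) (keepCoin t x.2) T) y

lemma measurable_noiseHeight (t : ℝ) {T : Set ℝ} (hT : MeasurableSet T) (y : ℕ) :
    Measurable fun x => noiseHeight t T x y :=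
  measurable_heightOf (fun j => measurable_edgesAfter
    (a := fun x : (ℕ × ℕ → ℝ) × (ℕ × ℕ × ℕ → ℝ) => arrivalTime x.1)
    (fun e => (measurable_arrivalTime e).comp measurable_fst)
    (keep := fun x => keepCoin t x.2) (fun _ _ => measurable_decide_lt
      ((measurable_pi_apply _).comp measurable_snd) measurable_const) hT j) y

/-! ### Existence of the models and equality of the laws of the two fields -/

section Models

variable {c : ℕ → ℝ} {t : ℝ}

lemma HalfContinuousSixVertex.ae_height_eq (hc : ∀ k, 0 < c k) {Ω : Type*} [MeasurableSpace Ω]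
    {μ : Measure Ω} (X : HalfContinuousSixVertex t c μ) :
    ∀ᵐ ω ∂μ, ∀ (τ : ℝ≥0) y, X.height ω τ y = noiseHeight t (Set.Iio (τ : ℝ)) (X.noise.noise ω) y := by
  have := fun k => isProbabilityMeasure_expMeasure (hc k)
  filter_upwards [X.paths, X.noise.ae_noise (ae_noiseLaw_fst (ae_isGoodArrival hc))] with ω h hg τ y
  have := IsHalfContinuousPaths.eq_edgesAfter hg h τ
  rw [HalfContinuousSixVertex.height, funext this]
  rfl

lemma HallLittlewoodRSK.ae_firstColumn_eq (ht : t < 1) (hc : ∀ k, 0 < c k) {Ω : Type*}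
    [MeasurableSpace Ω] {μ : Measure Ω} (Y : HallLittlewoodRSK t c μ) :
    ∀ᵐ ω ∂μ, ∀ (τ : ℝ≥0) (y : ℕ), (y : ℤ) - (Y.firstColumn ω τ y : ℤ) =
      noiseHeight t (Set.Iic (τ : ℝ)) (Y.noise.noise ω) y := by
  have := fun k => isProbabilityMeasure_expMeasure (hc k)
  filter_upwards [Y.evolution, Y.noise.ae_noise (ae_noiseLaw_fst (ae_isGoodArrival hc)),
    Y.noise.ae_noise (ae_noiseLaw_snd (c := c) (ae_coinLaw t))] with ω h hg hq τ y
  have := IsRSKEvolution.edge_eq_edgesAfter hg ht (fun k n m => (hq (k, n, m)).1) h τ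
  rw [HallLittlewoodRSK.firstColumn, ← InterlacingArray.heightOf_edge, funext this]
  rfl

/-- The two heights can differ only if some arrival happens exactly at `τ`. -/
lemma ae_noiseHeight_Iio_eq (hc : ∀ k, 0 < c k) (τ : ℝ) (y : ℕ) :
    ∀ᵐ x ∂(noiseLaw c), noiseHeight t (Set.Iio τ) x y = noiseHeight t (Set.Iic τ) x y := by
  have := fun k => isProbabilityMeasure_expMeasure (hc k)
  filter_upwards [ae_noiseLaw_fst (ae_isGoodArrival hc),
    ae_noiseLaw_fst (ae_all_iff.2 fun e => ae_arrivalTime_ne (c := c) e τ)] with x hx hne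
  rw [noiseHeight, noiseHeight]
  congr 1
  funext j
  rw [edgesAfter, edgesAfter, hx.events_congr bddAbove_Iio bddAbove_Iic]
  intro e _
  rw [Set.mem_Iio, Set.mem_Iic]
  exact ⟨le_of_lt, fun h => lt_of_le_of_ne h (hne e)⟩

lemma identDistrib_height_firstColumn (ht : t < 1) (hc : ∀ k, 0 < c k) {Ω Ω' : Type*}
    [MeasurableSpace Ω] [MeasurableSpace Ω'] {μ : Measure Ω} {ν : Measure Ω'}
    (X : HalfContinuousSixVertex t c μ) (Y : HallLittlewoodRSK t c ν) :
    IdentDistrib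
      (fun ω (p : ℝ≥0 × ℕ) => (X.height ω p.1 p.2 : ℤ))
      (fun ω (p : ℝ≥0 × ℕ) => (p.2 : ℤ) - (Y.firstColumn ω p.1 p.2 : ℤ)) μ ν := by
  have := fun k => isProbabilityMeasure_expMeasure (hc k)
  let F : (ℝ≥0 → Set ℝ) → (ℕ × ℕ → ℝ) × (ℕ × ℕ × ℕ → ℝ) → ℝ≥0 × ℕ → ℤ :=
    fun T x p => noiseHeight t (T p.1) x p.2
  have hF : ∀ T : ℝ≥0 → Set ℝ, (∀ τ, MeasurableSet (T τ)) → Measurable (F T) := fun T hT =>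
    measurable_pi_iff.2 fun p => measurable_from_top.comp (measurable_noiseHeight t (hT p.1) p.2)
  have h1 := hF (fun τ => Set.Iio τ) fun _ => measurableSet_Iio
  have h2 := hF (fun τ => Set.Iic τ) fun _ => measurableSet_Iic
  have hX : (fun ω (p : ℝ≥0 × ℕ) => (X.height ω p.1 p.2 : ℤ)) =ᵐ[μ]
      F (fun τ => Set.Iio τ) ∘ X.noise.noise := by
    filter_upwards [X.ae_height_eq hc] with ω h
    funext p
    simp only [h, F, Function.comp_apply]
  have hY : (fun ω (p : ℝ≥0 × ℕ) => (p.2 : ℤ) - (Y.firstColumn ω p.1 p.2 : ℤ)) =ᵐ[ν]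
      F (fun τ => Set.Iic τ) ∘ Y.noise.noise := by
    filter_upwards [Y.ae_firstColumn_eq ht hc] with ω h
    funext p
    simp only [h, F, Function.comp_apply]
  refine ⟨(h1.comp X.noise.measurable_noise).aemeasurable.congr hX.symm,
    (h2.comp Y.noise.measurable_noise).aemeasurable.congr hY.symm, ?_⟩
  rw [Measure.map_congr hX, Measure.map_congr hY,
    ← Measure.map_map h1 X.noise.measurable_noise, ← Measure.map_map h2 Y.noise.measurable_noise,
    X.noise.map_noise, Y.noise.map_noise]
  -- Agreement holds almost surely at each fixed point, not at all times at once; this determines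
  -- the finite-dimensional distributions and so the law on the product space.
  refine map_eq_of_forall_ae_eq (X := fun p x => F (fun τ => Set.Iio τ) x p)
    (Y := fun p x => F (fun τ => Set.Iic τ) x p) h1.aemeasurable h2.aemeasurable fun p => ?_
  filter_upwards [ae_noiseHeight_Iio_eq (t := t) hc p.1 p.2] with x hx
  simp only [F, hx]

lemma exists_halfContinuousSixVertex (hc : ∀ k, 0 < c k) :
    ∃ (Ω : Type) (_ : MeasurableSpace Ω) (μ : Measure Ω),
      IsProbabilityMeasure μ ∧ Nonempty (HalfContinuousSixVertex t c μ) := by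
  have := fun k => isProbabilityMeasure_expMeasure (hc k)
  refine ⟨_, _, noiseLaw c, inferInstance, ⟨coordinateNoise c, fun x (τ : ℝ≥0) =>
    edgesAfter (arrivalTime x.1) (keepCoin t x.2) (Set.Iio (τ : ℝ)), ?_⟩⟩
  filter_upwards [ae_noiseLaw_fst (ae_isGoodArrival hc)] with x hx
  exact isHalfContinuousPaths_edgesAfter hx (coin := fun k n m => x.2 (k, n, m))

open Classical in
lemma exists_hallLittlewoodRSK (hc : ∀ k, 0 < c k) :
    ∃ (Ω : Type) (_ : MeasurableSpace Ω) (μ : Measure Ω),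
      IsProbabilityMeasure μ ∧ Nonempty (HallLittlewoodRSK t c μ) := by
  have := fun k => isProbabilityMeasure_expMeasure (hc k)
  refine ⟨_, _, noiseLaw c, inferInstance, ⟨coordinateNoise c, fun x (τ : ℝ≥0) =>
    if hx : IsGoodArrival (arrivalTime x.1) then
      arrayAfter hx t (fun k n m => x.2 (k, n, m)) (Set.Iic (τ : ℝ)) bddAbove_Iic
    else emptyArray, ?_⟩⟩
  filter_upwards [ae_noiseLaw_fst (ae_isGoodArrival hc)] with x hx
  simp only [hx, dif_pos]
  exact isRSKEvolution_arrayAfter hx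

end Models

/-! ### Discretization of a Poisson process -/

/-- The column of the `n`-th arrival when the interarrival times `γ`, multiplied by `s`, are rounded
to integers. -/
def arrivalColumn (s : ℝ) (γ : ℕ → ℝ) (n : ℕ) : ℕ := n + ∑ i ∈ Finset.range (n + 1), ⌊γ i * s⌋₊

lemma arrivalColumn_zero (s : ℝ) (γ : ℕ → ℝ) : arrivalColumn s γ 0 = ⌊γ 0 * s⌋₊ := by
  simp [arrivalColumn]

/-- Renewal: after the first arrival the process starts afresh in the next column. The `+ 1` keeps
successive arrivals in distinct columns. -/
lemma arrivalColumn_succ (s : ℝ) (γ : ℕ → ℝ) (n : ℕ) :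
    arrivalColumn s γ (n + 1) = ⌊γ 0 * s⌋₊ + 1 + arrivalColumn s (fun i => γ (i + 1)) n := by
  rw [arrivalColumn, arrivalColumn, Finset.sum_range_succ']
  omega

lemma strictMono_arrivalColumn (s : ℝ) (γ : ℕ → ℝ) : StrictMono (arrivalColumn s γ) :=
  strictMono_nat_of_lt_succ fun n => by
    rw [arrivalColumn, arrivalColumn, Finset.sum_range_succ _ (n + 1)]
    omega

lemma measurable_arrivalColumn (s : ℝ) (n : ℕ) : Measurable fun γ => arrivalColumn s γ n := by
  unfold arrivalColumn
  refine measurable_const.add (Finset.measurable_fun_sum _ fun i _ => ?_)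
  exact Nat.measurable_floor.comp (by fun_prop)

open Classical in
/-- Whether there is an arrival in the column `x`. -/
def isArrival (D : ℕ → ℕ) (x : ℕ) : Bool := decide (∃ n, D n = x)

lemma isArrival_iff {D : ℕ → ℕ} {x : ℕ} : isArrival D x = true ↔ ∃ n, D n = x := by
  simp [isArrival]

lemma measurable_isArrival {Ω : Type*} [MeasurableSpace Ω] {D : Ω → ℕ → ℕ}
    (hD : ∀ n, Measurable fun ω => D ω n) (x : ℕ) : Measurable fun ω => isArrival (D ω) x := by
  refine measurable_to_bool ?_
  have : (fun ω => isArrival (D ω) x) ⁻¹' {true} = ⋃ n, {ω | D ω n = x} := by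
    ext ω
    simp [isArrival]
  rw [this]
  exact MeasurableSet.iUnion fun n => hD n (measurableSet_singleton x)

lemma isArrival_arrivalColumn_iff {s : ℝ} {γ : ℕ → ℝ} {x : ℕ} :
    isArrival (arrivalColumn s γ) x = true ↔ x = ⌊γ 0 * s⌋₊ ∨
      (⌊γ 0 * s⌋₊ < x ∧
        isArrival (arrivalColumn s fun i => γ (i + 1)) (x - (⌊γ 0 * s⌋₊ + 1)) = true) := by
  rw [isArrival_iff, isArrival_iff]
  constructor
  · rintro ⟨n, hn⟩
    cases n with
    | zero => exact Or.inl (by rw [← hn, arrivalColumn_zero])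
    | succ n =>
      rw [arrivalColumn_succ] at hn
      exact Or.inr ⟨by omega, n, by omega⟩
  · rintro (h | ⟨h, n, hn⟩)
    · exact ⟨0, by rw [h, arrivalColumn_zero]⟩
    · exact ⟨n + 1, by rw [arrivalColumn_succ]; omega⟩

/-- The law on `Bool` which gives `false` the probability `w`. -/
def boolLaw (w : ℝ) : Measure Bool :=
  ENNReal.ofReal (1 - w) • Measure.dirac true + ENNReal.ofReal w • Measure.dirac false

lemma boolLaw_singleton (w : ℝ) (θ : Bool) :
    boolLaw w {θ} = ENNReal.ofReal (if θ = true then 1 - w else w) := by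
  cases θ <;> simp [boolLaw]

lemma isProbabilityMeasure_boolLaw {w : ℝ} (h0 : 0 ≤ w) (h1 : w ≤ 1) :
    IsProbabilityMeasure (boolLaw w) := by
  refine ⟨?_⟩
  simp only [boolLaw, Measure.coe_add, Measure.coe_smul, Pi.add_apply, Pi.smul_apply,
    measure_univ, smul_eq_mul, mul_one]
  rw [← ENNReal.ofReal_add (by linarith) h0]
  simp

/-! ### Rounded exponential gaps and Bernoulli trials -/

section OneProcess

variable {r : ℝ}

/-- The law of independent exponential interarrival times. -/
def expSequence (r : ℝ) : Measure (ℕ → ℝ) := Measure.infinitePi fun _ => expMeasure r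

/-- The head is independent of the tail, and the tail has the law of the whole sequence. Writing the
index set as a point and a copy of `ℕ` makes this a product measure. -/
lemma expSequence_head_tail [IsProbabilityMeasure (expMeasure r)] {A : Set ℝ}
    (hA : MeasurableSet A) {E : Set (ℕ → ℝ)} (hE : MeasurableSet E) :
    expSequence r {γ | γ 0 ∈ A ∧ (fun i => γ (i + 1)) ∈ E} = expMeasure r A * expSequence r E := by
  let f : ℕ → Unit ⊕ ℕ := fun n => Nat.casesOn n (Sum.inl ()) Sum.inr
  have hf : Function.Injective f := by
    rintro (_ | m) (_ | n) h <;> simp_all [f]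
  have hI : ∀ i : Unit ⊕ ℕ, IsProbabilityMeasure
      ((Sum.elim (fun _ : Unit => expMeasure r) fun _ : ℕ => expMeasure r) i) := by
    rintro (i | i) <;> simp only [Sum.elim_inl, Sum.elim_inr] <;> infer_instance
  have h1 := Measure.map_infinitePi_infinitePi_of_inj
    (P := Sum.elim (fun _ : Unit => expMeasure r) fun _ : ℕ => expMeasure r) hf
  have h2 : (fun i => Sum.elim (fun _ : Unit => expMeasure r) (fun _ : ℕ => expMeasure r) (f i)) =
      fun _ => expMeasure r := by
    funext n; cases n <;> rfl
  have hm : Measurable fun p : (Unit → ℝ) × (ℕ → ℝ) => (Sum.elim p.1 p.2 : Unit ⊕ ℕ → ℝ) := by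
    refine measurable_pi_iff.2 ?_
    rintro (i | i)
    · exact (measurable_pi_apply i).comp measurable_fst
    · exact (measurable_pi_apply i).comp measurable_snd
  have hm' : Measurable fun (ω : Unit ⊕ ℕ → ℝ) (i : ℕ) => ω (f i) := by fun_prop
  rw [← map_sumElim_prod_infinitePi, h2, Measure.map_map hm' hm] at h1
  have hset : MeasurableSet {γ : ℕ → ℝ | γ 0 ∈ A ∧ (fun i => γ (i + 1)) ∈ E} :=
    (measurable_pi_apply 0 hA).inter
      ((measurable_pi_iff.2 fun i => measurable_pi_apply (i + 1)) hE)
  rw [expSequence, ← h1, Measure.map_apply (hm'.comp hm) hset]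
  have hpre : ((fun (ω : Unit ⊕ ℕ → ℝ) (i : ℕ) => ω (f i)) ∘
      fun p : (Unit → ℝ) × (ℕ → ℝ) => (Sum.elim p.1 p.2 : Unit ⊕ ℕ → ℝ)) ⁻¹'
      {γ : ℕ → ℝ | γ 0 ∈ A ∧ (fun i => γ (i + 1)) ∈ E} =
      ((fun u : Unit → ℝ => u ()) ⁻¹' A) ×ˢ E := rfl
  rw [hpre, Measure.prod_prod, h1]
  congr 1
  rw [← Measure.map_apply (measurable_pi_apply ()) hA,
    Measure.infinitePi_map_eval (fun _ : Unit => expMeasure r) ()]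

variable (hr : 0 < r) {s : ℝ} (hs : 0 < s)
include hr hs

/-- Memorylessness in discrete form: the rounded gap is geometric with failure probability `exp (-(r
/ s))`. -/
lemma expMeasure_le_floor (m : ℕ) : expMeasure r {x | m ≤ ⌊x * s⌋₊} =
    ENNReal.ofReal (Real.exp (-(r / s)) ^ m) := by
  have := isProbabilityMeasure_expMeasure hr
  rcases Nat.eq_zero_or_pos m with rfl | hm
  · simp
  · have : {x : ℝ | m ≤ ⌊x * s⌋₊} = Set.Ici (m / s) := by
      ext x
      simp only [Set.mem_ofPred_eq, Set.mem_Ici]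
      rw [Nat.le_floor_iff' (by omega), div_le_iff₀ hs]
    rw [this, expMeasure_Ici hr (by positivity), ← Real.exp_nat_mul]
    congr 2
    ring

lemma expMeasure_floor_eq (m : ℕ) : expMeasure r {x | ⌊x * s⌋₊ = m} =
    ENNReal.ofReal (Real.exp (-(r / s)) ^ m * (1 - Real.exp (-(r / s)))) := by
  have := isProbabilityMeasure_expMeasure hr
  have hsub : {x : ℝ | m + 1 ≤ ⌊x * s⌋₊} ⊆ {x | m ≤ ⌊x * s⌋₊} := fun x hx => by
    simp only [Set.mem_ofPred_eq] at hx ⊢; omega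
  have hmeas : ∀ m : ℕ, MeasurableSet {x : ℝ | m ≤ ⌊x * s⌋₊} := fun m =>
    (Nat.measurable_floor.comp (by fun_prop : Measurable fun x : ℝ => x * s))
      (measurableSet_Ici (a := m))
  have : {x : ℝ | ⌊x * s⌋₊ = m} = {x | m ≤ ⌊x * s⌋₊} \ {x | m + 1 ≤ ⌊x * s⌋₊} := by
    ext x
    simp only [Set.mem_ofPred_eq, Set.mem_sdiff]; omega
  rw [this, measure_sdiff hsub (hmeas _).nullMeasurableSet (measure_ne_top _ _),
    expMeasure_le_floor hr hs, expMeasure_le_floor hr hs, ← ENNReal.ofReal_sub _ (by positivity)]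
  congr 1
  ring

/-- If `m` is the first marked column, the first rounded gap must equal `m`, with probability `w ^ m
* (1 - w)`, and the tail must independently produce the rest of the pattern on `X - (m + 1)`
columns. If no column is marked, the first rounded gap must be at least `X`, with probability `w ^
X`. -/
lemma expSequence_pattern (X : ℕ) (θ : ℕ → Bool) :
    expSequence r {γ | ∀ x < X, isArrival (arrivalColumn s γ) x = θ x} =
      ∏ x ∈ Finset.range X, boolLaw (Real.exp (-(r / s))) {θ x} := by
  have := isProbabilityMeasure_expMeasure hr
  set w := Real.exp (-(r / s)) with hw
  have hw1 : w ≤ 1 := Real.exp_le_one_iff.2 (by have := div_pos hr hs; linarith)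
  induction X using Nat.strong_induction_on generalizing θ with
  | _ X ih =>
    by_cases hθ : ∃ m, m < X ∧ θ m = true
    · obtain ⟨m, ⟨hm, hθm⟩, hmin⟩ : ∃ m, (m < X ∧ θ m = true) ∧ ∀ x < m, θ x = false := by
        classical
        refine ⟨Nat.find hθ, Nat.find_spec hθ, fun x hx => ?_⟩
        have := Nat.find_min hθ hx
        have hX := (Nat.find_spec hθ).1
        rw [← Bool.not_eq_true]
        exact fun h => this ⟨hx.trans hX, h⟩
      have hset : {γ : ℕ → ℝ | ∀ x < X, isArrival (arrivalColumn s γ) x = θ x} =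
          {γ | γ 0 ∈ {x | ⌊x * s⌋₊ = m} ∧ (fun i => γ (i + 1)) ∈ {γ : ℕ → ℝ |
            ∀ y < X - (m + 1), isArrival (arrivalColumn s γ) y = θ (m + 1 + y)}} := by
        ext γ
        simp only [Set.mem_ofPred_eq]
        constructor
        · intro h
          have h0 : ⌊γ 0 * s⌋₊ = m := by
            have h1 := isArrival_arrivalColumn_iff.1 ((h m hm).trans hθm)
            by_contra hne
            have hlt : ⌊γ 0 * s⌋₊ < m := by
              rcases h1 with h1 | h1
              · exact absurd h1.symm hne
              · exact h1.1
            have h2 := h _ (hlt.trans hm)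
            rw [hmin _ hlt, isArrival_arrivalColumn_iff.2 (Or.inl rfl)] at h2
            simp at h2
          refine ⟨h0, fun y hy => ?_⟩
          rw [← h (m + 1 + y) (by omega), Bool.eq_iff_iff,
            isArrival_arrivalColumn_iff (x := m + 1 + y), h0, Nat.add_sub_cancel_left]
          constructor
          · exact fun h' => Or.inr ⟨by omega, h'⟩
          · rintro (h' | h')
            · omega
            · exact h'.2
        · rintro ⟨h0, h⟩ x hx
          rw [Bool.eq_iff_iff, isArrival_arrivalColumn_iff, h0]
          rcases lt_trichotomy x m with hxm | rfl | hxm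
          · rw [hmin x hxm]
            refine iff_of_false ?_ (by simp)
            rintro (h' | h') <;> omega
          · exact iff_of_true (Or.inl rfl) hθm
          · rw [h (x - (m + 1)) (by omega), Nat.add_sub_cancel' (by omega)]
            exact ⟨fun h' => h'.elim (fun h'' => absurd h'' hxm.ne') And.right,
              fun h' => Or.inr ⟨hxm, h'⟩⟩
      have hmeas : ∀ (Y : ℕ) (θ : ℕ → Bool), MeasurableSet
          {γ : ℕ → ℝ | ∀ y < Y, isArrival (arrivalColumn s γ) y = θ y} := by
        intro Y θ
        have : {γ : ℕ → ℝ | ∀ y < Y, isArrival (arrivalColumn s γ) y = θ y} =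
            ⋂ y ∈ Finset.range Y, {γ | isArrival (arrivalColumn s γ) y = θ y} := by
          ext γ; simp
        rw [this]
        exact Finset.measurableSet_biInter _ fun y _ => measurable_isArrival
          (measurable_arrivalColumn s) y (measurableSet_singleton _)
      have hmeas' : MeasurableSet {x : ℝ | ⌊x * s⌋₊ = m} :=
        (Nat.measurable_floor.comp (by fun_prop : Measurable fun x : ℝ => x * s))
          (measurableSet_singleton m)
      rw [hset, expSequence_head_tail hmeas' (hmeas _ fun y => θ (m + 1 + y)),
        ih _ (by omega) fun y => θ (m + 1 + y), expMeasure_floor_eq hr hs]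
      conv_rhs => rw [show X = m + 1 + (X - (m + 1)) by omega, Finset.prod_range_add,
        Finset.prod_range_succ]
      congr 1
      rw [boolLaw_singleton, if_pos hθm, ENNReal.ofReal_mul (by positivity),
        ENNReal.ofReal_pow (by positivity)]
      congr 1
      rw [Finset.prod_congr rfl (g := fun _ => ENNReal.ofReal w), Finset.prod_const,
        Finset.card_range]
      intro x hx
      rw [boolLaw_singleton, hmin x (Finset.mem_range.1 hx)]
      simp
    · have hfalse : ∀ x < X, θ x = false := fun x hx => by
        rw [← Bool.not_eq_true]
        exact fun h => hθ ⟨x, hx, h⟩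
      have hset : {γ : ℕ → ℝ | ∀ x < X, isArrival (arrivalColumn s γ) x = θ x} =
          {γ | γ 0 ∈ {x | X ≤ ⌊x * s⌋₊} ∧ (fun i => γ (i + 1)) ∈ Set.univ} := by
        ext γ
        simp only [Set.mem_ofPred_eq, Set.mem_univ, and_true]
        constructor
        · intro h
          by_contra hlt
          have h2 := h _ (not_le.1 hlt)
          rw [hfalse _ (not_le.1 hlt), isArrival_arrivalColumn_iff.2 (Or.inl rfl)] at h2
          simp at h2
        · intro h x hx
          rw [hfalse x hx, ← Bool.not_eq_true, isArrival_arrivalColumn_iff]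
          omega
      have : IsProbabilityMeasure (expSequence r) := by unfold expSequence; infer_instance
      have hmeas' : MeasurableSet {x : ℝ | X ≤ ⌊x * s⌋₊} :=
        (Nat.measurable_floor.comp (by fun_prop : Measurable fun x : ℝ => x * s))
          (measurableSet_Ici (a := X))
      rw [hset, expSequence_head_tail hmeas' MeasurableSet.univ, measure_univ,
        mul_one, expMeasure_le_floor hr hs, ENNReal.ofReal_pow (by positivity),
        Finset.prod_congr rfl (g := fun _ => ENNReal.ofReal w), Finset.prod_const,
        Finset.card_range]
      intro x hx
      rw [boolLaw_singleton, hfalse x (Finset.mem_range.1 hx)]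
      simp

/-- The indicators of the columns with an arrival are independent. -/
lemma expSequence_isArrival_mem (X : ℕ) (A : ℕ → Set Bool) :
    expSequence r {γ | ∀ x < X, isArrival (arrivalColumn s γ) x ∈ A x} =
      ∏ x ∈ Finset.range X, boolLaw (Real.exp (-(r / s))) (A x) := by
  have := isProbabilityMeasure_expMeasure hr
  have hw1 : Real.exp (-(r / s)) ≤ 1 :=
    Real.exp_le_one_iff.2 (by have := div_pos hr hs; linarith)
  have := isProbabilityMeasure_boolLaw (Real.exp_pos (-(r / s))).le hw1
  let f : (ℕ → ℝ) → Fin X → Bool := fun γ x => isArrival (arrivalColumn s γ) x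
  have hf : Measurable f :=
    measurable_pi_iff.2 fun x => measurable_isArrival (measurable_arrivalColumn s) x
  have hmap : (expSequence r).map f = Measure.pi fun _ => boolLaw (Real.exp (-(r / s))) := by
    refine Measure.ext_of_singleton fun θ => ?_
    rw [Measure.map_apply hf (measurableSet_singleton θ), Measure.pi_singleton]
    have hset : f ⁻¹' {θ} = {γ | ∀ x < X, isArrival (arrivalColumn s γ) x =
        if h : x < X then θ ⟨x, h⟩ else false} := by
      ext γ
      simp only [Set.mem_preimage, Set.mem_singleton_iff, Set.mem_ofPred_eq, funext_iff, f]
      constructor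
      · intro h x hx
        rw [dif_pos hx, ← h ⟨x, hx⟩]
      · intro h x
        rw [h x x.2, dif_pos x.2]
    rw [hset, expSequence_pattern hr hs, Finset.prod_range]
    exact Finset.prod_congr rfl fun x _ => by rw [dif_pos x.2]
  have hset : {γ | ∀ x < X, isArrival (arrivalColumn s γ) x ∈ A x} =
      f ⁻¹' (Set.univ.pi fun x : Fin X => A x) := by
    ext γ
    simp only [Set.mem_preimage, Set.mem_pi, Set.mem_ofPred_eq, Set.mem_univ, true_imp_iff, f]
    exact ⟨fun h x => h x x.2, fun h x hx => h ⟨x, hx⟩⟩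
  rw [hset, ← Measure.map_apply hf (MeasurableSet.of_discrete), hmap, Measure.pi_pi,
    Finset.prod_range]

end OneProcess

/-- The indicators of arrivals in all rows and columns are independent. -/
lemma gapLaw_isArrival_mem {c : ℕ → ℝ} (hc : ∀ k, 0 < c k) {M : ℕ} {s : ℕ → ℝ}
    (hs : ∀ j < M, 0 < s j) (X : ℕ) (A : ℕ × ℕ → Set Bool) :
    gapLaw c {g | ∀ v ∈ Finset.range X ×ˢ Finset.range M,
      isArrival (arrivalColumn (s v.2) fun n => g (v.2, n)) v.1 ∈ A v} =
      ∏ v ∈ Finset.range X ×ˢ Finset.range M, boolLaw (Real.exp (-(c v.2 / s v.2))) (A v) := by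
  have := fun k => isProbabilityMeasure_expMeasure (hc k)
  have hcurry := Measure.infinitePi_map_curry fun (k : ℕ) (_ : ℕ) => expMeasure (c k)
  let E : ℕ → Set (ℕ → ℝ) := fun j =>
    {γ | ∀ x < X, isArrival (arrivalColumn (s j) γ) x ∈ A (x, j)}
  have hE : ∀ j, MeasurableSet (E j) := by
    intro j
    have : E j = ⋂ x ∈ Finset.range X, {γ | isArrival (arrivalColumn (s j) γ) x ∈ A (x, j)} := by
      ext γ; simp [E]
    rw [this]
    exact Finset.measurableSet_biInter _ fun y _ => measurable_isArrival
      (measurable_arrivalColumn (s j)) y MeasurableSet.of_discrete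
  have hset : {g | ∀ v ∈ Finset.range X ×ˢ Finset.range M,
      isArrival (arrivalColumn (s v.2) fun n => g (v.2, n)) v.1 ∈ A v} =
      MeasurableEquiv.curry ℕ ℕ ℝ ⁻¹' (Set.pi (Finset.range M : Finset ℕ) E) := by
    ext g
    simp only [Set.mem_ofPred_eq, Finset.mem_product, Finset.mem_range, Set.mem_preimage, Set.mem_pi,
      Finset.mem_coe, E]
    exact ⟨fun h j hj x hx => h (x, j) ⟨hx, hj⟩, fun h v hv => h v.2 hv.2 v.1 hv.1⟩
  rw [hset, ← Measure.map_apply (MeasurableEquiv.measurable _)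
    (MeasurableSet.pi (Finset.countable_toSet _) fun j _ => hE j), gapLaw, hcurry,
    Measure.infinitePi_pi _ fun j _ => hE j, Finset.prod_product_right]
  exact Finset.prod_congr rfl fun j hj =>
    expSequence_isArrival_mem (hc j) (hs j (Finset.mem_range.1 hj)) X fun x => A (x, j)

/-! ### Vertex models with independent choices -/

/-- The left edges of the vertices in column `x`, when the path at the vertex `(x, j)` turns up
or goes up according to `T x j` and `K x j`. -/
def leftEdges (T K : ℕ → ℕ → Bool) : ℕ → ℕ → Bool
  | 0 => fun _ => true
  | x + 1 => columnRight (T x) (K x) (leftEdges T K x)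

/-- The bottom edges in a column with given left and right edges. -/
def bottomEdges (l r : ℕ → Bool) : ℕ → Bool
  | 0 => false
  | j + 1 => ((l j).xor (bottomEdges l r j)).xor (r j)

/-- Conservation of paths at a vertex, modulo 2. -/
lemma vertexOut_snd (T K l b : Bool) :
    (vertexOut T K l b).2 = (l.xor b).xor (vertexOut T K l b).1 := by
  revert T K l b
  decide

/-- Once left and right edges are prescribed, conservation forces the bottom edges, and the event
splits into one condition per vertex. -/
lemma columnRight_eq_iff {T K l' l r : ℕ → Bool} {M : ℕ} (hl : ∀ j < M, l' j = l j) :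
    (∀ j < M, columnRight T K l' j = r j) ↔
      ∀ j < M, (vertexOut (T j) (K j) (l j) (bottomEdges l r j)).1 = r j := by
  suffices H : ((∀ j < M, columnRight T K l' j = r j) ↔
      ∀ j < M, (vertexOut (T j) (K j) (l j) (bottomEdges l r j)).1 = r j) ∧
      ((∀ j < M, columnRight T K l' j = r j) → columnBottom T K l' M = bottomEdges l r M) from H.1
  induction M with
  | zero => simp [columnBottom, bottomEdges]
  | succ M ih =>
    obtain ⟨h1, h2⟩ := ih fun j hj => hl j (by omega)
    simp only [Nat.forall_lt_succ_right, ← h1]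
    have hstep : (∀ j < M, columnRight T K l' j = r j) → columnRight T K l' M =
        (vertexOut (T M) (K M) (l M) (bottomEdges l r M)).1 := fun h => by
      rw [columnRight, h2 h, hl M (Nat.lt_succ_self M)]
    refine ⟨and_congr_right fun h => by rw [hstep h], fun h => ?_⟩
    rw [columnBottom, bottomEdges, h2 h.1, hl M (Nat.lt_succ_self M), vertexOut_snd, ← hstep h.1,
      h.2]

lemma leftEdges_eq_iff {T K s : ℕ → ℕ → Bool} {X M : ℕ} (hs : ∀ j < M, s 0 j = true) :
    (∀ x ≤ X, ∀ j < M, leftEdges T K x j = s x j) ↔ ∀ x < X, ∀ j < M,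
      (vertexOut (T x j) (K x j) (s x j) (bottomEdges (s x) (s (x + 1)) j)).1 = s (x + 1) j := by
  induction X with
  | zero => simpa [leftEdges] using fun j hj => (hs j hj).symm
  | succ X ih =>
    rw [Nat.forall_lt_succ_right, ← ih]
    constructor
    · exact fun h => ⟨fun x hx => h x (by omega),
        (columnRight_eq_iff (h X (by omega))).1 (h (X + 1) le_rfl)⟩
    · rintro ⟨h1, h2⟩ x hx
      rcases Nat.lt_or_eq_of_le hx with hx | rfl
      · exact h1 x (by omega)
      · exact (columnRight_eq_iff (h1 X le_rfl)).2 h2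

/-- The values of `turnUp` which lead to the right edge `r`. -/
def turnSet (l b r : Bool) : Set Bool :=
  if b then Set.univ else {τ | (vertexOut τ true l false).1 = r}

/-- The values of `keepUp` which lead to the right edge `r`. -/
def keepSet (l b r : Bool) : Set Bool :=
  if b then {κ | (vertexOut true κ l true).1 = r} else Set.univ

/-- Each vertex consults at most one of its two choices, so the condition on it is a rectangle with
at least one trivial side. -/
lemma vertexOut_fst_eq_iff (T K l b r : Bool) :
    (vertexOut T K l b).1 = r ↔ T ∈ turnSet l b r ∧ K ∈ keepSet l b r := by
  cases b <;> cases l <;> simp [turnSet, keepSet, vertexOut]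

section VertexModel

variable {Ω Ω' : Type*} [MeasurableSpace Ω] [MeasurableSpace Ω']

lemma measurable_leftEdges {T K : Ω → ℕ → ℕ → Bool} (hT : ∀ x j, Measurable fun ω => T ω x j)
    (hK : ∀ x j, Measurable fun ω => K ω x j) (x j : ℕ) :
    Measurable fun ω => leftEdges (T ω) (K ω) x j := by
  induction x generalizing j with
  | zero => exact measurable_const
  | succ x ih => exact measurable_columnRight (hT x) (hK x) ih j

/-- The law of the paths is determined by the probabilities of the events that at each vertex one of
the two choices is prescribed. -/
lemma measure_leftEdges_congr {μ : Measure Ω} {μ' : Measure Ω'} {T K : Ω → ℕ → ℕ → Bool}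
    {T' K' : Ω' → ℕ → ℕ → Bool} (hT : ∀ x j, Measurable fun ω => T ω x j)
    (hK : ∀ x j, Measurable fun ω => K ω x j) (hT' : ∀ x j, Measurable fun ω => T' ω x j)
    (hK' : ∀ x j, Measurable fun ω => K' ω x j) (X M : ℕ)
    (h : ∀ A B : ℕ × ℕ → Set Bool, (∀ v, A v = Set.univ ∨ B v = Set.univ) →
      μ {ω | ∀ v ∈ Finset.range X ×ˢ Finset.range M, T ω v.1 v.2 ∈ A v ∧ K ω v.1 v.2 ∈ B v} =
      μ' {ω | ∀ v ∈ Finset.range X ×ˢ Finset.range M, T' ω v.1 v.2 ∈ A v ∧ K' ω v.1 v.2 ∈ B v})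
    (S : Set (Fin (X + 1) → Fin M → Bool)) :
    μ {ω | (fun (x : Fin (X + 1)) (j : Fin M) => leftEdges (T ω) (K ω) x j) ∈ S} =
      μ' {ω | (fun (x : Fin (X + 1)) (j : Fin M) => leftEdges (T' ω) (K' ω) x j) ∈ S} := by
  have hm : Measurable fun ω (x : Fin (X + 1)) (j : Fin M) => leftEdges (T ω) (K ω) x j :=
    measurable_pi_iff.2 fun x => measurable_pi_iff.2 fun j => measurable_leftEdges hT hK x j
  have hm' : Measurable fun ω (x : Fin (X + 1)) (j : Fin M) => leftEdges (T' ω) (K' ω) x j :=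
    measurable_pi_iff.2 fun x => measurable_pi_iff.2 fun j => measurable_leftEdges hT' hK' x j
  suffices H : μ.map (fun ω (x : Fin (X + 1)) (j : Fin M) => leftEdges (T ω) (K ω) x j) =
      μ'.map fun ω (x : Fin (X + 1)) (j : Fin M) => leftEdges (T' ω) (K' ω) x j by
    have := congrArg (fun m => m S) H
    rwa [Measure.map_apply hm MeasurableSet.of_discrete,
      Measure.map_apply hm' MeasurableSet.of_discrete] at this
  refine Measure.ext_of_singleton fun s => ?_
  rw [Measure.map_apply hm (measurableSet_singleton s),
    Measure.map_apply hm' (measurableSet_singleton s)]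
  let s' : ℕ → ℕ → Bool := fun x j =>
    if hx : x < X + 1 then if hj : j < M then s ⟨x, hx⟩ ⟨j, hj⟩ else false else false
  have hpre : ∀ T K : ℕ → ℕ → Bool,
      ((fun (x : Fin (X + 1)) (j : Fin M) => leftEdges T K x j) = s ↔
        ∀ x ≤ X, ∀ j < M, leftEdges T K x j = s' x j) := by
    intro T K
    simp only [funext_iff, s']
    constructor
    · intro h x hx j hj
      rw [dif_pos (by omega), dif_pos hj, ← h ⟨x, by omega⟩ ⟨j, hj⟩]
    · intro h x j
      rw [h x (by omega) j j.2, dif_pos x.2, dif_pos j.2]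
  by_cases h0 : ∀ j < M, s' 0 j = true
  · have := h
      (fun v => turnSet (s' v.1 v.2) (bottomEdges (s' v.1) (s' (v.1 + 1)) v.2) (s' (v.1 + 1) v.2))
      (fun v => keepSet (s' v.1 v.2) (bottomEdges (s' v.1) (s' (v.1 + 1)) v.2) (s' (v.1 + 1) v.2))
      (fun v => by
        cases bottomEdges (s' v.1) (s' (v.1 + 1)) v.2 <;> simp [turnSet, keepSet])
    simp only [← vertexOut_fst_eq_iff, Finset.mem_product, Finset.mem_range] at this
    convert this using 2
    · ext ω
      rw [Set.mem_preimage, Set.mem_singleton_iff, hpre, leftEdges_eq_iff h0]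
      exact ⟨fun h v hv => h v.1 hv.1 v.2 hv.2, fun h x hx j hj => h (x, j) ⟨hx, hj⟩⟩
    · ext ω
      rw [Set.mem_preimage, Set.mem_singleton_iff, hpre, leftEdges_eq_iff h0]
      exact ⟨fun h v hv => h v.1 hv.1 v.2 hv.2, fun h x hx j hj => h (x, j) ⟨hx, hj⟩⟩
  · have hempty : ∀ T K : ℕ → ℕ → Bool,
        (fun (x : Fin (X + 1)) (j : Fin M) => leftEdges T K x j) ≠ s := by
      intro T K hs
      exact h0 fun j hj => ((hpre T K).1 hs 0 (by omega) j hj).symm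
    have h1 : (fun ω (x : Fin (X + 1)) (j : Fin M) => leftEdges (T ω) (K ω) x j) ⁻¹' {s} = ∅ :=
      Set.eq_empty_iff_forall_notMem.2 fun ω hω => hempty _ _ hω
    have h2 : (fun ω (x : Fin (X + 1)) (j : Fin M) => leftEdges (T' ω) (K' ω) x j) ⁻¹' {s} = ∅ :=
      Set.eq_empty_iff_forall_notMem.2 fun ω hω => hempty _ _ hω
    rw [h1, h2, measure_empty, measure_empty]

end VertexModel

lemma horizontalEdge_eq_leftEdges (t : ℝ) (a b : ℕ → ℝ) (u : ℕ × ℕ → ℝ) (x : ℕ) :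
    horizontalEdge t a b u x = leftEdges (fun x j => decide (weightRight t (a x) (b j) ≤ u (x, j)))
      (fun x j => decide (u (x, j) < weightUp t (a x) (b j))) x := by
  induction x with
  | zero => rfl
  | succ x ih => rw [horizontalEdge, leftEdges, ih]

lemma uniform01_Iio {w : ℝ} (_h0 : 0 ≤ w) (h1 : w ≤ 1) :
    uniform01 (Set.Iio w) = ENNReal.ofReal w := by
  rw [uniform01, Measure.restrict_apply measurableSet_Iio]
  have : Set.Iio w ∩ Set.Icc 0 1 = Set.Ico 0 w := by
    ext x
    simp only [Set.mem_inter_iff, Set.mem_Iio, Set.mem_Icc, Set.mem_Ico]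
    constructor
    · exact fun h => ⟨h.2.1, h.1⟩
    · exact fun h => ⟨h.2, h.1, h.2.le.trans h1⟩
  rw [this, Real.volume_Ico, sub_zero]

lemma uniform01_decide_le_mem {w : ℝ} (h0 : 0 ≤ w) (h1 : w ≤ 1) (A : Set Bool) :
    uniform01 {u | decide (w ≤ u) ∈ A} = boolLaw w A := by
  have hm : Measurable fun u : ℝ => decide (w ≤ u) := by
    refine measurable_to_bool ?_
    have : (fun u : ℝ => decide (w ≤ u)) ⁻¹' {true} = Set.Ici w := by ext; simp
    rw [this]; exact measurableSet_Ici
  have : uniform01.map (fun u => decide (w ≤ u)) = boolLaw w := by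
    refine Measure.ext_of_singleton fun θ => ?_
    rw [Measure.map_apply hm (measurableSet_singleton θ), boolLaw_singleton]
    cases θ
    · have : (fun u : ℝ => decide (w ≤ u)) ⁻¹' {false} = Set.Iio w := by ext; simp
      rw [this, uniform01_Iio h0 h1]
      simp
    · have : (fun u : ℝ => decide (w ≤ u)) ⁻¹' {true} = (Set.Iio w)ᶜ := by ext; simp
      rw [this, prob_compl_eq_one_sub measurableSet_Iio, uniform01_Iio h0 h1, if_pos rfl,
        ENNReal.ofReal_sub _ h0, ENNReal.ofReal_one]
  rw [← this, Measure.map_apply hm MeasurableSet.of_discrete]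
  rfl

/-- The six vertex model makes both choices at a vertex from one uniform number, so they are
dependent. Since `hAB` leaves at most one of them constrained, the probability still factors as if
they were independent. -/
lemma vertexLaw_choices_mem {t : ℝ} {a b : ℕ → ℝ} (X M : ℕ)
    (hw : ∀ x < X, ∀ j < M, 0 ≤ weightRight t (a x) (b j) ∧ weightRight t (a x) (b j) ≤ 1)
    (A B : ℕ × ℕ → Set Bool) (hAB : ∀ v, A v = Set.univ ∨ B v = Set.univ) :
    vertexLaw {u | ∀ v ∈ Finset.range X ×ˢ Finset.range M,
      decide (weightRight t (a v.1) (b v.2) ≤ u (v.1, v.2)) ∈ A v ∧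
        decide (u (v.1, v.2) < weightUp t (a v.1) (b v.2)) ∈ B v} =
      ∏ v ∈ Finset.range X ×ˢ Finset.range M, boolLaw (weightRight t (a v.1) (b v.2)) (A v) *
        uniform01 {u | decide (u < weightUp t (a v.1) (b v.2)) ∈ B v} := by
  have hset : {u : ℕ × ℕ → ℝ | ∀ v ∈ Finset.range X ×ˢ Finset.range M,
      decide (weightRight t (a v.1) (b v.2) ≤ u (v.1, v.2)) ∈ A v ∧
        decide (u (v.1, v.2) < weightUp t (a v.1) (b v.2)) ∈ B v} =
      Set.pi (Finset.range X ×ˢ Finset.range M : Finset (ℕ × ℕ)) fun v =>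
        {u | decide (weightRight t (a v.1) (b v.2) ≤ u) ∈ A v} ∩
          {u | decide (u < weightUp t (a v.1) (b v.2)) ∈ B v} := by
    ext u; rfl
  have hm1 : ∀ (w : ℝ) (A : Set Bool), MeasurableSet {u : ℝ | decide (w ≤ u) ∈ A} := by
    intro w A
    have : Measurable fun u : ℝ => decide (w ≤ u) := by
      refine measurable_to_bool ?_
      have : (fun u : ℝ => decide (w ≤ u)) ⁻¹' {true} = Set.Ici w := by ext; simp
      rw [this]; exact measurableSet_Ici
    exact this MeasurableSet.of_discrete
  have hm2 : ∀ (w : ℝ) (A : Set Bool), MeasurableSet {u : ℝ | decide (u < w) ∈ A} := fun w A =>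
    (measurable_decide_lt measurable_id measurable_const) MeasurableSet.of_discrete
  rw [hset, vertexLaw, Measure.infinitePi_pi _ fun v _ => (hm1 _ _).inter (hm2 _ _)]
  refine Finset.prod_congr rfl fun v hv => ?_
  rw [Finset.mem_product, Finset.mem_range, Finset.mem_range] at hv
  obtain ⟨h0, h1⟩ := hw v.1 hv.1 v.2 hv.2
  rw [← uniform01_decide_le_mem h0 h1]
  rcases hAB v with h | h
  · simp only [h, Set.mem_univ, Set.ofPred_true, Set.univ_inter, measure_univ, one_mul]
  · simp only [h, Set.mem_univ, Set.ofPred_true, Set.inter_univ, measure_univ, mul_one]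

/-! ### The choices in the discretized half-continuous model -/

/-- The coin which is used at the vertex `(x, j)`, when the arrival `e` is in column `D e`: the
one of an arrival in a lower row of the same column, or else an otherwise unused coin. -/
def IsCoinIndex (D : ℕ × ℕ → ℕ) (x j : ℕ) (i : ℕ × ℕ × ℕ) : Prop :=
  i.2.2 = j ∧ ((i.1 < j ∧ D (i.1, i.2.1) = x ∧ ∀ k < i.1, ∀ n, D (k, n) ≠ x) ∨
    (i.1 = j ∧ i.2.1 = x ∧ ∀ k < j, ∀ n, D (k, n) ≠ x))

lemma exists_isCoinIndex (D : ℕ × ℕ → ℕ) (x j : ℕ) : ∃ i, IsCoinIndex D x j i := by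
  classical
  by_cases h : ∃ k, k < j ∧ ∃ n, D (k, n) = x
  · obtain ⟨hk, n, hn⟩ := Nat.find_spec h
    refine ⟨(Nat.find h, n, j), rfl, Or.inl ⟨hk, hn, fun k hk' n' hn' => ?_⟩⟩
    exact Nat.find_min h hk' ⟨hk'.trans hk, n', hn'⟩
  · refine ⟨(j, x, j), rfl, Or.inr ⟨rfl, rfl, fun k hk n hn => h ⟨k, hk, n, hn⟩⟩⟩

/-- The coin which is used at the vertex `(x, j)`. -/
def coinIndex (D : ℕ × ℕ → ℕ) (v : ℕ × ℕ) : ℕ × ℕ × ℕ := (exists_isCoinIndex D v.1 v.2).choose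

lemma isCoinIndex_coinIndex (D : ℕ × ℕ → ℕ) (v : ℕ × ℕ) :
    IsCoinIndex D v.1 v.2 (coinIndex D v) := (exists_isCoinIndex D v.1 v.2).choose_spec

/-- No coin serves two vertices, so given the arrivals the choices made with these coins are
independent. -/
lemma injective_coinIndex (D : ℕ × ℕ → ℕ) : Function.Injective (coinIndex D) := by
  rintro ⟨x, j⟩ ⟨x', j'⟩ h
  obtain ⟨h1, h2⟩ := isCoinIndex_coinIndex D (x, j)
  obtain ⟨h1', h2'⟩ := isCoinIndex_coinIndex D (x', j')
  rw [← h] at h1' h2'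
  simp only at h1 h1' h2 h2'
  obtain rfl : j = j' := h1.symm.trans h1'
  have : x = x' := by
    rcases h2 with h2 | h2 <;> rcases h2' with h2' | h2'
    · exact h2.2.1.symm.trans h2'.2.1
    · exact absurd h2'.1 h2.1.ne
    · exact absurd h2.1 h2'.1.ne
    · exact h2.2.1.symm.trans h2'.2.1
  rw [this]

/-- When a process has at most one arrival per column the index is unique. This explicit description
gives measurability and identifies the coins in the coupling. -/
lemma coinIndex_eq_iff {D : ℕ × ℕ → ℕ} (hD : ∀ k, Function.Injective fun n => D (k, n))
    {v : ℕ × ℕ} {i : ℕ × ℕ × ℕ} : coinIndex D v = i ↔ IsCoinIndex D v.1 v.2 i := by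
  refine ⟨fun h => h ▸ isCoinIndex_coinIndex D v, fun h => ?_⟩
  obtain ⟨h1, h2⟩ := isCoinIndex_coinIndex D v
  generalize coinIndex D v = i' at h1 h2
  obtain ⟨k, n, j⟩ := i
  obtain ⟨k', n', j'⟩ := i'
  obtain ⟨h3, h4⟩ := h
  simp only at h1 h2 h3 h4
  subst h1 h3
  rcases h2 with h2 | h2 <;> rcases h4 with h4 | h4
  · obtain rfl : k = k' := by
      rcases lt_trichotomy k k' with h | h | h
      · exact absurd h4.2.1 (h2.2.2 k h n)
      · exact h
      · exact absurd h2.2.1 (h4.2.2 k' h n')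
    rw [hD k (h2.2.1.trans h4.2.1.symm)]
  · exact absurd h2.2.1 (h4.2.2 k' h2.1 n')
  · exact absurd h4.2.1 (h2.2.2 k h4.1 n)
  · rw [h2.1, h4.1, h2.2.1, h4.2.1]

section Discretization

/-- The columns of arrivals in all rows. -/
def arrivalColumns (s : ℕ → ℝ) (g : ℕ × ℕ → ℝ) (e : ℕ × ℕ) : ℕ :=
  arrivalColumn (s e.1) (fun n => g (e.1, n)) e.2

lemma injective_arrivalColumns (s : ℕ → ℝ) (g : ℕ × ℕ → ℝ) (k : ℕ) :
    Function.Injective fun n => arrivalColumns s g (k, n) :=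
  (strictMono_arrivalColumn (s k) fun n => g (k, n)).injective

lemma measurable_arrivalColumns (s : ℕ → ℝ) (e : ℕ × ℕ) :
    Measurable fun g => arrivalColumns s g e :=
  (measurable_arrivalColumn (s e.1) e.2).comp
    (measurable_pi_iff.2 fun n => measurable_pi_apply (e.1, n))

/-- Whether a path turns up at a vertex of the discretized half-continuous model. -/
def turnChoice (s : ℕ → ℝ) (g : ℕ × ℕ → ℝ) (x j : ℕ) : Bool :=
  isArrival (fun n => arrivalColumns s g (j, n)) x

/-- Whether a path which comes from the bottom goes straight at a vertex of the discretized
half-continuous model. -/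
def keepChoice (s w : ℕ → ℝ) (y : (ℕ × ℕ → ℝ) × (ℕ × ℕ × ℕ → ℝ)) (x j : ℕ) : Bool :=
  decide (y.2 (coinIndex (arrivalColumns s y.1) (x, j)) < w j)

lemma measurable_turnChoice (s : ℕ → ℝ) (x j : ℕ) : Measurable fun g => turnChoice s g x j :=
  measurable_isArrival (fun n => measurable_arrivalColumns s (j, n)) x

lemma measurableSet_coinIndex_eq (s : ℕ → ℝ) (v : ℕ × ℕ) (i : ℕ × ℕ × ℕ) :
    MeasurableSet {g | coinIndex (arrivalColumns s g) v = i} := by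
  have hD : ∀ e x, MeasurableSet {g | arrivalColumns s g e = x} := fun e x =>
    measurable_arrivalColumns s e (measurableSet_singleton x)
  have h1 : ∀ m, MeasurableSet {g | ∀ k < m, ∀ n, arrivalColumns s g (k, n) ≠ v.1} := by
    intro m
    have : {g | ∀ k < m, ∀ n, arrivalColumns s g (k, n) ≠ v.1} =
        ⋂ k ∈ Finset.range m, ⋂ n, {g | arrivalColumns s g (k, n) = v.1}ᶜ := by
      ext g; simp
    rw [this]
    exact Finset.measurableSet_biInter _ fun k _ => MeasurableSet.iInter fun n => (hD _ _).compl
  simp only [coinIndex_eq_iff (injective_arrivalColumns s _), IsCoinIndex]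
  exact (MeasurableSet.const _).inter (((MeasurableSet.const _).inter ((hD _ _).inter (h1 _))).union
    ((MeasurableSet.const _).inter ((MeasurableSet.const _).inter (h1 _))))

lemma measurable_keepChoice (s w : ℕ → ℝ) (x j : ℕ) : Measurable fun y => keepChoice s w y x j := by
  refine measurable_to_bool ?_
  have : (fun y => keepChoice s w y x j) ⁻¹' {true} =
      ⋃ i, (Prod.fst ⁻¹' {g | coinIndex (arrivalColumns s g) (x, j) = i}) ∩
        {y : (ℕ × ℕ → ℝ) × (ℕ × ℕ × ℕ → ℝ) | y.2 i < w j} := by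
    ext y
    simp [keepChoice]
  rw [this]
  exact MeasurableSet.iUnion fun i => (measurable_fst (measurableSet_coinIndex_eq s _ i)).inter
    (measurableSet_lt ((measurable_pi_apply i).comp measurable_snd) measurable_const)

lemma coinLaw_injective_mem {f : ℕ × ℕ → ℕ × ℕ × ℕ} (hf : Function.Injective f)
    (R : Finset (ℕ × ℕ)) {E : ℕ × ℕ → Set ℝ} (hE : ∀ v, MeasurableSet (E v)) :
    coinLaw {q | ∀ v ∈ R, q (f v) ∈ E v} = ∏ v ∈ R, uniform01 (E v) := by
  have h := Measure.map_infinitePi_infinitePi_of_inj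
    (P := fun _ : ℕ × ℕ × ℕ => uniform01) hf
  have hm : Measurable fun (q : ℕ × ℕ × ℕ → ℝ) v => q (f v) := by fun_prop
  rw [← Measure.infinitePi_pi (fun _ : ℕ × ℕ => uniform01) fun v _ => hE v, ← h,
    Measure.map_apply hm (MeasurableSet.pi R.countable_toSet fun v _ => hE v)]
  rfl

/-- Integrate over the coins first. For fixed gaps the vertices use distinct coins, whichever these
are, so the probability of the conditions on the coins does not depend on the gaps. -/
lemma noiseLaw_choices_mem {c : ℕ → ℝ} (hc : ∀ k, 0 < c k) {X M : ℕ} {s : ℕ → ℝ}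
    (hs : ∀ j < M, 0 < s j) (w : ℕ → ℝ) (A B : ℕ × ℕ → Set Bool) :
    noiseLaw c {y | ∀ v ∈ Finset.range X ×ˢ Finset.range M,
      turnChoice s y.1 v.1 v.2 ∈ A v ∧ keepChoice s w y v.1 v.2 ∈ B v} =
      ∏ v ∈ Finset.range X ×ˢ Finset.range M, boolLaw (Real.exp (-(c v.2 / s v.2))) (A v) *
        uniform01 {u | decide (u < w v.2) ∈ B v} := by
  have := fun k => isProbabilityMeasure_expMeasure (hc k)
  set R := Finset.range X ×ˢ Finset.range M with hR
  have hset : {y : (ℕ × ℕ → ℝ) × (ℕ × ℕ × ℕ → ℝ) | ∀ v ∈ R,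
      turnChoice s y.1 v.1 v.2 ∈ A v ∧ keepChoice s w y v.1 v.2 ∈ B v} =
      ⋂ v ∈ R, ((fun y => turnChoice s y.1 v.1 v.2) ⁻¹' A v) ∩
        ((fun y => keepChoice s w y v.1 v.2) ⁻¹' B v) := by
    ext y; simp
  have hmeas : MeasurableSet {y : (ℕ × ℕ → ℝ) × (ℕ × ℕ × ℕ → ℝ) | ∀ v ∈ R,
      turnChoice s y.1 v.1 v.2 ∈ A v ∧ keepChoice s w y v.1 v.2 ∈ B v} := by
    rw [hset]
    exact Finset.measurableSet_biInter _ fun v _ =>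
      (((measurable_turnChoice s v.1 v.2).comp measurable_fst) MeasurableSet.of_discrete).inter
        ((measurable_keepChoice s w v.1 v.2) MeasurableSet.of_discrete)
  have hE : ∀ v : ℕ × ℕ, MeasurableSet {u : ℝ | decide (u < w v.2) ∈ B v} := fun v =>
    (measurable_decide_lt measurable_id measurable_const) MeasurableSet.of_discrete
  have hG : MeasurableSet {g | ∀ v ∈ R, turnChoice s g v.1 v.2 ∈ A v} := by
    have : {g | ∀ v ∈ R, turnChoice s g v.1 v.2 ∈ A v} =
        ⋂ v ∈ R, (fun g => turnChoice s g v.1 v.2) ⁻¹' A v := by ext g; simp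
    rw [this]
    exact Finset.measurableSet_biInter _ fun v _ =>
      (measurable_turnChoice s v.1 v.2) MeasurableSet.of_discrete
  rw [noiseLaw, Measure.prod_apply hmeas]
  have hfiber : ∀ g : ℕ × ℕ → ℝ, coinLaw (Prod.mk g ⁻¹' {y | ∀ v ∈ R,
      turnChoice s y.1 v.1 v.2 ∈ A v ∧ keepChoice s w y v.1 v.2 ∈ B v}) =
      {g | ∀ v ∈ R, turnChoice s g v.1 v.2 ∈ A v}.indicator
        (fun _ => ∏ v ∈ R, uniform01 {u | decide (u < w v.2) ∈ B v}) g := by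
    intro g
    by_cases hg : ∀ v ∈ R, turnChoice s g v.1 v.2 ∈ A v
    · rw [Set.indicator_of_mem (by exact hg),
        ← coinLaw_injective_mem (injective_coinIndex (arrivalColumns s g)) R hE]
      congr 1
      ext q
      exact ⟨fun h v hv => (h v hv).2, fun h v hv => ⟨hg v hv, h v hv⟩⟩
    · rw [Set.indicator_of_notMem (by exact hg)]
      convert! measure_empty (μ := coinLaw)
      refine Set.eq_empty_iff_forall_notMem.2 fun q hq => hg fun v hv => (hq v hv).1
  simp only [hfiber]
  rw [lintegral_indicator_const hG, Finset.prod_mul_distrib, mul_comm]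
  congr 1
  exact gapLaw_isArrival_mem hc hs X A

end Discretization

/-! ### Comparison of the discretized and the half-continuous model -/

lemma heightOf_congr {l l' : ℕ → Bool} {y : ℕ} (h : ∀ j < y, l j = l' j) :
    heightOf l y = heightOf l' y := by
  rw [heightOf, heightOf]
  congr 1
  exact Finset.filter_congr fun j hj => by rw [h j (Finset.mem_range.1 hj)]

/-- A column without arrivals lets all edges through. By `hinj` any other column contains a single
arrival `e` in the rows below `M`, so it acts as `pathUpdate` at `e`: paths enter from below only in
rows above `e.1`, where `coinIndex` selects the coins of `e`. -/
lemma leftEdges_eq_applyInOrder {D : ℕ × ℕ → ℕ} (hD : ∀ k, Function.Injective fun n => D (k, n))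
    (q : ℕ × ℕ × ℕ → ℝ) (w : ℕ → ℝ) {M x : ℕ} {l : Finset (ℕ × ℕ)}
    (hl : ∀ e, e ∈ l ↔ e.1 < M ∧ D e < x) (hinj : Set.InjOn D l) {j : ℕ} (hj : j < M) :
    leftEdges (fun x j => isArrival (fun n => D (j, n)) x)
        (fun x j => decide (q (coinIndex D (x, j)) < w j)) x j =
      applyInOrder (fun e => (D e : ℝ)) (pathUpdate fun e i => decide (q (e.1, e.2, i) < w i))
        (fun _ => true) l j := by
  induction x generalizing l j with
  | zero =>
    have : l = ∅ := Finset.eq_empty_iff_forall_notMem.2 fun e he =>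
      absurd ((hl e).1 he).2 (Nat.not_lt_zero _)
    rw [this, applyInOrder_empty]
    rfl
  | succ x ih =>
    have hl' : ∀ e, e ∈ l.filter (fun e => D e < x) ↔ e.1 < M ∧ D e < x := fun e => by
      rw [Finset.mem_filter, hl]; omega
    have hsub : (↑(l.filter fun e => D e < x) : Set (ℕ × ℕ)) ⊆ ↑l := fun e he =>
      (Finset.mem_filter.1 he).1
    have ih' := fun {i : ℕ} => @ih (l.filter fun e => D e < x) hl' (hinj.mono hsub) i
    rw [leftEdges]
    by_cases hex : ∃ e ∈ l, D e = x
    · obtain ⟨e, he, hex⟩ := hex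
      have heM := ((hl e).1 he).1
      have huniq : ∀ k n, k < M → D (k, n) = x → (k, n) = e := fun k n hk hkn =>
        hinj ((hl _).2 ⟨hk, by omega⟩) he (hkn.trans hex.symm)
      have hins : l = insert e (l.filter fun e => D e < x) := by
        ext e'
        rw [Finset.mem_insert, hl', hl]
        constructor
        · rintro ⟨h1, h2⟩
          rcases Nat.lt_or_eq_of_le (Nat.le_of_lt_succ h2) with h3 | h3
          · exact Or.inr ⟨h1, h3⟩
          · exact Or.inl (huniq e'.1 e'.2 h1 h3)
        · rintro (rfl | ⟨h1, h2⟩)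
          · exact ⟨heM, by omega⟩
          · exact ⟨h1, by omega⟩
      have hT : ∀ i < M, isArrival (fun n => D (i, n)) x = decide (i = e.1) := by
        intro i hi
        rw [Bool.eq_iff_iff, isArrival_iff, decide_eq_true_iff]
        constructor
        · rintro ⟨n, hn⟩
          rw [← huniq i n hi hn]
        · rintro rfl
          exact ⟨e.2, hex⟩
      rw [hins, applyInOrder_insert fun e' he' => by
        rw [hex, Nat.cast_lt]; exact ((hl' e').1 he').2]
      refine columnRight_congr (fun i hi => hT i (by omega)) (fun i hi hb => ?_)
        fun i hi => ih' (by omega)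
      have hei : e.1 < i := by
        by_contra hle
        rw [columnBottom_eq_false fun i' hi' => ?_] at hb
        · simp at hb
        · rw [hT i' (by omega), decide_eq_false (by omega)]
      have hidx : coinIndex D (x, i) = (e.1, e.2, i) := by
        refine (coinIndex_eq_iff hD).2 ⟨rfl, Or.inl ⟨hei, hex, fun k hk n hn => ?_⟩⟩
        have hk' : k < e.1 := hk
        rw [← huniq k n (by omega) hn] at hk'
        exact lt_irrefl _ hk'
      rw [hidx]
    · have hfil : l = l.filter fun e => D e < x := by
        refine (Finset.filter_true_of_mem fun e he => ?_).symm
        have h1 := ((hl e).1 he).2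
        have h2 : D e ≠ x := fun h => hex ⟨e, he, h⟩
        omega
      have hT : ∀ i ≤ j, isArrival (fun n => D (i, n)) x = false := by
        intro i hi
        rw [← Bool.not_eq_true, isArrival_iff]
        rintro ⟨n, hn⟩
        exact hex ⟨(i, n), (hl _).2 ⟨by simp only; omega, by omega⟩, hn⟩
      rw [columnRight_eq_left hT, ih' hj, ← hfil]

/-- When the discretization has the same arrivals in the same order, and the coins decide in the same
way, then it has the same paths. -/
lemma leftEdges_eq_edgesAfter {a : ℕ × ℕ → ℝ} (ha : IsGoodArrival a) {D : ℕ × ℕ → ℕ}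
    (hD : ∀ k, Function.Injective fun n => D (k, n)) {q : ℕ × ℕ × ℕ → ℝ} {w : ℕ → ℝ} {t : ℝ}
    {M x : ℕ} {τ : ℝ} (hx : ∀ e, e.1 ≤ M → (D e < x ↔ a e < τ))
    (hord : ∀ e ∈ events a 0 M (Set.Iio τ), ∀ e' ∈ events a 0 M (Set.Iio τ), a e < a e' → D e < D e')
    (hq : ∀ e ∈ events a 0 M (Set.Iio τ), ∀ i ≤ M, (q (e.1, e.2, i) < w i ↔ q (e.1, e.2, i) < t))
    {j : ℕ} (hj : j ≤ M) :
    leftEdges (fun x j => isArrival (fun n => D (j, n)) x)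
        (fun x j => decide (q (coinIndex D (x, j)) < w j)) x j =
      edgesAfter a (keepCoin t q) (Set.Iio τ) j := by
  have hmem : ∀ e, e ∈ events a 0 M (Set.Iio τ) ↔ e.1 < M + 1 ∧ D e < x := by
    intro e
    rw [ha.mem_events bddAbove_Iio, Set.mem_Iio, Nat.add_zero, Nat.lt_succ_iff]
    exact and_congr_right fun h => (hx e h).symm
  have hinj : Set.InjOn D (events a 0 M (Set.Iio τ)) := by
    intro e he e' he' h
    by_contra hne
    rcases lt_or_gt_of_ne (ha.inj.ne hne) with h' | h'
    · exact (hord e he e' he' h').ne h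
    · exact (hord e' he' e he h').ne' h
  rw [leftEdges_eq_applyInOrder hD q w hmem hinj (Nat.lt_succ_of_le hj), edgesAfter,
    ← ha.coord_applyInOrder (isLocal_pathUpdate (keepCoin t q)) bddAbove_Iio hj]
  refine (applyInOrder_rel (fun s s' : ℕ → Bool => ∀ j ≤ M, s' j = s j) ha.inj.injOn
    (fun e he e' he' h => Nat.cast_lt.2 (hord e he e' he' h)) (fun _ _ => rfl) ?_) j hj
  intro e he s s' hs j hj
  refine columnRight_congr (fun _ _ => rfl) (fun i hi _ => ?_) fun i hi => hs i (hi.trans hj)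
  rw [keepCoin, decide_eq_decide]
  exact hq e he i (hi.trans hj)

/-! ### The limit of small columns -/

section Limit

variable {t : ℝ} (ht₁ : t < 1)

/-- Minus the logarithm of the probability that a path goes straight to the right. -/
def turnRate (t c ε : ℝ) : ℝ := Real.log (1 - t * (ε / (1 - t)) * c) - Real.log (1 - ε / (1 - t) * c)

/-- The factor by which the interarrival times are multiplied in the discretization. -/
def columnScale (t c ε : ℝ) : ℝ := c / turnRate t c ε

include ht₁ in
-- The derivative at `ε = 0` is `-t c / (1 - t) + c / (1 - t) = c`; this explains the normalization
-- `a = ε / (1 - t)`.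
lemma tendsto_turnRate_div (c : ℝ) :
    Tendsto (fun ε => turnRate t c ε / ε) (𝓝[>] 0) (𝓝 c) := by
  have ht : (1 - t) ≠ 0 := by linarith
  have h1 : HasDerivAt (fun ε : ℝ => Real.log (1 - t * (ε / (1 - t)) * c))
      (-(t * (1 / (1 - t)) * c) / (1 - t * (0 / (1 - t)) * c)) 0 :=
    (((((hasDerivAt_id (0 : ℝ)).div_const (1 - t)).const_mul t).mul_const c).const_sub 1).log
      (by simp)
  have h2 : HasDerivAt (fun ε : ℝ => Real.log (1 - ε / (1 - t) * c))
      (-(1 / (1 - t) * c) / (1 - 0 / (1 - t) * c)) 0 :=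
    ((((hasDerivAt_id (0 : ℝ)).div_const (1 - t)).mul_const c).const_sub 1).log (by simp)
  have h := (h1.sub h2).tendsto_slope_zero_right
  have hval : -(t * (1 / (1 - t)) * c) / (1 - t * (0 / (1 - t)) * c) -
      -(1 / (1 - t) * c) / (1 - 0 / (1 - t) * c) = c := by
    simp only [zero_div, mul_zero, zero_mul, sub_zero, div_one]
    field_simp
    ring
  rw [hval] at h
  refine h.congr fun ε => ?_
  simp [turnRate, div_eq_inv_mul]

include ht₁ in
lemma tendsto_mul_columnScale {c : ℝ} (hc : 0 < c) :
    Tendsto (fun ε => ε * columnScale t c ε) (𝓝[>] 0) (𝓝 1) := by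
  have h := (tendsto_const_nhds (x := c)).div (tendsto_turnRate_div ht₁ c) hc.ne'
  rw [div_self hc.ne'] at h
  refine h.congr fun ε => ?_
  rw [columnScale, Pi.div_apply, div_div_eq_mul_div]
  ring

include ht₁ in
-- The scale makes the failure probability of the rounded gaps equal to the six vertex weight
-- exactly, not only to first order. Small `ε` ensures `a * c < 1`.
lemma eventually_weightRight {c : ℝ} (hc : 0 < c) : ∀ᶠ ε in 𝓝[>] (0 : ℝ),
    0 ≤ weightRight t (ε / (1 - t)) c ∧ weightRight t (ε / (1 - t)) c ≤ 1 ∧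
      0 < columnScale t c ε ∧
      Real.exp (-(c / columnScale t c ε)) = weightRight t (ε / (1 - t)) c := by
  have ht : 0 < 1 - t := by linarith
  have h1 : ∀ᶠ ε in 𝓝[>] (0 : ℝ), ε < (1 - t) / c :=
    nhdsWithin_le_nhds (gt_mem_nhds (by positivity))
  filter_upwards [h1, self_mem_nhdsWithin] with ε h1 h0
  have h0 : 0 < ε := h0
  have hac0 : 0 < ε / (1 - t) * c := by positivity
  have hac1 : ε / (1 - t) * c < 1 := by
    rw [lt_div_iff₀ hc] at h1
    rw [div_mul_eq_mul_div, div_lt_one ht]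
    exact h1
  have htac : t * (ε / (1 - t)) * c < ε / (1 - t) * c := by
    rw [mul_assoc]
    exact mul_lt_of_lt_one_left hac0 ht₁
  have hd : 0 < 1 - t * (ε / (1 - t)) * c := by linarith
  have hn : 0 < 1 - ε / (1 - t) * c := by linarith
  have hrate : 0 < turnRate t c ε := sub_pos.2 (Real.log_lt_log hn (by linarith))
  refine ⟨div_nonneg hn.le hd.le, (div_le_one hd).2 (by linarith), div_pos hc hrate, ?_⟩
  rw [columnScale, div_div_cancel₀ hc.ne', turnRate, neg_sub, Real.exp_sub, Real.exp_log hn,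
    Real.exp_log hd, weightRight]

lemma tendsto_weightUp (c : ℝ) :
    Tendsto (fun ε => weightUp t (ε / (1 - t)) c) (𝓝[>] 0) (𝓝 t) := by
  have h : ContinuousAt (fun ε => weightUp t (ε / (1 - t)) c) 0 := by
    unfold weightUp
    refine ContinuousAt.div (by fun_prop) (by fun_prop) (by simp)
  have h0 : weightUp t (0 / (1 - t)) c = t := by simp [weightUp]
  have := h.tendsto
  rw [h0] at this
  exact this.mono_left nhdsWithin_le_nhds

variable {c : ℕ → ℝ} (hc : ∀ k, 0 < c k)

include ht₁ hc in
-- Rounding moves each gap by at most one column of width `ε`, and the shift `n` contributes only `ε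
-- n`.
lemma tendsto_mul_arrivalColumns {g : ℕ × ℕ → ℝ} (hg : ∀ p, 0 < g p) (e : ℕ × ℕ) :
    Tendsto (fun ε => ε * (arrivalColumns (fun j => columnScale t (c j) ε) g e : ℝ)) (𝓝[>] 0)
      (𝓝 (arrivalTime g e)) := by
  have hid : Tendsto (fun ε : ℝ => ε) (𝓝[>] 0) (𝓝 0) :=
    tendsto_id.mono_left nhdsWithin_le_nhds
  have hfloor : ∀ i, Tendsto (fun ε => ε * (⌊g (e.1, i) * columnScale t (c e.1) ε⌋₊ : ℝ)) (𝓝[>] 0)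
      (𝓝 (g (e.1, i))) := by
    intro i
    have h1 : Tendsto (fun ε => g (e.1, i) * (ε * columnScale t (c e.1) ε)) (𝓝[>] 0)
        (𝓝 (g (e.1, i))) := by
      simpa using (tendsto_mul_columnScale ht₁ (hc e.1)).const_mul (g (e.1, i))
    have h2 : Tendsto (fun ε => g (e.1, i) * (ε * columnScale t (c e.1) ε) - ε) (𝓝[>] 0)
        (𝓝 (g (e.1, i))) := by
      simpa using h1.sub hid
    have hpos := (tendsto_mul_columnScale ht₁ (hc e.1)).eventually_const_lt one_pos
    refine tendsto_of_tendsto_of_tendsto_of_le_of_le' h2 h1 ?_ ?_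
    · filter_upwards [self_mem_nhdsWithin] with ε (hε : 0 < ε)
      have := mul_le_mul_of_nonneg_left
        (Nat.lt_floor_add_one (g (e.1, i) * columnScale t (c e.1) ε)).le hε.le
      linarith
    · filter_upwards [self_mem_nhdsWithin, hpos] with ε (hε : 0 < ε) hpos
      have hs : 0 < columnScale t (c e.1) ε := (mul_pos_iff_of_pos_left hε).1 hpos
      have := mul_le_mul_of_nonneg_left
        (Nat.floor_le (mul_pos (hg (e.1, i)) hs).le) hε.le
      linarith
  have hsum := (hid.mul_const (e.2 : ℝ)).add
    (tendsto_finsetSum (Finset.range (e.2 + 1)) fun i _ => hfloor i)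
  rw [zero_mul, zero_add] at hsum
  refine hsum.congr fun ε => ?_
  rw [arrivalColumns, arrivalColumn, Nat.cast_add, Nat.cast_sum, mul_add, Finset.mul_sum]

include ht₁ hc in
-- For almost every noise no arrival is at `τ`, no two coincide and no coin equals `t`. Finitely
-- many strict inequalities then fix the arrivals before `τ`, their order and the coin decisions,
-- and they persist for small `ε`.
lemma eventually_leftEdges_eq {g : ℕ × ℕ → ℝ} (hg : ∀ p, 0 < g p)
    (ha : IsGoodArrival (arrivalTime g)) {q : ℕ × ℕ × ℕ → ℝ} (hq : ∀ i, q i ≠ t) {τ : ℝ}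
    (hτ : ∀ e, arrivalTime g e ≠ τ) (M : ℕ) : ∀ᶠ ε in 𝓝[>] (0 : ℝ), ∀ j ≤ M,
      leftEdges (turnChoice (fun j => columnScale t (c j) ε) g)
        (keepChoice (fun j => columnScale t (c j) ε)
          (fun j => weightUp t (ε / (1 - t)) (c j)) (g, q)) (⌈τ / ε⌉₊ - 1) j =
      edgesAfter (arrivalTime g) (keepCoin t q) (Set.Iio τ) j := by
  set E := events (arrivalTime g) 0 M (Set.Iio τ) with hE
  have hmem : ∀ e, e ∈ E ↔ e.1 ≤ M ∧ arrivalTime g e < τ := fun e => ha.mem_events bddAbove_Iio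
  have hlim := tendsto_mul_arrivalColumns ht₁ hc hg
  have hpos : ∀ᶠ ε in 𝓝[>] (0 : ℝ), 0 < ε := self_mem_nhdsWithin
  have h1 : ∀ᶠ ε in 𝓝[>] (0 : ℝ), ∀ e ∈ E,
      arrivalColumns (fun j => columnScale t (c j) ε) g e < ⌈τ / ε⌉₊ - 1 := by
    rw [eventually_all_finset]
    intro e he
    have hid : Tendsto (fun ε : ℝ => ε) (𝓝[>] 0) (𝓝 0) :=
      tendsto_id.mono_left nhdsWithin_le_nhds
    -- The additional `ε` accounts for the `- 1`: column `x` is placed at `ε (x + 1)`.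
    have h := (hlim e).add hid
    rw [add_zero] at h
    filter_upwards [h.eventually_lt_const ((hmem e).1 he).2, hpos] with ε h hε
    have h' : ((arrivalColumns (fun j => columnScale t (c j) ε) g e + 1 : ℕ) : ℝ) < τ / ε := by
      rw [lt_div_iff₀ hε]
      push_cast
      linarith
    have := Nat.lt_ceil.2 h'
    omega
  -- Infinitely many arrivals come after `τ`; as columns increase along a process, only the first of
  -- them in each row has to be controlled.
  have h2 : ∀ᶠ ε in 𝓝[>] (0 : ℝ), ∀ k ∈ Finset.range (M + 1), ∀ n, τ ≤ arrivalTime g (k, n) →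
      ⌈τ / ε⌉₊ ≤ arrivalColumns (fun j => columnScale t (c j) ε) g (k, n) := by
    rw [eventually_all_finset]
    intro k _
    classical
    have hex : ∃ n, τ ≤ arrivalTime g (k, n) := ((ha.tendsto k).eventually_ge_atTop τ).exists
    have hlt : τ < arrivalTime g (k, Nat.find hex) :=
      lt_of_le_of_ne (Nat.find_spec hex) (hτ _).symm
    filter_upwards [(hlim (k, Nat.find hex)).eventually_const_lt hlt, hpos] with ε h hε n hn
    have hle : Nat.find hex ≤ n := Nat.find_min' hex hn
    refine le_trans (Nat.ceil_le.2 ?_) ((strictMono_arrivalColumn _ _).monotone hle)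
    rw [div_le_iff₀ hε, mul_comm]
    exact h.le
  have h3 : ∀ᶠ ε in 𝓝[>] (0 : ℝ), ∀ e ∈ E, ∀ e' ∈ E, arrivalTime g e < arrivalTime g e' →
      arrivalColumns (fun j => columnScale t (c j) ε) g e <
        arrivalColumns (fun j => columnScale t (c j) ε) g e' := by
    simp only [eventually_all_finset]
    intro e _ e' _
    by_cases hlt : arrivalTime g e < arrivalTime g e'
    · filter_upwards [(hlim e).eventually_lt (hlim e') hlt, hpos] with ε h hε _
      exact Nat.cast_lt.1 (lt_of_mul_lt_mul_left h hε.le)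
    · exact Eventually.of_forall fun _ h => absurd h hlt
  have h4 : ∀ᶠ ε in 𝓝[>] (0 : ℝ), ∀ e ∈ E, ∀ i ∈ Finset.range (M + 1),
      (q (e.1, e.2, i) < weightUp t (ε / (1 - t)) (c i) ↔ q (e.1, e.2, i) < t) := by
    simp only [eventually_all_finset]
    intro e _ i _
    rcases lt_or_gt_of_ne (hq (e.1, e.2, i)) with h | h
    · filter_upwards [(tendsto_weightUp (t := t) (c i)).eventually_const_lt h] with ε hε
      exact iff_of_true hε h
    · filter_upwards [(tendsto_weightUp (t := t) (c i)).eventually_lt_const h] with ε hε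
      exact iff_of_false (not_lt.2 hε.le) (not_lt.2 h.le)
  filter_upwards [h1, h2, h3, h4] with ε h1 h2 h3 h4 j hj
  refine leftEdges_eq_edgesAfter ha (injective_arrivalColumns _ g) ?_ h3
    (fun e he i hi => h4 e he i (Finset.mem_range.2 (by omega))) hj
  rintro ⟨k, n⟩ hk
  refine ⟨fun h => ?_, fun h => h1 _ ((hmem _).2 ⟨hk, h⟩)⟩
  by_contra hle
  have := h2 k (Finset.mem_range.2 (Nat.lt_succ_of_le hk)) n (not_lt.1 hle)
  omega

include ht₁ hc in
/-- The finite-dimensional distributions of the discretized half-continuous model are those of the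
stochastic six vertex model. -/
lemma eventually_vertexLaw_eq {d : ℕ} (x : ℝ → Fin d → ℕ) (y h : Fin d → ℕ) :
    ∀ᶠ ε in 𝓝[>] (0 : ℝ), vertexLaw
        {u | ∀ i, sixVertexHeight t (fun _ => ε / (1 - t)) c u (x ε i) (y i) = h i} =
      noiseLaw c {z | ∀ i, heightOf (leftEdges (turnChoice (fun j => columnScale t (c j) ε) z.1)
        (keepChoice (fun j => columnScale t (c j) ε)
          (fun j => weightUp t (ε / (1 - t)) (c j)) z) (x ε i)) (y i) = h i} := by
  set M := Finset.univ.sup y with hM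
  have hy : ∀ i, y i ≤ M := fun i => Finset.le_sup (Finset.mem_univ i)
  have hev : ∀ᶠ ε in 𝓝[>] (0 : ℝ), ∀ j ∈ Finset.range M,
      0 ≤ weightRight t (ε / (1 - t)) (c j) ∧ weightRight t (ε / (1 - t)) (c j) ≤ 1 ∧
      0 < columnScale t (c j) ε ∧
      Real.exp (-(c j / columnScale t (c j) ε)) = weightRight t (ε / (1 - t)) (c j) := by
    rw [eventually_all_finset]
    exact fun j _ => eventually_weightRight ht₁ (hc j)
  filter_upwards [hev] with ε hε
  replace hε := fun j (hj : j < M) => hε j (Finset.mem_range.2 hj)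
  set X := Finset.univ.sup (x ε) with hX
  have hx : ∀ i, x ε i < X + 1 := fun i =>
    Nat.lt_succ_of_le (Finset.le_sup (f := x ε) (Finset.mem_univ i))
  -- The heights involve only rows below `M` and columns up to `X`, so the event is one about a
  -- finite table of edges.
  let S : Set (Fin (X + 1) → Fin M → Bool) := {s | ∀ i,
    heightOf (fun j => if hj : j < M then s ⟨x ε i, hx i⟩ ⟨j, hj⟩ else false) (y i) = h i}
  have hS : ∀ T K : ℕ → ℕ → Bool,
      (fun (x : Fin (X + 1)) (j : Fin M) => leftEdges T K x j) ∈ S ↔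
        ∀ i, heightOf (leftEdges T K (x ε i)) (y i) = h i := by
    intro T K
    refine forall_congr' fun i => ?_
    rw [heightOf_congr fun j hj => dif_pos (lt_of_lt_of_le hj (hy i))]
  have hm1 : ∀ x j, Measurable fun u : ℕ × ℕ → ℝ =>
      decide (weightRight t (ε / (1 - t)) (c j) ≤ u (x, j)) := by
    intro x j
    refine measurable_to_bool ?_
    have : (fun u : ℕ × ℕ → ℝ => decide (weightRight t (ε / (1 - t)) (c j) ≤ u (x, j))) ⁻¹' {true} =
        {u | weightRight t (ε / (1 - t)) (c j) ≤ u (x, j)} := by ext; simp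
    rw [this]
    exact measurableSet_le measurable_const (measurable_pi_apply _)
  have hcongr := measure_leftEdges_congr (μ := vertexLaw) (μ' := noiseLaw c)
    (T := fun u x j => decide (weightRight t (ε / (1 - t)) (c j) ≤ u (x, j)))
    (K := fun u x j => decide (u (x, j) < weightUp t (ε / (1 - t)) (c j)))
    (T' := fun z => turnChoice (fun j => columnScale t (c j) ε) z.1)
    (K' := fun z => keepChoice (fun j => columnScale t (c j) ε)
      (fun j => weightUp t (ε / (1 - t)) (c j)) z) hm1
    (fun x j => measurable_decide_lt (measurable_pi_apply _) measurable_const)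
    (fun x j => (measurable_turnChoice _ x j).comp measurable_fst)
    (fun x j => measurable_keepChoice _ _ x j) X M ?_ S
  · simp only [hS] at hcongr
    simpa only [sixVertexHeight, horizontalEdge_eq_leftEdges] using hcongr
  · intro A B hAB
    rw [vertexLaw_choices_mem (a := fun _ => ε / (1 - t)) X M
      (fun _ _ j hj => ⟨(hε j hj).1, (hε j hj).2.1⟩) A B hAB,
      noiseLaw_choices_mem hc (fun j hj => (hε j hj).2.2.1) _ A B]
    refine Finset.prod_congr rfl fun v hv => ?_
    rw [Finset.mem_product, Finset.mem_range, Finset.mem_range] at hv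
    rw [(hε v.2 hv.2).2.2.2]

include ht₁ hc in
-- The six vertex probability is that of the coupled discretization, whose indicator converges
-- almost surely; bounded convergence gives the limit.
lemma tendsto_sixVertexHeight {Ω : Type*} [MeasurableSpace Ω] (μ : Measure Ω)
    [IsProbabilityMeasure μ] (X : HalfContinuousSixVertex t c μ) (d : ℕ) (τ : Fin d → ℝ≥0)
    (y h : Fin d → ℕ) :
    Tendsto
      (fun ε : ℝ => vertexLaw.real
        {u | ∀ i, sixVertexHeight t (fun _ => ε / (1 - t)) c u (⌈(τ i : ℝ) / ε⌉₊ - 1) (y i) = h i})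
      (𝓝[>] 0)
      (𝓝 (μ.real {ω | ∀ i, X.height ω (τ i) (y i) = h i})) := by
  have := fun k => isProbabilityMeasure_expMeasure (hc k)
  have hall : ∀ {Z : Type} [MeasurableSpace Z] {f : Z → Fin d → ℕ},
      (∀ i, Measurable fun z => f z i) → MeasurableSet {z | ∀ i, f z i = h i} := by
    intro Z _ f hf
    have : {z | ∀ i, f z i = h i} = ⋂ i, {z | f z i = h i} := by ext z; simp
    rw [this]
    exact MeasurableSet.iInter fun i => hf i (measurableSet_singleton (h i))
  have hmeas : MeasurableSet {z : (ℕ × ℕ → ℝ) × (ℕ × ℕ × ℕ → ℝ) |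
      ∀ i, noiseHeight t (Set.Iio (τ i : ℝ)) z (y i) = h i} :=
    hall fun i => measurable_noiseHeight t measurableSet_Iio (y i)
  have hX : μ {ω | ∀ i, X.height ω (τ i) (y i) = h i} =
      noiseLaw c {z | ∀ i, noiseHeight t (Set.Iio (τ i : ℝ)) z (y i) = h i} := by
    rw [← X.noise.map_noise, Measure.map_apply X.noise.measurable_noise hmeas]
    refine measure_congr ?_
    filter_upwards [X.ae_height_eq hc] with ω hω
    exact propext (forall_congr' fun i => by rw [hω])
  have hlim : Tendsto (fun ε => noiseLaw c {z | ∀ i, heightOf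
      (leftEdges (turnChoice (fun j => columnScale t (c j) ε) z.1)
        (keepChoice (fun j => columnScale t (c j) ε)
          (fun j => weightUp t (ε / (1 - t)) (c j)) z) (⌈(τ i : ℝ) / ε⌉₊ - 1)) (y i) = h i})
      (𝓝[>] 0)
      (𝓝 (noiseLaw c {z | ∀ i, noiseHeight t (Set.Iio (τ i : ℝ)) z (y i) = h i})) := by
    refine tendsto_measure_of_ae_tendsto_indicator_of_isFiniteMeasure _ hmeas (fun ε => ?_) ?_
    · exact hall fun i => measurable_heightOf (fun j => measurable_leftEdges
        (fun x j => (measurable_turnChoice _ x j).comp measurable_fst)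
        (fun x j => measurable_keepChoice _ _ x j) _ j) (y i)
    · filter_upwards [ae_noiseLaw_fst (ae_isGoodArrival hc), ae_noiseLaw_fst (ae_pos_gapLaw hc),
        ae_noiseLaw_snd (c := c) (ae_coinLaw t),
        ae_noiseLaw_fst (ae_all_iff.2 fun i => ae_all_iff.2 fun e =>
          ae_arrivalTime_ne (c := c) e (τ i : ℝ))] with z ha hg hq hτ
      have hev : ∀ᶠ ε in 𝓝[>] (0 : ℝ), ∀ i, ∀ j ≤ y i, _ := eventually_all.2 fun i =>
        eventually_leftEdges_eq ht₁ hc hg ha (fun k => (hq k).2) (hτ i) (y i)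
      filter_upwards [hev] with ε hε
      refine forall_congr' fun i => ?_
      rw [noiseHeight, heightOf_congr fun j hj => hε i j hj.le]
  rw [Measure.real, hX]
  refine ((ENNReal.tendsto_toReal (measure_ne_top _ _)).comp hlim).congr' ?_
  filter_upwards [eventually_vertexLaw_eq ht₁ hc (fun ε i => ⌈(τ i : ℝ) / ε⌉₊ - 1) y h]
    with ε hε
  rw [Function.comp_apply, ← hε, Measure.real]

end Limit

end

theorem mainTheorem5 (t : ℝ) (ht₀ : 0 < t) (ht₁ : t < 1) (b c : ℕ → ℝ)
    (hc : ∀ k, 0 < c k) (hbc : ∀ k, b k = c k) :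
    -- both models exist
    (∃ (Ω : Type) (_ : MeasurableSpace Ω) (μ : Measure Ω),
      IsProbabilityMeasure μ ∧ Nonempty (HalfContinuousSixVertex t b μ)) ∧
    (∃ (Ω : Type) (_ : MeasurableSpace Ω) (ν : Measure Ω),
      IsProbabilityMeasure ν ∧ Nonempty (HallLittlewoodRSK t c ν)) ∧
    -- the half-continuous model is the limit of the stochastic six vertex models with
    -- all `a_x = ε / (1 - t)` and the column number `x` placed at `ε (x + 1)`
    (∀ {Ω : Type*} [MeasurableSpace Ω] (μ : Measure Ω) [IsProbabilityMeasure μ]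
      (X : HalfContinuousSixVertex t b μ) (d : ℕ) (τ : Fin d → ℝ≥0) (y h : Fin d → ℕ),
      Tendsto
        (fun ε : ℝ => vertexLaw.real
          {u | ∀ i, sixVertexHeight t (fun _ => ε / (1 - t)) b u (⌈(τ i : ℝ) / ε⌉₊ - 1) (y i) = h i})
        (𝓝[>] 0)
        (𝓝 (μ.real {ω | ∀ i, X.height ω (τ i) (y i) = h i}))) ∧
    -- the random fields `h(τ, y)` and `y - l(τ, y)` are identically distributed
    (∀ {Ω Ω' : Type*} [MeasurableSpace Ω] [MeasurableSpace Ω'] (μ : Measure Ω) (ν : Measure Ω')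
      [IsProbabilityMeasure μ] [IsProbabilityMeasure ν]
      (X : HalfContinuousSixVertex t b μ) (Y : HallLittlewoodRSK t c ν),
      IdentDistrib
        (fun ω (p : ℝ≥0 × ℕ) => (X.height ω p.1 p.2 : ℤ))
        (fun ω (p : ℝ≥0 × ℕ) => (p.2 : ℤ) - (Y.firstColumn ω p.1 p.2 : ℤ)) μ ν) := by
  obtain rfl : b = c := funext hbc
  exact ⟨exists_halfContinuousSixVertex hc, exists_hallLittlewoodRSK hc,
    fun μ _ X d τ y h => tendsto_sixVertexHeight ht₁ hc μ X d τ y h,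
    fun _ _ _ _ X Y => identDistrib_height_firstColumn ht₁ hc X Y⟩
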